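/- Let $b>0$ with $\sin\pi b^2\neq0$, and put $Q=b+b^{-1}$. **Double sine function.** For $0<\mathrm{Re}\,x<Q$ let $S_b(x)=e^{\ell_b(x)}$ with $$\ell_b(x)=\int_0^\infty\frac{dt}{t}\Big(\frac{2x-Q}{2t}-\frac{\sinh((2x-Q)t)}{2\sinh(bt)\sinh(t/b)}\Big),$$ continued meromorphically to $\mathbb C$ by $S_b(x+b)=2\sin(\pi bx)S_b(x)$. On the strip $0<\mathrm{Re}\,x<Q$ put $S_b(x)^{1/2}:=e^{\ell_b(x)/2}$ (the holomorphic branch that is positive for real $x$). Let $D_{\mathrm i\alpha}(x)=\dfrac{S_b(Q/2-\mathrm ix+\alpha)}{S_b(Q/2-\mathrm ix-\alpha)}$ and $\Delta_\alpha=\alpha(Q-\alpha)$. **Representation spaces.** For $\alpha=Q/2+\mathrm is$, $s\in\mathbb R$, let $\mathsf p=(2\pi\mathrm i)^{-1}d/dx$ and let $\mathcal P_\alpha\subset L^2(\mathbb R)$ be the largest subspace that is contained in the domains of, and preserved by, $\mathsf E_\alpha=e^{\pi b\mathsf x}\frac{\cosh\pi b(\mathsf p-s)}{\sin\pi b^2}e^{\pi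 b\mathsf x}$, $\mathsf F_\alpha=e^{-\pi b\mathsf x}\frac{\cosh\pi b(\mathsf p+s)}{\sin\pi b^2}e^{-\pi b\mathsf x}$, $\mathsf K_\alpha=e^{-\pi b\mathsf p}$ and $\mathsf K_\alpha^{-1}$. Tensor products are algebraic, and their elements are written as functions $\psi(x_2,x_1)$. **Clebsch–Gordan coefficients.** Let $$\big({}^{\alpha_3}_{x_3}|{}^{\alpha_2}_{x_2}{}^{\alpha_1}_{x_1}\big)^{\rm an}_b=e^{-\pi\mathrm i(\Delta_{\alpha_3}-\Delta_{\alpha_1}-\Delta_{\alpha_2})/2}\,D_{-\frac{\mathrm i}{2}(\alpha_1+\alpha_2+\alpha_3-Q)}\big(x_2-x_1-\tfrac{\mathrm i\alpha_3}{2}\big)\,D_{-\frac{\mathrm i}{2}(Q+\alpha_2-\alpha_3-\alpha_1)}\big(x_2-x_3-\tfrac{\mathrm i\alpha_1}{2}\big)\,D_{-\frac{\mathrm i}{2}(Q+\alpha_1-\alpha_3-\alpha_2)}\big(x_3-x_1-\tfrac{\mathrm i\alpha_2}{2}\big)$$ and $\big({}^{\alpha_3}_{x_3}|{}^{\alpha_2}_{x_2}{}^{\alpha_1}_{x_1}\big)_b=M(\alpha_3,\alpha_2,\alpha_1)\big({}^{\alpha_3}_{x_3}|{}^{\alpha_2}_{x_2}{}^{\alpha_1}_{x_1}\big)^{\rm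 an}_b$, where $$M(\alpha_3,\alpha_2,\alpha_1)=\big(S_b(2Q-\alpha_1-\alpha_2-\alpha_3)\,S_b(Q-\alpha_1-\alpha_2+\alpha_3)\,S_b(\alpha_1+\alpha_3-\alpha_2)\,S_b(\alpha_2+\alpha_3-\alpha_1)\big)^{-1/2},$$ the root being taken factor by factor with the branch above. **Maps.** For $\alpha,\alpha_k\in Q/2+\mathrm i\mathbb R$ the kernels are singular at real arguments and are understood as boundary values: $$(\mathsf C^{\alpha_3}_{\alpha_2,\alpha_1}\psi)(x_3)=\lim_{\varepsilon\to0^+}\int_{\mathbb R^2}dx_1dx_2\,\big({}^{\alpha_3}_{x_3}|{}^{\ \ \alpha_2}_{x_2+\mathrm i\varepsilon}\,{}^{\ \ \alpha_1}_{x_1-\mathrm i\varepsilon}\big)_b\,\psi(x_2,x_1),$$ $$(\mathsf R_\alpha f)(x)=\lim_{\varepsilon\to0^+}S_b(2(\alpha-\varepsilon))\int_{\mathbb R}dx'\,D_{-\mathrm i(\alpha-\varepsilon)}(x-x')f(x').$$ **Claim 1 (Weyl invariance).** Let $\alpha_1,\alpha_2,\alpha_3\in Q/2+\mathrm i\mathbb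 R$. Then $$\mathsf C^{\alpha_3}_{\alpha_2,\alpha_1}(1\otimes\mathsf R_{Q-\alpha_1})=\mathsf C^{\alpha_3}_{\alpha_2,Q-\alpha_1}\ \text{ on }\mathcal P_{\alpha_2}\otimes\mathcal P_{Q-\alpha_1},$$ $$\mathsf C^{\alpha_3}_{\alpha_2,\alpha_1}(\mathsf R_{Q-\alpha_2}\otimes1)=\mathsf C^{\alpha_3}_{Q-\alpha_2,\alpha_1}\ \text{ on }\mathcal P_{Q-\alpha_2}\otimes\mathcal P_{\alpha_1},$$ $$\mathsf R_{\alpha_3}\mathsf C^{\alpha_3}_{\alpha_2,\alpha_1}=\mathsf C^{Q-\alpha_3}_{\alpha_2,\alpha_1}\ \text{ on }\mathcal P_{\alpha_2}\otimes\mathcal P_{\alpha_1}.$$ Both sides are functions on $\mathbb R$ and agree at every point. All limits involved exist, and the integrals under them converge absolutely for all small $\varepsilon>0$. **Claim 2 (kernel identity).** Put $\bar\alpha=Q-\alpha$. For all complex $\alpha_1,\alpha_2,\alpha_3,x_1,x_2,x_3$ such that the numbers $$Q-\tfrac{\alpha_1+\alpha_2}2-\alpha_3-\mathrm ix_2,\quad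 Q-\tfrac{\alpha_1+\alpha_2}2+\mathrm ix_2,\quad \tfrac{\alpha_3-\alpha_1}2-\mathrm ix_3,\quad \alpha_2+\tfrac{\alpha_3-\alpha_1}2+\mathrm ix_3,\quad \alpha_1-\tfrac Q2-\mathrm ix_1,\quad \alpha_1-\tfrac Q2+\mathrm ix_1$$ all have positive real part (so that the real line separates the two families of poles of the integrand), the following integral converges absolutely and $$S_b(2\bar\alpha_1)\int_{\mathbb R}dx_1'\,\big({}^{\alpha_3}_{x_3}|{}^{\alpha_2}_{x_2}{}^{\alpha_1}_{x_1'}\big)^{\rm an}_b D_{-\mathrm i\bar\alpha_1}(x_1'-x_1)=S_b(\alpha_2+\alpha_3-\alpha_1)\,S_b(2Q-\alpha_1-\alpha_2-\alpha_3)\,\big({}^{\alpha_3}_{x_3}|{}^{\alpha_2}_{x_2}{}^{\bar\alpha_1}_{x_1}\big)^{\rm an}_b$$ (where both sides share a common singular factor $S_b\big(\tfrac{\alpha_3-\alpha_2}{2}-\mathrm i(x_2-x_3)\big)$, at whose poles the identity is read with that factor removed or set to any common value). -/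

import Mathlib

open MeasureTheory Filter Topology FourierTransform

noncomputable section

namespace ModularDouble

/-- `Q = b + b⁻¹`. -/
def Q (b : ℝ) : ℝ := b + b⁻¹

/-! ### The double sine function -/

/-- The logarithm of the double sine function on the strip `0 < Re x < Q`,
`log S_b(x) = ∫₀^∞ (dt/t) [ (2x-Q)/(2t) - sinh((2x-Q)t) / (2 sinh(bt) sinh(t/b)) ]`.
It is the holomorphic branch that is real for real `x`, and it vanishes at `x = Q/2`.
In terms of `s_b(z) = exp (i ∫₀^∞ (dt/t) [ sin(2tz) / (2 sinh(bt) sinh(t/b)) - z/t ])` one has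
`S_b(x) = s_b(ix - iQ/2)`; moreover `S_b(x) = Γ_b(x) / Γ_b(Q-x)`. -/
def logSb (b : ℝ) (x : ℂ) : ℂ :=
  ∫ t in Set.Ioi (0 : ℝ),
    ((2 * x - Q b) / (2 * t)
      - Complex.sinh ((2 * x - Q b) * t) / (2 * Real.sinh (b * t) * Real.sinh (t / b))) / t

/-- The double sine function `S_b` on the whole plane: the exponential of `logSb` on the strip
`0 < Re x < Q`, continued by the functional equation `S_b(x + b) = 2 sin(π b x) S_b(x)`.
(At the poles `x = -nb - m/b` the value is `0` by the convention `z / 0 = 0`.) -/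
def Sb (b : ℝ) (x : ℂ) : ℂ :=
  if 0 < x.re ∧ x.re < Q b then Complex.exp (logSb b x)
  else if Q b ≤ x.re then
    (∏ k ∈ Finset.range (⌊(x.re - Q b) / b⌋₊ + 1),
        2 * Complex.sin (Real.pi * b * (x - (k + 1) * b)))
      * Complex.exp (logSb b (x - (⌊(x.re - Q b) / b⌋₊ + 1 : ℕ) * b))
  else
    Complex.exp (logSb b (x + (⌊-x.re / b⌋₊ + 1 : ℕ) * b))
      / ∏ k ∈ Finset.range (⌊-x.re / b⌋₊ + 1), 2 * Complex.sin (Real.pi * b * (x + k * b))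

/-- The square root of `S_b` on the strip `0 < Re x < Q`: the holomorphic branch that is positive
for real `x`. -/
def sqrtSb (b : ℝ) (x : ℂ) : ℂ := Complex.exp (logSb b x / 2)

/-- `D_β(x)`, with `D_{iα}(x) = S_b(Q/2 - ix + α) / S_b(Q/2 - ix - α)`, that is `α = -iβ`. -/
def D (b : ℝ) (β x : ℂ) : ℂ :=
  Sb b (Q b / 2 - Complex.I * x - Complex.I * β) / Sb b (Q b / 2 - Complex.I * x + Complex.I * β)

/-! ### Clebsch-Gordan coefficients -/

/-- `Δ_α = α (Q - α)`. -/
def confDim (b : ℝ) (α : ℂ) : ℂ := α * (Q b - α)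

/-- The Clebsch-Gordan coefficient `(α₃ x₃ | α₂ x₂ α₁ x₁)_b^an`, at complex `x₃, x₂, x₁`. -/
def cgAn (b : ℝ) (α₃ α₂ α₁ x₃ x₂ x₁ : ℂ) : ℂ :=
  Complex.exp (-(Real.pi * Complex.I * (confDim b α₃ - confDim b α₁ - confDim b α₂) / 2))
    * D b (-(Complex.I / 2) * (α₁ + α₂ + α₃ - Q b)) (x₂ - x₁ - Complex.I * (α₃ / 2))
    * D b (-(Complex.I / 2) * (Q b + α₂ - α₃ - α₁)) (x₂ - x₃ - Complex.I * (α₁ / 2))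
    * D b (-(Complex.I / 2) * (Q b + α₁ - α₃ - α₂)) (x₃ - x₁ - Complex.I * (α₂ / 2))

/-- The normalization factor
`M(α₃,α₂,α₁) = (S_b(2Q-α₁-α₂-α₃) S_b(Q-α₁-α₂+α₃) S_b(α₁+α₃-α₂) S_b(α₂+α₃-α₁))^{-1/2}`,
with the branch of the root given by `sqrtSb` in each factor. -/
def M (b : ℝ) (α₃ α₂ α₁ : ℂ) : ℂ :=
  (sqrtSb b (2 * Q b - α₁ - α₂ - α₃) * sqrtSb b (Q b - α₁ - α₂ + α₃)
    * sqrtSb b (α₁ + α₃ - α₂) * sqrtSb b (α₂ + α₃ - α₁))⁻¹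

/-- The normalized Clebsch-Gordan coefficient `(α₃ x₃ | α₂ x₂ α₁ x₁)_b`. -/
def cg (b : ℝ) (α₃ α₂ α₁ x₃ x₂ x₁ : ℂ) : ℂ :=
  M b α₃ α₂ α₁ * cgAn b α₃ α₂ α₁ x₃ x₂ x₁

/-! ### The representation spaces `P_α` -/

/-- The Hilbert space `L²(ℝ)`. -/
abbrev L2 : Type := Lp (α := ℝ) ℂ 2 volume

/-- The graph of the maximal operator of multiplication by `m(x)` in `L²(ℝ)`. -/
def PosGraph (m : ℝ → ℂ) (f g : L2) : Prop :=
  (g : ℝ → ℂ) =ᵐ[volume] fun x => m x * f x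

/-- The graph of the operator `m(p)`, where `p = (2πi)⁻¹ d/dx`: multiplication by `m` on the
Fourier side. -/
def MomGraph (m : ℝ → ℂ) (f g : L2) : Prop := PosGraph m (𝓕 f) (𝓕 g)

/-- The parameter `s` in `α = Q/2 + i s`. -/
def spin (b : ℝ) (α : ℂ) : ℂ := -Complex.I * (α - Q b / 2)

/-- The graph of `E_α = e^{πbx} (cosh πb(p - s) / sin πb²) e^{πbx}`. -/
def GraphE (b : ℝ) (α : ℂ) (f g : L2) : Prop :=
  ∃ u v : L2, PosGraph (fun x => Complex.exp (Real.pi * b * x)) f u ∧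
    MomGraph (fun k => Complex.cosh (Real.pi * b * (k - spin b α)) / Real.sin (Real.pi * b ^ 2))
      u v ∧
    PosGraph (fun x => Complex.exp (Real.pi * b * x)) v g

/-- The graph of `F_α = e^{-πbx} (cosh πb(p + s) / sin πb²) e^{-πbx}`. -/
def GraphF (b : ℝ) (α : ℂ) (f g : L2) : Prop :=
  ∃ u v : L2, PosGraph (fun x => Complex.exp (-(Real.pi * b * x))) f u ∧
    MomGraph (fun k => Complex.cosh (Real.pi * b * (k + spin b α)) / Real.sin (Real.pi * b ^ 2))
      u v ∧
    PosGraph (fun x => Complex.exp (-(Real.pi * b * x))) v g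

/-- The graph of `K_α = e^{-πbp}`. -/
def GraphK (b : ℝ) (f g : L2) : Prop :=
  MomGraph (fun k => Complex.exp (-(Real.pi * b * k))) f g

/-- A subspace of `L²(ℝ)` contained in the domains of `E_α`, `F_α`, `K_α`, `K_α⁻¹` and mapped into
itself by these operators. -/
def IsInvariant (b : ℝ) (α : ℂ) (V : Submodule ℂ L2) : Prop :=
  ∀ f ∈ V, (∃ g ∈ V, GraphE b α f g) ∧ (∃ g ∈ V, GraphF b α f g) ∧
    (∃ g ∈ V, GraphK b f g) ∧ (∃ g ∈ V, GraphK b g f)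

/-- `P_α`: the maximal subspace of `L²(ℝ)` on which all polynomials in `E_α`, `F_α`, `K_α^{±1}`
are defined. -/
def P (b : ℝ) (α : ℂ) : Submodule ℂ L2 := sSup {V | IsInvariant b α V}

/-- The algebraic tensor product `P_{α₂} ⊗ P_{α₁}`, realized as functions `ψ(x₂, x₁)`. -/
def PTensor (b : ℝ) (α₂ α₁ : ℂ) : Submodule ℂ (ℝ → ℝ → ℂ) :=
  Submodule.span ℂ {ψ | ∃ f ∈ P b α₂, ∃ g ∈ P b α₁, ψ = fun x₂ x₁ => f x₂ * g x₁}

/-! ### The reflection operators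

For `Re α = Q/2` the kernel `D_{-iα}(x - x')` has poles on the real line (and the prefactor
`S_b(2α)` vanishes at `α = Q/2`). The operator is the boundary value from `0 < Re α < Q/2`, where
the kernel is smooth and exponentially decreasing. -/

/-- `S_b(2α) ∫ dx' D_{-iα}(x - x') f(x')` at the shifted parameter `α - ε`. -/
def reflReg (b : ℝ) (α : ℂ) (f : ℝ → ℂ) (x ε : ℝ) : ℂ :=
  Sb b (2 * (α - ε)) * ∫ x' : ℝ, D b (-Complex.I * (α - ε)) (x - x') * f x'

/-- The boundary value that defines `(R_α f)(x)` exists. -/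
def ReflConverges (b : ℝ) (α : ℂ) (f : ℝ → ℂ) (x : ℝ) : Prop :=
  (∀ᶠ ε : ℝ in 𝓝[>] 0,
      Integrable fun x' : ℝ => D b (-Complex.I * (α - ε)) (x - x') * f x') ∧
    ∃ l, Tendsto (reflReg b α f x) (𝓝[>] 0) (𝓝 l)

/-- The reflection operator `R_α : P_α → P_{Q-α}`. -/
def reflOp (b : ℝ) (α : ℂ) (f : ℝ → ℂ) (x : ℝ) : ℂ := limUnder (𝓝[>] 0) (reflReg b α f x)

/-- `1 ⊗ R_α`, acting on the variable `x₁` of `ψ(x₂, x₁)`. -/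
def refl₁ (b : ℝ) (α : ℂ) (ψ : ℝ → ℝ → ℂ) : ℝ → ℝ → ℂ :=
  fun x₂ x₁ => reflOp b α (fun x => ψ x₂ x) x₁

/-- `R_α ⊗ 1`, acting on the variable `x₂` of `ψ(x₂, x₁)`. -/
def refl₂ (b : ℝ) (α : ℂ) (ψ : ℝ → ℝ → ℂ) : ℝ → ℝ → ℂ :=
  fun x₂ x₁ => reflOp b α (fun x => ψ x x₁) x₂

/-! ### The Clebsch-Gordan maps

For `Re α_k = Q/2` the Clebsch-Gordan coefficients have poles at real `x₃, x₂, x₁`. They are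
distributions: the boundary values from `Im x₂ > Im x₃ > Im x₁`. This is also the boundary
value from the region of parameters `α_k` in which the poles have left the real line. -/

/-- `∫ dx₁ dx₂ (α₃ x₃ | α₂ x₂ α₁ x₁)_b ψ(x₂, x₁)` with the shifts `x₂ + iε` and `x₁ - iε` in
the coefficient. -/
def cgReg (b : ℝ) (α₃ α₂ α₁ : ℂ) (ψ : ℝ → ℝ → ℂ) (x₃ ε : ℝ) : ℂ :=
  ∫ x : ℝ × ℝ, cg b α₃ α₂ α₁ x₃ (x.1 + Complex.I * ε) (x.2 - Complex.I * ε) * ψ x.1 x.2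

/-- The boundary value that defines `(C^{α₃}_{α₂,α₁} ψ)(x₃)` exists. -/
def CGConverges (b : ℝ) (α₃ α₂ α₁ : ℂ) (ψ : ℝ → ℝ → ℂ) (x₃ : ℝ) : Prop :=
  (∀ᶠ ε : ℝ in 𝓝[>] 0, Integrable fun x : ℝ × ℝ =>
      cg b α₃ α₂ α₁ x₃ (x.1 + Complex.I * ε) (x.2 - Complex.I * ε) * ψ x.1 x.2) ∧
    ∃ l, Tendsto (cgReg b α₃ α₂ α₁ ψ x₃) (𝓝[>] 0) (𝓝 l)

/-- The normalized Clebsch-Gordan map `C^{α₃}_{α₂,α₁}`. -/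
def cgMap (b : ℝ) (α₃ α₂ α₁ : ℂ) (ψ : ℝ → ℝ → ℂ) (x₃ : ℝ) : ℂ :=
  limUnder (𝓝[>] 0) (cgReg b α₃ α₂ α₁ ψ x₃)

end ModularDouble

end

open ModularDouble

/-!
# Weyl invariance of the Clebsch-Gordan maps of the modular double

All claims rest on the star-triangle identity for the double sine function
(`stIntegral_eq_stProd`): if `∑ (μᵢ + νᵢ) = Q` and all real parts are positive, then
`∫ ∏ᵢ S_b(μᵢ - iy) S_b(νᵢ + iy) dy = ∏ᵢⱼ S_b(μᵢ + νⱼ)`. The kernel identity is an instance of it, in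
which the six numbers are those whose real parts are assumed to be positive (`kernel_identity`).
The same identity for the variable `x₃` is another instance (`kernel_identity_three`).

*The star-triangle identity.* Let `J` be the quotient of the two sides. By the functional equation
`S_b(z + b) = 2 sin(π b z) S_b(z)` (`dsine_add`), the substitution `μ₁ → μ₁ + b`, `ν₁ → ν₁ - b`
changes the normalized integrand by a difference `G(z + b) - G(z)`, so that `J` is unchanged
(`stRatio_shift`). As a function of `μ₁`, with `μ₁ + ν₁` fixed and `Re (μ₁ + ν₁) > b`, `J` is
therefore periodic, and the growth `|S_b(x + iy)| ≍ exp (π (x - Q/2) |y|)` (`exists_norm_dsine_le`)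
shows that it is bounded; by Liouville's theorem it is constant (`stRatio_eq_of_add_eq`). Hence the
parameters can be moved until the poles at `μ₁` and `-ν₂` pinch the contour at the origin, where the
integrand turns into a Poisson kernel and `J → 1` (`tendsto_stRatio_pinch`). The remaining
parameters are reached by analytic continuation (`stRatio_eq_one`).

*The spaces `P_α`.* Since `K` and `K⁻¹` act on `P_α`, the Fourier transform of an element of `P_α`
decays exponentially in the `L²` sense, and the element extends to a bounded holomorphic function on
a strip around the real line (`exists_stripBounded_of_mem_P`). This is the only property of `P_α`
that is needed. By contour shifts, the limits that define the Clebsch-Gordan maps exist on products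
of such functions (`hasCG_tensor`).

*The reflection operators.* At `Re α = Q/2` the kernel of `R_α` has a pole on either side of the
real line, and the contour is pinched if `α = Q/2`. Because `sin π b² ≠ 0` excludes `b = 1`, one of
`b`, `b⁻¹` is smaller than `Q/2`; with this one as the period `p` the functional equation writes the
kernel as a sum of two terms with poles on one side each (`dsinePair_div_eq`), for which the contour
can be shifted separately. This gives the limit together with a uniform bound
(`exists_reflReg_limit`).

*Weyl invariance.* For `α₁`, keep `ε` fixed in the Clebsch-Gordan integral and apply the kernel
identity at `α₁ + e`, where Fubini's theorem is available; the limit `e → 0` follows by dominated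
convergence (`weyl_one`). The relation for `α₂` is the mirror image of that for `α₁` under `x → -x`
(`weyl_two`). For `α₃` the function to which `R_{α₃}` is applied extends holomorphically to a strip
and is the limit of its analogues at `α₃ - e`, to which the kernel identity applies (`weyl_three`).
In each case the factors of `S_b` on the right of the kernel identity are the quotients of the
normalization factors `M`.
-/

noncomputable section

namespace ModularDouble

/-! ### Holomorphic parameter integrals and contour shifts -/

/-- Differentiation under the integral sign for a holomorphic parameter: the derivative is
dominated by a Cauchy estimate, so a local bound on the integrand alone is enough. -/
theorem hasDerivAt_integral_of_holomorphic {X : Type*} [MeasurableSpace X] {μ : Measure X}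
    {U : Set ℂ} {F : ℂ → X → ℂ} {w₀ : ℂ} (hU : U ∈ 𝓝 w₀)
    (hmeas : ∀ w ∈ U, AEStronglyMeasurable (F w) μ)
    (hdiff : ∀ᵐ x ∂μ, DifferentiableOn ℂ (fun w => F w x) U)
    {g : X → ℝ} (hg : Integrable g μ) (hb : ∀ᵐ x ∂μ, ∀ w ∈ U, ‖F w x‖ ≤ g x) :
    Integrable (fun x => deriv (fun w => F w x) w₀) μ ∧
      HasDerivAt (fun w => ∫ x, F w x ∂μ) (∫ x, deriv (fun w => F w x) w₀ ∂μ) w₀ := by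
  obtain ⟨r, hr, hrU⟩ := Metric.mem_nhds_iff.1 hU
  have hsub : ∀ w ∈ Metric.ball w₀ (r / 2), Metric.closedBall w (r / 3) ⊆ U := by
    intro w hw y hy
    apply hrU
    rw [Metric.mem_ball] at hw ⊢
    rw [Metric.mem_closedBall] at hy
    linarith [dist_triangle y w w₀]
  have hd : ∀ᵐ x ∂μ, ∀ w ∈ Metric.ball w₀ (r / 2), DifferentiableAt ℂ (fun w => F w x) w := by
    filter_upwards [hdiff] with x hx w hw
    exact hx.differentiableAt (Filter.mem_of_superset
      (Metric.closedBall_mem_nhds w (by positivity)) (hsub w hw))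
  have hw₀ : w₀ ∈ Metric.ball w₀ (r / 2) := Metric.mem_ball_self (by positivity)
  have hmem : w₀ ∈ U := mem_of_mem_nhds hU
  refine hasDerivAt_integral_of_dominated_loc_of_deriv_le (μ := μ) (𝕜 := ℂ)
    (bound := fun x => g x / (r / 3)) (F := F) (F' := fun w x => deriv (fun w => F w x) w)
    (Metric.ball_mem_nhds w₀ (half_pos hr)) ?_ ?_ ?_ ?_ (hg.div_const _) ?_
  · filter_upwards [hU] with w hw using hmeas w hw
  · exact hg.mono' (hmeas _ hmem) (by filter_upwards [hb] with x hx using hx _ hmem)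
  · -- the derivative is an almost everywhere limit of difference quotients
    have hseq : Tendsto (fun n : ℕ => ((1 / ((n : ℝ) + 1) : ℝ) : ℂ)) atTop (𝓝[≠] 0) := by
      refine tendsto_nhdsWithin_iff.2 ⟨?_, Eventually.of_forall fun n => ?_⟩
      · have := (Complex.continuous_ofReal.tendsto 0).comp
          (tendsto_one_div_add_atTop_nhds_zero_nat (𝕜 := ℝ))
        simpa [Function.comp_def] using this
      · have : (1 / ((n : ℝ) + 1) : ℝ) ≠ 0 := by positivity
        exact Complex.ofReal_ne_zero.2 this
    obtain ⟨N, hN⟩ := eventually_atTop.1 ((tendsto_nhdsWithin_iff.1 hseq).1.eventually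
      (show ∀ᶠ h : ℂ in 𝓝 0, w₀ + h ∈ U from
        ((continuous_const_add w₀).tendsto' 0 w₀ (add_zero w₀)).eventually hU))
    refine aestronglyMeasurable_of_tendsto_ae atTop
      (f := fun (n : ℕ) x => (((1 / (((n + N : ℕ) : ℝ) + 1) : ℝ) : ℂ))⁻¹ •
        (F (w₀ + ((1 / (((n + N : ℕ) : ℝ) + 1) : ℝ) : ℂ)) x - F w₀ x)) ?_ ?_
    · intro n
      exact AEStronglyMeasurable.const_smul
        ((hmeas _ (hN (n + N) (Nat.le_add_left N n))).sub (hmeas _ hmem)) (_ : ℂ)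
    · filter_upwards [hd] with x hx
      have h1 := (hasDerivAt_iff_tendsto_slope_zero.1 (hx w₀ hw₀).hasDerivAt)
      exact (h1.comp hseq).comp (tendsto_add_atTop_nat N)
  · filter_upwards [hdiff, hb] with x hx hbx w hw
    have hdc : DiffContOnCl ℂ (fun w => F w x) (Metric.ball w (r / 3)) :=
      (hx.mono ((Metric.closure_ball_subset_closedBall).trans (hsub w hw))).diffContOnCl
    exact Complex.norm_deriv_le_of_forall_mem_sphere_norm_le (by positivity) hdc
      fun z hz => hbx z (hsub w hw (Metric.sphere_subset_closedBall hz))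
  · filter_upwards [hd] with x hx w hw using (hx w hw).hasDerivAt

/-- A parameter integral is holomorphic on an open set as soon as the integrand is holomorphic and
locally uniformly dominated. -/
theorem differentiableOn_integral_of_locally_bounded {X : Type*} [MeasurableSpace X]
    {μ : Measure X} {U : Set ℂ} (hU : IsOpen U) {F : ℂ → X → ℂ}
    (hmeas : ∀ w ∈ U, AEStronglyMeasurable (F w) μ)
    (hdiff : ∀ᵐ x ∂μ, DifferentiableOn ℂ (fun w => F w x) U)
    (hb : ∀ w₀ ∈ U, ∃ V ∈ 𝓝 w₀, ∃ g : X → ℝ, Integrable g μ ∧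
      ∀ᵐ x ∂μ, ∀ w ∈ V ∩ U, ‖F w x‖ ≤ g x) :
    DifferentiableOn ℂ (fun w => ∫ x, F w x ∂μ) U := by
  intro w₀ hw₀
  obtain ⟨V, hV, g, hg, hVb⟩ := hb w₀ hw₀
  refine (hasDerivAt_integral_of_holomorphic (U := V ∩ U)
    (inter_mem hV (hU.mem_nhds hw₀)) (fun w hw => hmeas w hw.2) ?_ hg
    hVb).2.differentiableAt.differentiableWithinAt
  filter_upwards [hdiff] with x hx using hx.mono Set.inter_subset_right

/-- The open horizontal strip `a < Im z < c`. -/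
def hStrip (a c : ℝ) : Set ℂ := {z | a < z.im ∧ z.im < c}

theorem isOpen_hStrip (a c : ℝ) : IsOpen (hStrip a c) :=
  (isOpen_lt continuous_const Complex.continuous_im).inter
    (isOpen_lt Complex.continuous_im continuous_const)

theorem convex_hStrip (a c : ℝ) : Convex ℝ (hStrip a c) :=
  (convex_halfSpace_im_gt a).inter (convex_halfSpace_im_lt c)

/-- A holomorphic function on a convex domain that is invariant under real translations is
constant. Applied to `w ↦ ∫ f(x + w) dx` it says that contours can be shifted. -/
theorem eq_of_translation_invariant {U : Set ℂ} (hUo : IsOpen U) (hUc : Convex ℝ U) {Φ : ℂ → ℂ}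
    (hd : DifferentiableOn ℂ Φ U) (hinv : ∀ w ∈ U, ∀ r : ℝ, Φ (w + r) = Φ w) {w₁ w₂ : ℂ}
    (h₁ : w₁ ∈ U) (h₂ : w₂ ∈ U) : Φ w₁ = Φ w₂ := by
  refine hUc.is_const_of_fderivWithin_eq_zero (𝕜 := ℂ) hd ?_ h₁ h₂
  intro w hw
  have hdw : DifferentiableAt ℂ Φ w := hd.differentiableAt (hUo.mem_nhds hw)
  have h0 : deriv Φ w = 0 := by
    have h1 : HasDerivAt (fun r : ℝ => Φ (w + r)) (deriv Φ w) 0 := by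
      have h2 : HasDerivAt (fun z : ℂ => Φ (w + z)) (deriv Φ w) ((0 : ℝ) : ℂ) := by
        have : HasDerivAt Φ (deriv Φ w) (w + ((0 : ℝ) : ℂ)) := by simpa using hdw.hasDerivAt
        simpa using this.comp_const_add w _
      exact h2.comp_ofReal
    have h3 : HasDerivAt (fun r : ℝ => Φ (w + r)) 0 0 := by
      simp_rw [hinv w hw]
      exact hasDerivAt_const _ _
    exact h1.unique h3
  rw [fderivWithin_of_isOpen hUo hw]
  ext
  simp [h0]

/-! ### The logarithm of the double sine function on the strip -/

/-- The integrand of `logSb` as a function of `w = 2x - Q`. -/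
def dsKernel (b : ℝ) (w : ℂ) (t : ℝ) : ℂ :=
  (w / (2 * t) - Complex.sinh (w * t) / (2 * Real.sinh (b * t) * Real.sinh (t / b))) / t

theorem logSb_eq (b : ℝ) (x : ℂ) :
    logSb b x = ∫ t in Set.Ioi (0 : ℝ), dsKernel b (2 * x - Q b) t := rfl

theorem Q_pos {b : ℝ} (hb : 0 < b) : 0 < Q b := by unfold Q; positivity

theorem norm_sinh_sub_le (x : ℂ) : ‖Complex.sinh x - x‖ ≤ ‖x‖ ^ 3 * Real.exp ‖x‖ := by
  have h1 := Complex.norm_exp_sub_sum_le_norm_mul_exp x 3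
  have h2 := Complex.norm_exp_sub_sum_le_norm_mul_exp (-x) 3
  rw [norm_neg] at h2
  have h3 : Complex.sinh x - x = ((Complex.exp x - ∑ m ∈ Finset.range 3, x ^ m / m.factorial)
      - (Complex.exp (-x) - ∑ m ∈ Finset.range 3, (-x) ^ m / m.factorial)) / 2 := by
    simp [Complex.sinh, Finset.sum_range_succ, Nat.factorial]
    ring
  rw [h3, norm_div, Complex.norm_two, div_le_iff₀ two_pos]
  exact (norm_sub_le _ _).trans (by linarith)

theorem norm_sinh_le_mul_exp (x : ℂ) : ‖Complex.sinh x‖ ≤ ‖x‖ * Real.exp ‖x‖ := by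
  have h1 := Complex.norm_exp_sub_sum_le_norm_mul_exp x 1
  have h2 := Complex.norm_exp_sub_sum_le_norm_mul_exp (-x) 1
  rw [norm_neg] at h2
  have h3 : Complex.sinh x = ((Complex.exp x - ∑ m ∈ Finset.range 1, x ^ m / m.factorial)
      - (Complex.exp (-x) - ∑ m ∈ Finset.range 1, (-x) ^ m / m.factorial)) / 2 := by
    simp [Complex.sinh]
  rw [pow_one] at h1 h2
  rw [h3, norm_div, Complex.norm_two, div_le_iff₀ two_pos]
  exact (norm_sub_le _ _).trans (by linarith)

theorem norm_sinh_le_exp {x : ℂ} {a : ℝ} (h : |x.re| ≤ a) : ‖Complex.sinh x‖ ≤ Real.exp a := by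
  rw [Complex.sinh, norm_div, Complex.norm_two, div_le_iff₀ two_pos]
  refine (norm_sub_le _ _).trans ?_
  rw [Complex.norm_exp, Complex.norm_exp, Complex.neg_re]
  have := Real.exp_le_exp.2 ((le_abs_self _).trans h)
  have := Real.exp_le_exp.2 ((neg_le_abs _).trans h)
  linarith

/-- Near `t = 0` the two singular terms of the integrand cancel to fourth order. -/
theorem exists_norm_dsKernel_le_of_le_one {b : ℝ} (hb : 0 < b) {W : ℝ} (hW : 0 ≤ W) :
    ∃ C : ℝ, 0 ≤ C ∧ ∀ t : ℝ, 0 < t → t ≤ 1 → ∀ w : ℂ, ‖w‖ ≤ W → ‖dsKernel b w t‖ ≤ C := by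
  refine ⟨W * (b ^ 2 * Real.exp b * Real.exp b⁻¹ + b⁻¹ ^ 2 * Real.exp b⁻¹)
    + W ^ 3 * Real.exp W, by positivity, fun t ht ht1 w hw => ?_⟩
  have hsb : b * t ≤ Real.sinh (b * t) := Real.self_le_sinh_iff.2 (by positivity)
  have hsb' : t / b ≤ Real.sinh (t / b) := Real.self_le_sinh_iff.2 (by positivity)
  set s : ℝ := Real.sinh (b * t) * Real.sinh (t / b) with hs
  have hst : t ^ 2 ≤ s := by
    calc t ^ 2 = (b * t) * (t / b) := by field_simp
      _ ≤ s := mul_le_mul hsb hsb' (by positivity) (by linarith [mul_pos hb ht])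
  have hspos : 0 < s := lt_of_lt_of_le (by positivity) hst
  have key : ∀ a : ℝ, 0 < a → |Real.sinh (a * t) - a * t| ≤ (a * t) ^ 3 * Real.exp a ∧
      |Real.sinh (a * t)| ≤ (a * t) * Real.exp a := by
    intro a ha
    have hn : ‖((a * t : ℝ) : ℂ)‖ = a * t := by
      rw [Complex.norm_real, Real.norm_eq_abs, abs_of_pos (by positivity)]
    have he : Real.exp (a * t) ≤ Real.exp a := Real.exp_le_exp.2 (by nlinarith)
    have h1 := norm_sinh_sub_le ((a * t : ℝ) : ℂ)
    have h2 := norm_sinh_le_mul_exp ((a * t : ℝ) : ℂ)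
    rw [hn] at h1 h2
    rw [← Complex.ofReal_sinh] at h1 h2
    rw [← Complex.ofReal_sub, Complex.norm_real, Real.norm_eq_abs] at h1
    rw [Complex.norm_real, Real.norm_eq_abs] at h2
    exact ⟨h1.trans (by gcongr), h2.trans (by gcongr)⟩
  have hsd : |s - t ^ 2| ≤
      t ^ 4 * (b ^ 2 * Real.exp b * Real.exp b⁻¹ + b⁻¹ ^ 2 * Real.exp b⁻¹) := by
    have h1 := key b hb
    have h2 := key b⁻¹ (by positivity)
    rw [show b⁻¹ * t = t / b by ring] at h2
    have : s - t ^ 2 = (Real.sinh (b * t) - b * t) * Real.sinh (t / b)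
        + b * t * (Real.sinh (t / b) - t / b) := by
      rw [hs]; field_simp; ring
    rw [this]
    refine (abs_add_le _ _).trans ?_
    rw [abs_mul, abs_mul, abs_of_pos (show 0 < b * t by positivity)]
    calc _ ≤ ((b * t) ^ 3 * Real.exp b) * (t / b * Real.exp b⁻¹)
          + b * t * ((t / b) ^ 3 * Real.exp b⁻¹) := by
            gcongr
            · exact h1.1
            · exact h2.2
            · exact h2.1
      _ = _ := by field_simp
  have hsw : ‖Complex.sinh (w * t) - w * t‖ ≤ t ^ 3 * (W ^ 3 * Real.exp W) := by
    have hn : ‖w * (t : ℂ)‖ ≤ W * t := by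
      rw [norm_mul, Complex.norm_real, Real.norm_eq_abs, abs_of_pos ht]; gcongr
    calc _ ≤ ‖w * (t : ℂ)‖ ^ 3 * Real.exp ‖w * (t : ℂ)‖ := norm_sinh_sub_le _
      _ ≤ (W * t) ^ 3 * Real.exp W := by
          gcongr
          exact hn.trans (by nlinarith)
      _ = _ := by ring
  have hform : dsKernel b w t =
      (w * ((s - t ^ 2 : ℝ) : ℂ) - t * (Complex.sinh (w * t) - w * t)) / (2 * t ^ 2 * s) := by
    have h1 : (t : ℂ) ≠ 0 := by exact_mod_cast ht.ne'
    have h2 : ((Real.sinh (b * t) : ℝ) : ℂ) ≠ 0 := by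
      have := mul_pos hb ht
      exact_mod_cast (show Real.sinh (b * t) ≠ 0 by linarith)
    have h3 : ((Real.sinh (t / b) : ℝ) : ℂ) ≠ 0 := by
      have := div_pos ht hb
      exact_mod_cast (show Real.sinh (t / b) ≠ 0 by linarith)
    rw [dsKernel, hs]
    push_cast at h2 h3 ⊢
    generalize Complex.sinh (b * t) = A at *
    generalize Complex.sinh (t / b) = B at *
    field_simp
    ring
  have hden : ‖(2 * (t : ℂ) ^ 2 * s)‖ = 2 * t ^ 2 * s := by
    rw [← Complex.ofReal_pow, show (2 : ℂ) = ((2 : ℝ) : ℂ) by norm_num, ← Complex.ofReal_mul,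
      ← Complex.ofReal_mul, Complex.norm_real, Real.norm_eq_abs, abs_of_pos (by positivity)]
  rw [hform, norm_div, hden, div_le_iff₀ (by positivity)]
  set A := b ^ 2 * Real.exp b * Real.exp b⁻¹ + b⁻¹ ^ 2 * Real.exp b⁻¹ with hA
  have hA0 : 0 ≤ A := by positivity
  calc _ ≤ ‖w‖ * |s - t ^ 2| + t * ‖Complex.sinh (w * t) - w * t‖ := by
        refine (norm_sub_le _ _).trans ?_
        rw [norm_mul, norm_mul, Complex.norm_real, Complex.norm_real, Real.norm_eq_abs,
          Real.norm_eq_abs, abs_of_pos ht]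
    _ ≤ W * (t ^ 4 * A) + t * (t ^ 3 * (W ^ 3 * Real.exp W)) := by gcongr
    _ = (W * A + W ^ 3 * Real.exp W) * (t ^ 2 * t ^ 2) := by ring
    _ ≤ (W * A + W ^ 3 * Real.exp W) * (t ^ 2 * s) := by gcongr
    _ ≤ (W * A + W ^ 3 * Real.exp W) * (2 * t ^ 2 * s) := by
        have : 0 ≤ (W * A + W ^ 3 * Real.exp W) * (t ^ 2 * s) := by positivity
        linarith

theorem exists_norm_dsKernel_le_of_one_le {b : ℝ} (hb : 0 < b) (W w₀ : ℝ) :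
    ∃ C : ℝ, 0 ≤ C ∧ ∀ t : ℝ, 1 ≤ t → ∀ w : ℂ, |w.re| ≤ w₀ → ‖w‖ ≤ W →
      ‖dsKernel b w t‖ ≤ W / 2 * t ^ (-2 : ℝ) + C * Real.exp ((w₀ - Q b) * t) := by
  set c : ℝ := (1 - Real.exp (-(2 * b))) / 2 * ((1 - Real.exp (-(2 * b⁻¹))) / 2) with hc
  have key : ∀ a : ℝ, 0 < a → 0 < (1 - Real.exp (-(2 * a))) / 2 ∧ ∀ t : ℝ, 1 ≤ t →
      Real.exp (a * t) * ((1 - Real.exp (-(2 * a))) / 2) ≤ Real.sinh (a * t) := by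
    intro a ha
    refine ⟨?_, fun t ht => ?_⟩
    · have := Real.exp_lt_one_iff.2 (show -(2 * a) < 0 by linarith)
      linarith
    · have h1 : Real.exp (-(a * t)) ≤ Real.exp (a * t) * Real.exp (-(2 * a)) := by
        rw [← Real.exp_add]
        exact Real.exp_le_exp.2 (by nlinarith)
      rw [Real.sinh_eq]
      linarith
  obtain ⟨hc1, hs1⟩ := key b hb
  obtain ⟨hc2, hs2⟩ := key b⁻¹ (inv_pos.2 hb)
  have hcpos : 0 < c := mul_pos hc1 hc2
  refine ⟨(2 * c)⁻¹, by positivity, fun t ht w hw hwW => ?_⟩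
  have ht0 : 0 < t := by linarith
  have hs : c * Real.exp (Q b * t) ≤ Real.sinh (b * t) * Real.sinh (t / b) := by
    rw [show t / b = b⁻¹ * t by ring]
    calc c * Real.exp (Q b * t) = (Real.exp (b * t) * ((1 - Real.exp (-(2 * b))) / 2)) *
          (Real.exp (b⁻¹ * t) * ((1 - Real.exp (-(2 * b⁻¹))) / 2)) := by
          rw [hc, Q, add_mul, Real.exp_add]; ring
      _ ≤ _ := mul_le_mul (hs1 t ht) (hs2 t ht) (by positivity)
          (le_trans (by positivity) (hs1 t ht))
  have hspos : 0 < Real.sinh (b * t) * Real.sinh (t / b) := lt_of_lt_of_le (by positivity) hs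
  rw [dsKernel, sub_div]
  refine (norm_sub_le _ _).trans (add_le_add ?_ ?_)
  · rw [norm_div, norm_div, norm_mul, Complex.norm_real, Complex.norm_two, Real.norm_eq_abs,
      abs_of_pos ht0, Real.rpow_neg ht0.le, Real.rpow_two]
    calc ‖w‖ / (2 * t) / t = ‖w‖ / 2 * (t ^ 2)⁻¹ := by field_simp
      _ ≤ _ := by gcongr
  · rw [norm_div, norm_div, mul_assoc, norm_mul, ← Complex.ofReal_mul, Complex.norm_real,
      Complex.norm_real, Complex.norm_two, Real.norm_eq_abs, Real.norm_eq_abs, abs_of_pos ht0,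
      abs_of_pos hspos]
    have hsin : ‖Complex.sinh (w * t)‖ ≤ Real.exp (w₀ * t) := by
      apply norm_sinh_le_exp
      rw [Complex.re_mul_ofReal, abs_mul, abs_of_pos ht0]
      gcongr
    calc _ ≤ ‖Complex.sinh (w * t)‖ / (2 * (Real.sinh (b * t) * Real.sinh (t / b))) :=
          div_le_self (by positivity) ht
      _ ≤ Real.exp (w₀ * t) / (2 * (c * Real.exp (Q b * t))) := by gcongr
      _ = _ := by
          rw [sub_mul, Real.exp_sub]; field_simp

/-- The integrand of `logSb` is dominated by one integrable function as long as `w = 2x - Q` stays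
bounded and away from the boundary of the strip `|Re w| < Q`. -/
theorem exists_dsKernel_bound {b : ℝ} (hb : 0 < b) {W w₀ : ℝ} (hW : 0 ≤ W) (hw₀ : w₀ < Q b) :
    ∃ g : ℝ → ℝ, IntegrableOn g (Set.Ioi 0) ∧ ∀ t : ℝ, 0 < t → ∀ w : ℂ, |w.re| ≤ w₀ → ‖w‖ ≤ W →
      ‖dsKernel b w t‖ ≤ g t := by
  obtain ⟨C₁, hC₁, h₁⟩ := exists_norm_dsKernel_le_of_le_one hb hW
  obtain ⟨C₂, hC₂, h₂⟩ := exists_norm_dsKernel_le_of_one_le hb W w₀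
  refine ⟨fun t => if t ≤ 1 then C₁ else W / 2 * t ^ (-2 : ℝ) + C₂ * Real.exp ((w₀ - Q b) * t),
    ?_, ?_⟩
  · rw [← Set.Ioc_union_Ioi_eq_Ioi (zero_le_one' ℝ)]
    refine IntegrableOn.union ?_ ?_
    · refine IntegrableOn.congr_fun (f := fun _ => C₁) ?_ (fun t ht => ?_) measurableSet_Ioc
      · exact integrableOn_const (by simp)
      · simp [ht.2]
    · refine IntegrableOn.congr_fun (f := fun t => W / 2 * t ^ (-2 : ℝ)
        + C₂ * Real.exp ((w₀ - Q b) * t)) ?_ (fun t ht => ?_) measurableSet_Ioi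
      · refine Integrable.add ?_ ?_
        · exact (integrableOn_Ioi_rpow_of_lt (by norm_num) one_pos).const_mul _
        · exact (integrableOn_exp_mul_Ioi (by linarith) 1).const_mul _
      · simp [not_le.2 (Set.mem_Ioi.1 ht)]
  · intro t ht w hw hwW
    dsimp only
    split_ifs with h
    · exact h₁ t ht h w hwW
    · exact h₂ t (not_le.1 h).le w hw hwW

theorem continuousOn_dsKernel {b : ℝ} (hb : 0 < b) (w : ℂ) :
    ContinuousOn (dsKernel b w) (Set.Ioi 0) := by
  unfold dsKernel
  have h : ∀ t : ℝ, t ∈ Set.Ioi (0 : ℝ) → (t : ℂ) ≠ 0 ∧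
      (2 * Real.sinh (b * t) * Real.sinh (t / b) : ℂ) ≠ 0 := by
    intro t (ht : 0 < t)
    refine ⟨by exact_mod_cast ht.ne', ?_⟩
    have h1 : 0 < Real.sinh (b * t) := Real.sinh_pos_iff.2 (by positivity)
    have h2 : 0 < Real.sinh (t / b) := Real.sinh_pos_iff.2 (by positivity)
    exact_mod_cast (by positivity : (2 * Real.sinh (b * t) * Real.sinh (t / b)) ≠ 0)
  refine ContinuousOn.div (ContinuousOn.sub (ContinuousOn.div ?_ ?_ fun t ht => ?_)
    (ContinuousOn.div ?_ ?_ fun t ht => (h t ht).2)) ?_ fun t ht => (h t ht).1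
  · fun_prop
  · fun_prop
  · exact mul_ne_zero two_ne_zero (h t ht).1
  · fun_prop
  · exact Continuous.continuousOn (by fun_prop)
  · fun_prop

theorem aestronglyMeasurable_dsKernel {b : ℝ} (hb : 0 < b) (w : ℂ) :
    AEStronglyMeasurable (dsKernel b w) (volume.restrict (Set.Ioi 0)) :=
  (continuousOn_dsKernel hb w).aestronglyMeasurable measurableSet_Ioi

theorem integrableOn_dsKernel {b : ℝ} (hb : 0 < b) {w : ℂ} (hw : |w.re| < Q b) :
    IntegrableOn (dsKernel b w) (Set.Ioi 0) := by
  obtain ⟨g, hg, h⟩ := exists_dsKernel_bound hb (norm_nonneg w) hw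
  exact hg.mono' (aestronglyMeasurable_dsKernel hb w)
    ((ae_restrict_iff' measurableSet_Ioi).2 (ae_of_all _ fun t ht => h t ht w le_rfl le_rfl))

theorem differentiable_dsKernel (b t : ℝ) : Differentiable ℂ fun w => dsKernel b w t := by
  unfold dsKernel
  intro w
  fun_prop

/-- The strip `0 < Re z < Q`. -/
def strip (b : ℝ) : Set ℂ := {z | 0 < z.re ∧ z.re < Q b}

theorem isOpen_strip (b : ℝ) : IsOpen (strip b) :=
  (isOpen_lt continuous_const Complex.continuous_re).inter
    (isOpen_lt Complex.continuous_re continuous_const)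

theorem convex_strip (b : ℝ) : Convex ℝ (strip b) :=
  (convex_halfSpace_re_gt 0).inter (convex_halfSpace_re_lt (Q b))

theorem abs_re_lt_of_mem_strip {b : ℝ} {z : ℂ} (hz : z ∈ strip b) :
    |(2 * z - Q b).re| < Q b := by
  rw [abs_lt]
  simp only [Complex.sub_re, Complex.mul_re, Complex.re_ofNat, Complex.im_ofNat, zero_mul,
    sub_zero, Complex.ofReal_re]
  constructor <;> linarith [hz.1, hz.2]

/-- A dominating function for the integrand of `logSb` near a point of the strip. -/
theorem exists_local_dsKernel_bound {b : ℝ} (hb : 0 < b) {z : ℂ} (hz : z ∈ strip b) :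
    ∃ V ∈ 𝓝 z, ∃ g : ℝ → ℝ, IntegrableOn g (Set.Ioi 0) ∧
      ∀ t : ℝ, 0 < t → ∀ w ∈ V, ‖dsKernel b (2 * w - Q b) t‖ ≤ g t := by
  obtain ⟨w₀, h1, h2⟩ := exists_between (abs_re_lt_of_mem_strip hz)
  obtain ⟨g, hg, h⟩ := exists_dsKernel_bound hb
    (W := ‖2 * z - Q b‖ + 1) (by positivity) h2
  refine ⟨{w | |(2 * w - Q b).re| < w₀ ∧ ‖2 * w - Q b‖ < ‖2 * z - Q b‖ + 1}, ?_, g, hg,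
    fun t ht w hw => h t ht _ hw.1.le hw.2.le⟩
  refine IsOpen.mem_nhds (IsOpen.inter ?_ ?_) ⟨h1, by linarith⟩
  · exact isOpen_lt (f := fun w : ℂ => |(2 * w - Q b).re|) (by fun_prop) continuous_const
  · exact isOpen_lt (f := fun w : ℂ => ‖2 * w - Q b‖) (by fun_prop) continuous_const

theorem differentiableOn_logSb {b : ℝ} (hb : 0 < b) :
    DifferentiableOn ℂ (logSb b) (strip b) := by
  refine differentiableOn_integral_of_locally_bounded (isOpen_strip b)
    (fun w _ => aestronglyMeasurable_dsKernel hb _)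
    (ae_of_all _ fun t => ?_) fun z hz => ?_
  · exact ((differentiable_dsKernel b t).comp (by fun_prop)).differentiableOn
  · obtain ⟨V, hV, g, hg, h⟩ := exists_local_dsKernel_bound hb hz
    exact ⟨V, hV, g, hg, (ae_restrict_iff' measurableSet_Ioi).2
      (ae_of_all _ fun t ht w hw => h t ht w hw.1)⟩

theorem dsKernel_neg (b : ℝ) (w : ℂ) (t : ℝ) : dsKernel b (-w) t = -dsKernel b w t := by
  simp only [dsKernel, neg_mul, Complex.sinh_neg]; ring

theorem logSb_reflect (b : ℝ) (z : ℂ) : logSb b (Q b - z) = -logSb b z := by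
  rw [logSb_eq, logSb_eq, ← integral_neg]
  congr 1 with t
  rw [← dsKernel_neg]
  congr 1; ring

theorem Q_inv (b : ℝ) : Q b⁻¹ = Q b := by simp [Q, add_comm]

theorem logSb_inv (b : ℝ) (z : ℂ) : logSb b⁻¹ z = logSb b z := by
  rw [logSb_eq, logSb_eq, Q_inv]
  congr 1 with t
  simp only [dsKernel]
  rw [show b⁻¹ * t = t / b by ring, show t / b⁻¹ = b * t by simp [div_eq_mul_inv, mul_comm]]
  ring

/-! ### The double sine function on the strip -/

/-- The double sine function on the strip `0 < Re z < Q`, as a plain exponential. It is meaningless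
outside the strip, where the integral `logSb` diverges, but with this convention it never vanishes
and the reflection formula holds for all arguments. -/
def dsine (b : ℝ) (z : ℂ) : ℂ := Complex.exp (logSb b z)

theorem Sb_eq_dsine {b : ℝ} {z : ℂ} (hz : z ∈ strip b) : Sb b z = dsine b z := if_pos hz

theorem dsine_ne_zero (b : ℝ) (z : ℂ) : dsine b z ≠ 0 := Complex.exp_ne_zero _

theorem differentiableOn_dsine {b : ℝ} (hb : 0 < b) : DifferentiableOn ℂ (dsine b) (strip b) :=
  (differentiableOn_logSb hb).cexp

theorem continuousOn_dsine {b : ℝ} (hb : 0 < b) : ContinuousOn (dsine b) (strip b) :=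
  (differentiableOn_dsine hb).continuousOn

theorem dsine_reflect (b : ℝ) (z : ℂ) : dsine b (Q b - z) = (dsine b z)⁻¹ := by
  rw [dsine, logSb_reflect, Complex.exp_neg, dsine]

theorem dsine_inv_param (b : ℝ) (z : ℂ) : dsine b⁻¹ z = dsine b z := by
  rw [dsine, logSb_inv, dsine]

/-! ### Growth of the double sine function -/

/-- The rate `k` in the estimate `|S_b(x + iy)| ≍ exp (k (x - Q/2) |y|)`. Its value is `π`, but
only its positivity matters. -/
def decayRate : ℝ := 2 * ∫ t in Set.Ioi (0 : ℝ), (1 - Real.cos t) / t ^ 2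

theorem one_sub_cos_div_sq_nonneg (t : ℝ) : 0 ≤ (1 - Real.cos t) / t ^ 2 :=
  div_nonneg (by linarith [Real.cos_le_one t]) (sq_nonneg t)

theorem integrableOn_one_sub_cos_div_sq :
    IntegrableOn (fun t : ℝ => (1 - Real.cos t) / t ^ 2) (Set.Ioi 0) := by
  have hcont : ContinuousOn (fun t : ℝ => (1 - Real.cos t) / t ^ 2) (Set.Ioi 0) :=
    ContinuousOn.div (by fun_prop) (by fun_prop) fun t (ht : 0 < t) => by positivity
  have hm := hcont.aestronglyMeasurable (μ := volume) measurableSet_Ioi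
  rw [← Set.Ioc_union_Ioi_eq_Ioi (zero_le_one' ℝ)] at hm ⊢
  refine IntegrableOn.union ?_ ?_
  · refine Integrable.mono' (g := fun _ => (1 / 2 : ℝ)) (integrableOn_const (by simp))
      (hm.mono_set Set.subset_union_left) ?_
    refine (ae_restrict_iff' measurableSet_Ioc).2 (ae_of_all _ fun t ht => ?_)
    rw [Real.norm_of_nonneg (one_sub_cos_div_sq_nonneg t), div_le_iff₀ (pow_pos ht.1 2)]
    linarith [Real.one_sub_sq_div_two_le_cos (x := t)]
  · refine Integrable.mono' (g := fun t : ℝ => 2 * t ^ (-2 : ℝ))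
      ((integrableOn_Ioi_rpow_of_lt (by norm_num) one_pos).const_mul 2)
      (hm.mono_set Set.subset_union_right) ?_
    refine (ae_restrict_iff' measurableSet_Ioi).2 (ae_of_all _ fun t (ht : 1 < t) => ?_)
    rw [Real.norm_of_nonneg (one_sub_cos_div_sq_nonneg t), Real.rpow_neg (by linarith),
      Real.rpow_two, div_eq_mul_inv]
    have : 0 < t := by linarith
    gcongr
    linarith [Real.neg_one_le_cos t]

theorem decayRate_pos : 0 < decayRate := by
  refine mul_pos two_pos ((setIntegral_pos_iff_support_of_nonneg_ae
    (ae_of_all _ one_sub_cos_div_sq_nonneg) integrableOn_one_sub_cos_div_sq).2 ?_)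
  refine lt_of_lt_of_le (b := volume (Set.Ioo (0 : ℝ) Real.pi)) (by simp [Real.pi_pos])
    (measure_mono fun t ht => ⟨?_, ht.1⟩)
  have h1 : Real.cos t < 1 := by
    rw [← Real.cos_zero]
    exact Real.cos_lt_cos_of_nonneg_of_le_pi le_rfl ht.2.le ht.1
  have h2 := ht.1
  exact (div_pos (by linarith) (by positivity)).ne'

theorem integral_one_sub_cos_mul (y : ℝ) :
    IntegrableOn (fun t : ℝ => (1 - Real.cos (2 * y * t)) / t ^ 2) (Set.Ioi 0) ∧
    ∫ t in Set.Ioi (0 : ℝ), (1 - Real.cos (2 * y * t)) / t ^ 2 = decayRate * |y| := by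
  rcases eq_or_ne y 0 with rfl | hy
  · simp
  have hc : 0 < |2 * y| := by positivity
  have hfun : (fun t : ℝ => (1 - Real.cos (2 * y * t)) / t ^ 2) =
      fun t => |2 * y| ^ 2 * ((1 - Real.cos (|2 * y| * t)) / (|2 * y| * t) ^ 2) := by
    ext t
    have h1 : Real.cos (|2 * y| * t) = Real.cos (2 * y * t) := by
      rcases abs_cases (2 * y) with h | h
      · rw [h.1]
      · rw [h.1, neg_mul, Real.cos_neg]
    rw [h1]
    rcases eq_or_ne t 0 with rfl | ht
    · simp
    field_simp
  constructor
  · rw [hfun]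
    refine Integrable.const_mul ?_ _
    have := (integrableOn_Ioi_comp_mul_left_iff
      (fun t : ℝ => (1 - Real.cos t) / t ^ 2) 0 hc).2
    rw [mul_zero] at this
    exact this integrableOn_one_sub_cos_div_sq
  · rw [hfun, integral_const_mul,
      integral_comp_mul_left_Ioi (fun t : ℝ => (1 - Real.cos t) / t ^ 2) 0 hc, mul_zero,
      decayRate, smul_eq_mul, abs_mul, abs_two]
    have : |y| ≠ 0 := by positivity
    field_simp

theorem dsKernel_re (b x y t : ℝ) (ht : 0 < t) :
    (dsKernel b (x + 2 * y * Complex.I) t).re =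
      x / 2 * ((1 - Real.cos (2 * y * t)) / t ^ 2)
        + Real.cos (2 * y * t) * (dsKernel b x t).re := by
  have h1 : ∀ y : ℝ, dsKernel b (x + 2 * y * Complex.I) t =
      ((x / (2 * t) - Real.sinh (x * t) * Real.cos (2 * y * t) /
        (2 * Real.sinh (b * t) * Real.sinh (t / b)) : ℝ) / t : ℝ)
      + ((2 * y / (2 * t) - Real.cosh (x * t) * Real.sin (2 * y * t) /
        (2 * Real.sinh (b * t) * Real.sinh (t / b)) : ℝ) / t : ℝ) * Complex.I := by
    intro y
    rw [dsKernel, show (x + 2 * y * Complex.I : ℂ) * t = (x * t : ℂ) + (2 * y * t) * Complex.I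
      by ring, Complex.sinh_add, Complex.cosh_mul_I, Complex.sinh_mul_I]
    push_cast
    ring
  have h2 := congrArg Complex.re (h1 y)
  have h3 := congrArg Complex.re (h1 0)
  rw [Complex.add_re, Complex.ofReal_re, Complex.re_ofReal_mul, Complex.I_re, mul_zero] at h2 h3
  simp only [Complex.ofReal_zero, mul_zero, zero_mul, add_zero, Real.cos_zero, mul_one] at h2 h3
  rw [h2, h3]
  field_simp
  ring

/-- Exponential bound for the double sine function. Since `S_b(z) S_b(Q - z) = 1` and the exponent
is odd about `Re z = Q/2`, it is also a lower bound. -/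
theorem exists_norm_dsine_le {b : ℝ} (hb : 0 < b) {x₀ : ℝ} (hx₀ : 0 < x₀) :
    ∃ C : ℝ, 0 < C ∧ ∀ z : ℂ, x₀ ≤ z.re → z.re ≤ Q b - x₀ →
      ‖dsine b z‖ ≤ C * Real.exp (decayRate * (z.re - Q b / 2) * |z.im|) := by
  have hQ := Q_pos hb
  obtain ⟨g, hg, h⟩ := exists_dsKernel_bound hb (W := Q b) (w₀ := Q b - 2 * x₀) hQ.le (by linarith)
  refine ⟨Real.exp (∫ t in Set.Ioi 0, g t), Real.exp_pos _, fun z h1 h2 => ?_⟩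
  have hz : z ∈ strip b := ⟨by linarith, by linarith⟩
  set x : ℝ := 2 * z.re - Q b with hx
  have hxabs : |x| ≤ Q b - 2 * x₀ := abs_le.2 ⟨by linarith, by linarith⟩
  have hw : 2 * z - Q b = x + 2 * z.im * Complex.I := by
    apply Complex.ext <;> simp [hx]
  have hK : ∀ t : ℝ, 0 < t → |(dsKernel b x t).re| ≤ g t := fun t ht =>
    (Complex.abs_re_le_norm _).trans (h t ht x (by simpa using hxabs)
      (by rw [Complex.norm_real, Real.norm_eq_abs]; linarith))
  have hint := integral_one_sub_cos_mul z.im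
  have hre : (logSb b z).re = ∫ t in Set.Ioi (0 : ℝ), (dsKernel b (2 * z - Q b) t).re := by
    rw [logSb_eq]
    exact (Complex.reCLM.integral_comp_comm
      (integrableOn_dsKernel hb (abs_re_lt_of_mem_strip hz))).symm
  have hint2 : IntegrableOn (fun t : ℝ => Real.cos (2 * z.im * t) * (dsKernel b x t).re)
      (Set.Ioi 0) := by
    refine hg.mono' ?_ ((ae_restrict_iff' measurableSet_Ioi).2 (ae_of_all _ fun t ht => ?_))
    · refine AEStronglyMeasurable.mul (Continuous.aestronglyMeasurable (by fun_prop)) ?_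
      exact Complex.continuous_re.comp_aestronglyMeasurable (aestronglyMeasurable_dsKernel hb _)
    · rw [norm_mul, Real.norm_eq_abs, Real.norm_eq_abs]
      calc _ ≤ 1 * |(dsKernel b x t).re| := by gcongr; exact Real.abs_cos_le_one _
        _ ≤ g t := by rw [one_mul]; exact hK t ht
  rw [dsine, Complex.norm_exp, ← Real.exp_add]
  apply Real.exp_le_exp.2
  have hsplit : ∫ t in Set.Ioi (0 : ℝ), (dsKernel b (2 * z - Q b) t).re =
      ∫ t in Set.Ioi (0 : ℝ), (x / 2 * ((1 - Real.cos (2 * z.im * t)) / t ^ 2)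
        + Real.cos (2 * z.im * t) * (dsKernel b x t).re) := by
    refine setIntegral_congr_fun measurableSet_Ioi fun t ht => ?_
    rw [hw]
    exact dsKernel_re b x z.im t ht
  rw [hre, hsplit, integral_add (hint.1.const_mul _) hint2, integral_const_mul, hint.2]
  have : ∫ t in Set.Ioi (0 : ℝ), Real.cos (2 * z.im * t) * (dsKernel b x t).re
      ≤ ∫ t in Set.Ioi 0, g t := by
    refine setIntegral_mono_on hint2 hg measurableSet_Ioi fun t ht => ?_
    refine (le_abs_self _).trans ?_
    rw [abs_mul]
    calc _ ≤ 1 * |(dsKernel b x t).re| := by gcongr; exact Real.abs_cos_le_one _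
      _ ≤ g t := by rw [one_mul]; exact hK t ht
  rw [hx]
  linarith

/-! ### The functional equation -/

/-- The difference of two integrands of `logSb` whose arguments differ by `b`. -/
theorem dsKernel_shift_sub {b : ℝ} (hb : 0 < b) (z : ℂ) {t : ℝ} (ht : 0 < t) :
    dsKernel b (2 * (z + b) - Q b) t - dsKernel b (2 * z - Q b) t =
      (b / t - Complex.cosh ((2 * z - b⁻¹) * t) / Real.sinh (t / b)) / t := by
  have h1 : (Complex.sinh (b * t)) ≠ 0 := by
    rw [← Complex.ofReal_mul, ← Complex.ofReal_sinh, Complex.ofReal_ne_zero]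
    exact (Real.sinh_pos_iff.2 (by positivity)).ne'
  have h2 : (Complex.sinh (t / b)) ≠ 0 := by
    rw [← Complex.ofReal_div, ← Complex.ofReal_sinh, Complex.ofReal_ne_zero]
    exact (Real.sinh_pos_iff.2 (by positivity)).ne'
  have h3 : (t : ℂ) ≠ 0 := Complex.ofReal_ne_zero.2 ht.ne'
  have e1 : (2 * (z + b) - Q b) * (t : ℂ) = (2 * z - b⁻¹) * t + b * t := by
    rw [Q]; push_cast; ring
  have e2 : (2 * z - Q b) * (t : ℂ) = (2 * z - b⁻¹) * t - b * t := by
    rw [Q]; push_cast; ring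
  simp only [dsKernel]
  rw [e1, e2, Complex.sinh_add, Complex.sinh_sub]
  push_cast
  generalize Complex.sinh (b * t) = A at *
  generalize Complex.sinh (t / b) = B at *
  generalize Complex.cosh ((2 * z - (b : ℂ)⁻¹) * t) = D
  field_simp
  ring

theorem logSb_shift_sub {b : ℝ} (hb : 0 < b) {z : ℂ} (h0 : 0 < z.re) (h1 : z.re < b⁻¹) :
    logSb b (z + b) - logSb b z = ∫ t in Set.Ioi (0 : ℝ),
      (b / t - Complex.cosh ((2 * z - b⁻¹) * t) / Real.sinh (t / b)) / t := by
  have hz : z ∈ strip b := ⟨h0, by rw [Q]; linarith⟩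
  have hz' : z + b ∈ strip b := by
    constructor <;> simp [Q] <;> linarith
  rw [logSb_eq, logSb_eq,
    ← integral_sub (integrableOn_dsKernel hb (abs_re_lt_of_mem_strip hz'))
      (integrableOn_dsKernel hb (abs_re_lt_of_mem_strip hz))]
  exact setIntegral_congr_fun measurableSet_Ioi fun t ht => dsKernel_shift_sub hb z ht

theorem hasDerivAt_logSb_sub {b : ℝ} (hb : 0 < b) {z : ℂ} (h0 : 0 < z.re) (h1 : z.re < b⁻¹) :
    IntegrableOn (fun t : ℝ => -2 * Complex.sinh ((2 * z - b⁻¹) * t) / Real.sinh (t / b))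
      (Set.Ioi 0) ∧
    HasDerivAt (fun z => logSb b (z + b) - logSb b z)
      (∫ t in Set.Ioi (0 : ℝ), -2 * Complex.sinh ((2 * z - b⁻¹) * t) / Real.sinh (t / b)) z := by
  have hz : z ∈ strip b := ⟨h0, by rw [Q]; linarith⟩
  have hz' : z + b ∈ strip b := by
    constructor <;> simp [Q] <;> linarith
  obtain ⟨V, hV, g, hg, h⟩ := exists_local_dsKernel_bound hb hz
  obtain ⟨V', hV', g', hg', h'⟩ := exists_local_dsKernel_bound hb hz'
  have hcont : Tendsto (fun w : ℂ => w + b) (𝓝 z) (𝓝 (z + b)) :=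
    (continuous_id.add continuous_const).tendsto z
  set U := (V ∩ (fun w : ℂ => w + b) ⁻¹' V') ∩ {w : ℂ | 0 < w.re ∧ w.re < b⁻¹} with hU
  have hUn : U ∈ 𝓝 z := by
    refine inter_mem (inter_mem hV (hcont hV')) (IsOpen.mem_nhds ?_ ⟨h0, h1⟩)
    exact (isOpen_lt continuous_const Complex.continuous_re).inter
      (isOpen_lt Complex.continuous_re continuous_const)
  have hdiff : ∀ t : ℝ, Differentiable ℂ
      fun w => dsKernel b (2 * (w + b) - Q b) t - dsKernel b (2 * w - Q b) t := by
    intro t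
    have h1 : Differentiable ℂ fun w : ℂ => 2 * (w + b) - (Q b : ℂ) := by fun_prop
    have h2 : Differentiable ℂ fun w : ℂ => 2 * w - (Q b : ℂ) := by fun_prop
    exact ((differentiable_dsKernel b t).comp h1).sub ((differentiable_dsKernel b t).comp h2)
  have hmeas : ∀ w ∈ U, AEStronglyMeasurable
      (fun t => dsKernel b (2 * (w + b) - Q b) t - dsKernel b (2 * w - Q b) t)
      (volume.restrict (Set.Ioi (0 : ℝ))) := fun w _ =>
    (aestronglyMeasurable_dsKernel hb _).sub (aestronglyMeasurable_dsKernel hb _)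
  have hbound : ∀ t : ℝ, t ∈ Set.Ioi (0 : ℝ) → ∀ w ∈ U,
      ‖dsKernel b (2 * (w + b) - Q b) t - dsKernel b (2 * w - Q b) t‖ ≤ (g' + g) t :=
    fun t ht w hw =>
      (norm_sub_le _ _).trans (add_le_add (h' t ht (w + b) hw.1.2) (h t ht w hw.1.1))
  have main := hasDerivAt_integral_of_holomorphic
    (F := fun w t => dsKernel b (2 * (w + b) - Q b) t - dsKernel b (2 * w - Q b) t) hUn hmeas
    (ae_of_all _ fun t => (hdiff t).differentiableOn) (Integrable.add hg' hg)
    ((ae_restrict_iff' measurableSet_Ioi).2 (ae_of_all _ hbound))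
  have hder : ∀ t ∈ Set.Ioi (0 : ℝ),
      deriv (fun w => dsKernel b (2 * (w + b) - Q b) t - dsKernel b (2 * w - Q b) t) z =
        -2 * Complex.sinh ((2 * z - b⁻¹) * t) / Real.sinh (t / b) := by
    intro t ht
    have h3 : (t : ℂ) ≠ 0 := Complex.ofReal_ne_zero.2 (ne_of_gt ht)
    rw [show (fun w => dsKernel b (2 * (w + b) - Q b) t - dsKernel b (2 * w - Q b) t) =
      fun w => (b / t - Complex.cosh ((2 * w - b⁻¹) * t) / Real.sinh (t / b)) / t from
        funext fun w => dsKernel_shift_sub hb w ht]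
    have h4 : HasDerivAt (fun w : ℂ => (2 * w - (b⁻¹ : ℝ)) * t) (2 * t) z := by
      simpa using (((hasDerivAt_id z).const_mul 2).sub_const ((b⁻¹ : ℝ) : ℂ)).mul_const (t : ℂ)
    have h5 : HasDerivAt (fun w : ℂ =>
        (b / t - Complex.cosh ((2 * w - b⁻¹) * t) / Real.sinh (t / b)) / t)
        (-(Complex.sinh ((2 * z - b⁻¹) * t) * (2 * t) / Real.sinh (t / b)) / t) z :=
      ((h4.ccosh.div_const _).const_sub _).div_const _
    push_cast at h5 ⊢
    rw [h5.deriv]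
    field_simp
  refine ⟨(integrableOn_congr_fun hder measurableSet_Ioi).1 main.1, ?_⟩
  rw [← setIntegral_congr_fun measurableSet_Ioi hder]
  refine main.2.congr_of_eventuallyEq ?_
  filter_upwards [hUn] with w hw
  have hw1 : w ∈ strip b := ⟨hw.2.1, by rw [Q]; linarith [hw.2.2]⟩
  have hw2 : w + b ∈ strip b := by
    have := hw.2.1
    have := hw.2.2
    constructor <;> simp [Q] <;> linarith
  rw [logSb_eq, logSb_eq,
    ← integral_sub (integrableOn_dsKernel hb (abs_re_lt_of_mem_strip hw2))
      (integrableOn_dsKernel hb (abs_re_lt_of_mem_strip hw1))]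

theorem _root_.HasSum.congr_value {α : Type*} [AddCommMonoid α] [TopologicalSpace α] {f : ℕ → α}
    {x y : α} (h : HasSum f x) (hxy : x = y) : HasSum f y := hxy ▸ h

/-- Partial fractions of `∫₀^∞ sinh(at)/sinh(t/b) dt`, from the geometric series of
`1 / sinh(t/b)`. -/
theorem hasSum_integral_sinh_div_sinh {b : ℝ} (hb : 0 < b) {z : ℂ} (h0 : 0 < z.re)
    (h1 : z.re < b⁻¹) :
    HasSum (fun n : ℕ => b * (1 / (b * z + n) + 1 / (b * z - (n + 1))))
      (∫ t in Set.Ioi (0 : ℝ), -2 * Complex.sinh ((2 * z - b⁻¹) * t) / Real.sinh (t / b)) := by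
  have hb' : (b : ℂ) ≠ 0 := Complex.ofReal_ne_zero.2 hb.ne'
  have hint := (hasDerivAt_logSb_sub hb h0 h1).1
  set F : ℕ → ℝ → ℂ := fun n t =>
    -4 * Complex.sinh ((2 * z - b⁻¹) * t) * ((Real.exp (-(t / b)) * Real.exp (-2 * (t / b)) ^ n : ℝ)) with hF
  have hgeo : ∀ t : ℝ, 0 < t → HasSum (fun n : ℕ => Real.exp (-(t / b)) *
      Real.exp (-2 * (t / b)) ^ n) (1 / (2 * Real.sinh (t / b))) := by
    intro t ht
    have htb : 0 < t / b := by positivity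
    have hlt : Real.exp (-2 * (t / b)) < 1 := Real.exp_lt_one_iff.2 (by linarith)
    have := (hasSum_geometric_of_lt_one (Real.exp_pos _).le hlt).mul_left (Real.exp (-(t / b)))
    refine HasSum.congr_value this ?_
    have h2 : Real.exp (-2 * (t / b)) = Real.exp (-(t / b)) ^ 2 := by
      rw [← Real.exp_nat_mul]; congr 1; push_cast; ring
    rw [h2] at hlt ⊢
    have h3 : Real.exp (t / b) = (Real.exp (-(t / b)))⁻¹ := by rw [Real.exp_neg, inv_inv]
    have h4 : 0 < Real.exp (-(t / b)) := Real.exp_pos _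
    rw [Real.sinh_eq, h3]
    have h5 : 1 - Real.exp (-(t / b)) ^ 2 ≠ 0 := by linarith
    field_simp
  have hsum : ∀ t : ℝ, 0 < t → HasSum (fun n => F n t)
      (-2 * Complex.sinh ((2 * z - b⁻¹) * t) / Real.sinh (t / b)) := by
    intro t ht
    refine HasSum.congr_value ((Complex.hasSum_ofReal.2 (hgeo t ht)).mul_left
      (-4 * Complex.sinh ((2 * z - b⁻¹) * t))) ?_
    push_cast
    ring
  have hsumn : ∀ t : ℝ, 0 < t → HasSum (fun n => ‖F n t‖)
      ‖-2 * Complex.sinh ((2 * z - b⁻¹) * t) / Real.sinh (t / b)‖ := by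
    intro t ht
    have hFn : (fun n => ‖F n t‖) = fun n : ℕ => ‖-4 * Complex.sinh ((2 * z - b⁻¹) * t)‖ *
        (Real.exp (-(t / b)) * Real.exp (-2 * (t / b)) ^ n) := by
      ext n
      simp only [hF]
      rw [norm_mul _ (((_ : ℝ)) : ℂ), Complex.norm_real, Real.norm_of_nonneg (by positivity)]
    rw [hFn]
    refine HasSum.congr_value ((hgeo t ht).mul_left
      ‖-4 * Complex.sinh ((2 * z - b⁻¹) * t)‖) ?_
    · have : 0 < Real.sinh (t / b) := Real.sinh_pos_iff.2 (by positivity)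
      rw [norm_div, norm_mul, norm_mul, Complex.norm_real, Real.norm_of_nonneg this.le]
      norm_num
      field_simp
      ring
  have main := hasSum_integral_of_dominated_convergence
    (μ := volume.restrict (Set.Ioi (0 : ℝ))) (F := F) (fun n t => ‖F n t‖)
    (fun n => Continuous.aestronglyMeasurable (by rw [hF]; fun_prop))
    (fun n => ae_of_all _ fun t => le_rfl)
    ((ae_restrict_iff' measurableSet_Ioi).2 (ae_of_all _ fun t ht => (hsumn t ht).summable))
    ((integrableOn_congr_fun (fun t ht => (hsumn t ht).tsum_eq) measurableSet_Ioi).2 hint.norm)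
    ((ae_restrict_iff' measurableSet_Ioi).2 (ae_of_all _ fun t ht => hsum t ht))
  refine (congrArg (fun f : ℕ → ℂ => HasSum f _) (funext fun n : ℕ => ?_)).mpr main
  have hn : (0 : ℝ) ≤ n := Nat.cast_nonneg n
  set p : ℂ := 2 * z - (2 * n + 2) * (b : ℂ)⁻¹ with hp
  set q : ℂ := -(2 * z) - 2 * n * (b : ℂ)⁻¹ with hq
  have hbinv : (0 : ℝ) < b⁻¹ := inv_pos.2 hb
  have hpre : p.re < 0 := by
    have : p.re = 2 * z.re - (2 * n + 2) * b⁻¹ := by simp [hp, ← Complex.ofReal_inv]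
    rw [this]; nlinarith
  have hqre : q.re < 0 := by
    have : q.re = -(2 * z.re) - 2 * n * b⁻¹ := by simp [hq, ← Complex.ofReal_inv]
    rw [this]; nlinarith
  have hFn : ∀ t : ℝ, F n t = -2 * (Complex.exp (p * t) - Complex.exp (q * t)) := by
    intro t
    simp only [hF]
    push_cast
    rw [← Complex.exp_nat_mul, ← Complex.exp_add, Complex.sinh]
    have e1 : p * t = (2 * z - (b : ℂ)⁻¹) * t + (-(t / b) + n * (-2 * (t / b))) := by
      rw [hp]; ring
    have e2 : q * t = -((2 * z - (b : ℂ)⁻¹) * t) + (-(t / b) + n * (-2 * (t / b))) := by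
      rw [hq]; ring
    rw [e1, e2, Complex.exp_add _ (-(t / b) + n * (-2 * (t / b)) : ℂ),
      Complex.exp_add _ (-(t / b) + n * (-2 * (t / b)) : ℂ)]
    ring
  simp_rw [hFn]
  rw [integral_const_mul, integral_sub (integrableOn_exp_mul_complex_Ioi hpre 0)
    (integrableOn_exp_mul_complex_Ioi hqre 0), integral_exp_mul_complex_Ioi hpre,
    integral_exp_mul_complex_Ioi hqre]
  have hp0 : p ≠ 0 := fun h => by rw [h] at hpre; simp at hpre
  have hq0 : q ≠ 0 := fun h => by rw [h] at hqre; simp at hqre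
  have e1 : (b : ℂ) * z - (n + 1) = b * p / 2 := by rw [hp]; field_simp
  have e2 : (b : ℂ) * z + n = -(b * q / 2) := by rw [hq]; field_simp; ring
  rw [e1, e2]
  simp only [Complex.ofReal_zero, mul_zero, Complex.exp_zero]
  field_simp
  ring

theorem mem_integerComplement_of_re {x : ℂ} (h0 : 0 < x.re) (h1 : x.re < 1) :
    x ∈ Complex.integerComplement := by
  rintro ⟨n, rfl⟩
  simp only [Complex.intCast_re] at h0 h1
  have h0' : 0 < n := by exact_mod_cast h0
  have h1' : n < 1 := by exact_mod_cast h1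
  omega

theorem pi_mul_cot_eq_of_hasSum {x L : ℂ} (h0 : 0 < x.re) (h1 : x.re < 1)
    (h : HasSum (fun n : ℕ => 1 / (x + n) + 1 / (x - (n + 1))) L) :
    L = Real.pi * Complex.cot (Real.pi * x) := by
  have hx := mem_integerComplement_of_re h0 h1
  have hs : HasSum (fun n : ℕ => 1 / (x - (n + 1)) + 1 / (x + (n + 1)))
      (Real.pi * Complex.cot (Real.pi * x) - 1 / x) := by
    rw [cot_series_rep' hx]
    exact (summable_cotTerm hx).hasSum
  have hpart : ∀ N : ℕ, ∑ n ∈ Finset.range N, (1 / (x + n) + 1 / (x - (n + 1))) =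
      1 / x + ∑ n ∈ Finset.range N, (1 / (x - (n + 1)) + 1 / (x + (n + 1)))
        - 1 / (x + N) := by
    intro N
    induction N with
    | zero => simp
    | succ N ih =>
      rw [Finset.sum_range_succ, Finset.sum_range_succ, ih]
      push_cast
      ring
  have hlim : Tendsto (fun N : ℕ => 1 / (x + N)) atTop (𝓝 0) := by
    rw [tendsto_zero_iff_norm_tendsto_zero]
    refine squeeze_zero' (Eventually.of_forall fun N => norm_nonneg _)
      ((eventually_ge_atTop 1).mono fun N hN => ?_) tendsto_one_div_atTop_nhds_zero_nat
    have hN' : (0 : ℝ) < N := by exact_mod_cast hN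
    rw [norm_div, norm_one]
    refine one_div_le_one_div_of_le hN' (le_trans ?_ (Complex.re_le_norm _))
    simp [h0.le]
  have := ((tendsto_const_nhds (x := 1 / x)).add hs.tendsto_sum_nat).sub hlim
  simp_rw [← hpart] at this
  rw [tendsto_nhds_unique h.tendsto_sum_nat this]
  ring

/-- The functional equation up to a constant, from the logarithmic derivative. -/
theorem exists_dsine_add_eq {b : ℝ} (hb : 0 < b) :
    ∃ c : ℂ, ∀ z : ℂ, 0 < z.re → z.re < b⁻¹ → Complex.exp (logSb b (z + b) - logSb b z) =
      c * (2 * Complex.sin (Real.pi * (b * z))) := by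
  set U : Set ℂ := {z | 0 < z.re ∧ z.re < b⁻¹} with hU
  have hUo : IsOpen U := (isOpen_lt continuous_const Complex.continuous_re).inter
    (isOpen_lt Complex.continuous_re continuous_const)
  have hUc : Convex ℝ U := (convex_halfSpace_re_gt 0).inter (convex_halfSpace_re_lt b⁻¹)
  have hbz : ∀ z ∈ U, 0 < ((b : ℂ) * z).re ∧ ((b : ℂ) * z).re < 1 := by
    intro z hz
    rw [Complex.re_ofReal_mul]
    refine ⟨mul_pos hb hz.1, ?_⟩
    have := mul_lt_mul_of_pos_left hz.2 hb
    rwa [mul_inv_cancel₀ hb.ne'] at this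
  have hsin : ∀ z ∈ U, Complex.sin (Real.pi * (b * z)) ≠ 0 := fun z hz =>
    sin_pi_mul_ne_zero (mem_integerComplement_of_re (hbz z hz).1 (hbz z hz).2)
  have hder : ∀ z ∈ U, HasDerivAt (fun z => Complex.exp (logSb b (z + b) - logSb b z) /
      (2 * Complex.sin (Real.pi * (b * z)))) 0 z := by
    intro z hz
    have hs : Complex.sin (Real.pi * (b * z)) ≠ 0 := hsin z hz
    have h1 := (hasDerivAt_logSb_sub hb hz.1 hz.2).2
    have h2 : ∫ t in Set.Ioi (0 : ℝ), -2 * Complex.sinh ((2 * z - b⁻¹) * t) / Real.sinh (t / b) =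
        b * (Real.pi * Complex.cot (Real.pi * (b * z))) := by
      have h3 := hasSum_integral_sinh_div_sinh hb hz.1 hz.2
      have hb' : (b : ℂ) ≠ 0 := Complex.ofReal_ne_zero.2 hb.ne'
      have h4 := (hasSum_mul_left_iff hb').1 (h3.congr_value (mul_inv_cancel_left₀ hb' _).symm)
      rw [← pi_mul_cot_eq_of_hasSum (hbz z hz).1 (hbz z hz).2 h4, mul_inv_cancel_left₀ hb']
    rw [h2] at h1
    have h5 : HasDerivAt (fun z : ℂ => 2 * Complex.sin (Real.pi * (b * z)))
        (2 * (Complex.cos (Real.pi * (b * z)) * (Real.pi * b))) z := by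
      have : HasDerivAt (fun z : ℂ => (Real.pi : ℂ) * (b * z)) (Real.pi * b) z := by
        simpa using ((hasDerivAt_id z).const_mul (b : ℂ)).const_mul (Real.pi : ℂ)
      exact (this.csin).const_mul 2
    refine (h1.cexp.div h5 (mul_ne_zero two_ne_zero hs)).congr_deriv ?_
    rw [Complex.cot_eq_cos_div_sin]
    generalize Complex.sin (Real.pi * (b * z)) = A at *
    field_simp
    ring
  have hz₀ : ((b⁻¹ / 2 : ℝ) : ℂ) ∈ U := by
    have : 0 < b⁻¹ := inv_pos.2 hb
    constructor <;> simp only [Complex.ofReal_re] <;> linarith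
  refine ⟨Complex.exp (logSb b ((b⁻¹ / 2 : ℝ) + b) - logSb b (b⁻¹ / 2 : ℝ)) /
      (2 * Complex.sin (Real.pi * (b * (b⁻¹ / 2 : ℝ)))), fun z h0 h1 => ?_⟩
  · have hz : z ∈ U := ⟨h0, h1⟩
    rw [← div_eq_iff (mul_ne_zero two_ne_zero (hsin z hz))]
    refine hUc.is_const_of_fderivWithin_eq_zero (𝕜 := ℂ)
      (fun w hw => (hder w hw).differentiableAt.differentiableWithinAt) ?_ hz hz₀
    intro w hw
    rw [fderivWithin_of_isOpen hUo hw]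
    ext
    simp [(hder w hw).deriv]

/-- The functional equation `S_b(z + b) = 2 sin(π b z) S_b(z)` on the strip. The constant is fixed
by the duplication formula, which holds for both sides. -/
theorem dsine_add {b : ℝ} (hb : 0 < b) {z : ℂ} (h0 : 0 < z.re) (h1 : z.re < b⁻¹) :
    dsine b (z + b) = 2 * Complex.sin (Real.pi * b * z) * dsine b z := by
  obtain ⟨c, hc⟩ := exists_dsine_add_eq hb
  have hbi : 0 < b⁻¹ := inv_pos.2 hb
  have hb' : (b : ℂ) ≠ 0 := Complex.ofReal_ne_zero.2 hb.ne'
  set H : ℝ → ℂ := fun r => logSb b ((b⁻¹ * r : ℝ) + b) - logSb b (b⁻¹ * r : ℝ) with hH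
  have hHr : ∀ r : ℝ, 0 < r → r < 1 → H r = ∫ t in Set.Ioi (0 : ℝ),
      (b / t - Complex.cosh ((2 * r - 1) * (b⁻¹ * t : ℝ)) / Real.sinh (t / b)) / t := by
    intro r hr hr1
    simp only [hH]
    rw [logSb_shift_sub hb (by simpa using mul_pos hbi hr)
      (by simpa using mul_lt_mul_of_pos_left hr1 hbi)]
    congr 1 with t
    congr 4
    push_cast
    ring
  have hEr : ∀ r : ℝ, 0 < r → r < 1 →
      Complex.exp (H r) = c * (2 * Complex.sin (Real.pi * r)) := by
    intro r hr hr1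
    rw [hH]
    dsimp only
    rw [hc _ (by simpa using mul_pos hbi hr) (by simpa using mul_lt_mul_of_pos_left hr1 hbi)]
    congr 4
    push_cast
    field_simp
  -- duplication: in the sum of the two integrals `sinh` doubles its argument, and `t ↦ t / 2` turns
  -- it into the integral at `1 / 2`
  have hdup : H (1 / 4) + H (3 / 4) = H (1 / 2) := by
    rw [hHr _ (by norm_num) (by norm_num), hHr _ (by norm_num) (by norm_num),
      hHr _ (by norm_num) (by norm_num)]
    have e1 : ∀ t : ℝ, Complex.cosh ((2 * (1 / 4 : ℝ) - 1) * (b⁻¹ * t : ℝ)) =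
        (Real.cosh (b⁻¹ * t / 2) : ℝ) := by
      intro t
      rw [Complex.ofReal_cosh, ← Complex.cosh_neg]
      congr 1; push_cast; ring
    have e2 : ∀ t : ℝ, Complex.cosh ((2 * (3 / 4 : ℝ) - 1) * (b⁻¹ * t : ℝ)) =
        (Real.cosh (b⁻¹ * t / 2) : ℝ) := by
      intro t
      rw [Complex.ofReal_cosh]
      congr 1; push_cast; ring
    have e3 : ∀ t : ℝ, Complex.cosh ((2 * (1 / 2 : ℝ) - 1) * (b⁻¹ * t : ℝ)) = 1 := by
      intro t
      rw [show (2 * ((1 / 2 : ℝ) : ℂ) - 1) = 0 by norm_num, zero_mul, Complex.cosh_zero]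
    simp_rw [e1, e2, e3]
    rw [← two_mul]
    set f : ℝ → ℂ := fun t => ((b : ℂ) / t - 1 / (Real.sinh (t / b) : ℝ)) / t with hf
    have hsub := integral_comp_mul_left_Ioi f 0 (b := 1 / 2) (by norm_num)
    rw [mul_zero] at hsub
    have hf2 : ∀ t : ℝ, 0 < t → ((b : ℂ) / t - (Real.cosh (b⁻¹ * t / 2) : ℝ) /
        (Real.sinh (t / b) : ℝ)) / t = 1 / 4 * f (1 / 2 * t) := by
      intro t ht
      have ht' : (t : ℂ) ≠ 0 := Complex.ofReal_ne_zero.2 ht.ne'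
      have hs : Real.sinh (t / b) = 2 * Real.sinh (1 / 2 * t / b) * Real.cosh (b⁻¹ * t / 2) := by
        rw [show t / b = 2 * (1 / 2 * t / b) by ring, Real.sinh_two_mul]
        congr 2; ring
      have h5 : Real.sinh (1 / 2 * t / b) ≠ 0 := (Real.sinh_pos_iff.2 (by positivity)).ne'
      have h6 : Real.cosh (b⁻¹ * t / 2) ≠ 0 := (Real.cosh_pos _).ne'
      have h5' := Complex.ofReal_ne_zero.2 h5
      have h6' := Complex.ofReal_ne_zero.2 h6
      rw [hf, hs]
      dsimp only
      rw [Complex.ofReal_mul (2 * _), Complex.ofReal_mul 2]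
      generalize ((Real.sinh (1 / 2 * t / b) : ℝ) : ℂ) = A at *
      generalize ((Real.cosh (b⁻¹ * t / 2) : ℝ) : ℂ) = B at *
      push_cast
      field_simp
      ring
    rw [setIntegral_congr_fun (g := fun t => 1 / 4 * f (1 / 2 * t)) measurableSet_Ioi
      fun t ht => hf2 t ht, integral_const_mul, hsub, Complex.real_smul]
    push_cast
    ring
  -- `2 sin (π / 4) * 2 sin (3 π / 4) = 2 sin (π / 2)`, so that `c * c = c`
  have hc1 : c = 1 := by
    have h4 := hEr (1 / 4) (by norm_num) (by norm_num)
    have h34 := hEr (3 / 4) (by norm_num) (by norm_num)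
    have h2 := hEr (1 / 2) (by norm_num) (by norm_num)
    rw [← hdup, Complex.exp_add, h4, h34] at h2
    have s4 : Complex.sin (Real.pi * (1 / 4 : ℝ)) = ((√2 / 2 : ℝ) : ℂ) := by
      rw [← Complex.ofReal_mul, ← Complex.ofReal_sin, ← Real.sin_pi_div_four]
      congr 2; ring
    have s34 : Complex.sin (Real.pi * (3 / 4 : ℝ)) = ((√2 / 2 : ℝ) : ℂ) := by
      rw [← Complex.ofReal_mul, ← Complex.ofReal_sin, ← Real.sin_pi_div_four,
        ← Real.sin_pi_sub]
      congr 2; ring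
    have s2 : Complex.sin (Real.pi * (1 / 2 : ℝ)) = 1 := by
      rw [← Complex.ofReal_mul, ← Complex.ofReal_sin, mul_one_div, Real.sin_pi_div_two,
        Complex.ofReal_one]
    have hcne : c ≠ 0 := by
      rintro rfl
      rw [zero_mul] at h4
      exact Complex.exp_ne_zero _ h4
    have hsq : ((√2 : ℝ) : ℂ) ^ 2 = 2 := by
      rw [← Complex.ofReal_pow, Real.sq_sqrt zero_le_two, Complex.ofReal_ofNat]
    rw [s4, s34, s2] at h2
    push_cast at h2
    have h7 : c * (c - 1) = 0 := by linear_combination (1 / 2) * h2 - (c ^ 2 / 2) * hsq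
    rcases mul_eq_zero.1 h7 with h | h
    · exact absurd h hcne
    · exact sub_eq_zero.1 h
  have := hc z h0 h1
  rw [hc1, one_mul, Complex.exp_sub, div_eq_iff (Complex.exp_ne_zero _)] at this
  rw [dsine, dsine, this, mul_assoc (Real.pi : ℂ)]

/-! ### The star-triangle integral -/

theorem integrable_exp_neg_mul_abs {a : ℝ} (ha : 0 < a) :
    Integrable fun y : ℝ => Real.exp (-a * |y|) := by
  have h1 : IntegrableOn (fun y : ℝ => Real.exp (-a * |y|)) (Set.Iic 0) := by
    refine (integrableOn_exp_mul_Iic ha 0).congr_fun (fun y hy => ?_) measurableSet_Iic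
    dsimp only
    rw [abs_of_nonpos hy]; ring_nf
  have h2 : IntegrableOn (fun y : ℝ => Real.exp (-a * |y|)) (Set.Ioi 0) := by
    refine (integrableOn_exp_mul_Ioi (neg_neg_of_pos ha) 0).congr_fun (fun y hy => ?_)
      measurableSet_Ioi
    dsimp only
    rw [abs_of_pos hy]
  have := h1.union h2
  rwa [Set.Iic_union_Ioi, integrableOn_univ] at this

/-- The growth estimate in a form that tolerates a bounded error `R` in the imaginary part. -/
theorem exists_norm_dsine_le_of_im_near {b : ℝ} (hb : 0 < b) {x₀ : ℝ} (hx₀ : 0 < x₀) (R : ℝ) :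
    ∃ C : ℝ, 0 < C ∧ ∀ (z : ℂ) (T : ℝ), x₀ ≤ z.re → z.re ≤ Q b - x₀ → |z.im - T| ≤ R →
      ‖dsine b z‖ ≤ C * Real.exp (decayRate * (z.re - Q b / 2) * |T|) := by
  obtain ⟨C, hC, h⟩ := exists_norm_dsine_le hb hx₀
  refine ⟨C * Real.exp (decayRate * (Q b / 2) * |R|), by positivity, fun z T h1 h2 h3 => ?_⟩
  refine (h z h1 h2).trans ?_
  rw [mul_assoc C (Real.exp _), ← Real.exp_add]
  refine mul_le_mul_of_nonneg_left (Real.exp_le_exp.2 ?_) hC.le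
  have hk := decayRate_pos
  have h4 : |z.re - Q b / 2| ≤ Q b / 2 := abs_le.2 ⟨by linarith, by linarith⟩
  have h5 : |(|z.im| - |T|)| ≤ |R| :=
    (abs_abs_sub_abs_le _ _).trans (h3.trans (le_abs_self R))
  have h6 : (z.re - Q b / 2) * (|z.im| - |T|) ≤ Q b / 2 * |R| :=
    (le_abs_self _).trans (by
      rw [abs_mul]
      exact mul_le_mul h4 h5 (abs_nonneg _) (by linarith [Q_pos hb]))
  nlinarith

/-- The star-triangle integrand `∏ᵢ S_b(μᵢ - z) S_b(νᵢ + z)`. -/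
def stKernel (b : ℝ) (μ ν : Fin 3 → ℂ) (z : ℂ) : ℂ :=
  ∏ i, (dsine b (μ i - z) * dsine b (ν i + z))

/-- The integral of the star-triangle integrand over the imaginary axis `z = iy`. -/
def stIntegral (b : ℝ) (μ ν : Fin 3 → ℂ) : ℂ := ∫ y : ℝ, stKernel b μ ν (Complex.I * y)

/-- The product `∏ᵢⱼ S_b(μᵢ + νⱼ)`, the value of the star-triangle integral. -/
def stProd (b : ℝ) (μ ν : Fin 3 → ℂ) : ℂ := ∏ i, ∏ j, dsine b (μ i + ν j)

theorem stProd_ne_zero (b : ℝ) (μ ν : Fin 3 → ℂ) : stProd b μ ν ≠ 0 :=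
  Finset.prod_ne_zero_iff.2 fun _ _ => Finset.prod_ne_zero_iff.2 fun _ _ => dsine_ne_zero _ _

theorem exists_norm_stKernel_le {b : ℝ} (hb : 0 < b) {x₀ : ℝ} (hx₀ : 0 < x₀) (R : ℝ) :
    ∃ C : ℝ, 0 < C ∧ ∀ μ ν : Fin 3 → ℂ,
      (∀ i, x₀ ≤ (μ i).re ∧ (μ i).re ≤ Q b - x₀ ∧ |(μ i).im| ≤ R) →
      (∀ i, x₀ ≤ (ν i).re ∧ (ν i).re ≤ Q b - x₀ ∧ |(ν i).im| ≤ R) → ∀ y : ℝ,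
      ‖stKernel b μ ν (Complex.I * y)‖ ≤
        C * Real.exp (decayRate * (∑ i, ((μ i).re + (ν i).re) - 3 * Q b) * |y|) := by
  obtain ⟨C, hC, h⟩ := exists_norm_dsine_le_of_im_near hb hx₀ R
  refine ⟨(C * C) ^ 3, by positivity, fun μ ν hμ hν y => ?_⟩
  have key : ∀ i, ‖dsine b (μ i - Complex.I * y) * dsine b (ν i + Complex.I * y)‖ ≤
      C * C * Real.exp (decayRate * ((μ i).re + (ν i).re - Q b) * |y|) := by
    intro i
    have h1 := h (μ i - Complex.I * y) (-y) (by simpa using (hμ i).1)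
      (by simpa using (hμ i).2.1) (by simpa using (hμ i).2.2)
    have h2 := h (ν i + Complex.I * y) y (by simpa using (hν i).1)
      (by simpa using (hν i).2.1) (by simpa using (hν i).2.2)
    rw [norm_mul]
    refine (mul_le_mul h1 h2 (norm_nonneg _) (by positivity)).trans (le_of_eq ?_)
    rw [mul_mul_mul_comm, ← Real.exp_add, abs_neg]
    congr 2
    simp
    ring
  rw [stKernel, norm_prod]
  refine (Finset.prod_le_prod (fun _ _ => norm_nonneg _) fun i _ => key i).trans (le_of_eq ?_)
  simp only [Fin.prod_univ_three, Fin.sum_univ_three]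
  have : decayRate * ((μ 0).re + (ν 0).re + ((μ 1).re + (ν 1).re) + ((μ 2).re + (ν 2).re)
      - 3 * Q b) * |y| = decayRate * ((μ 0).re + (ν 0).re - Q b) * |y| +
      decayRate * ((μ 1).re + (ν 1).re - Q b) * |y| +
      decayRate * ((μ 2).re + (ν 2).re - Q b) * |y| := by ring
  rw [this, Real.exp_add, Real.exp_add]
  ring

theorem continuous_dsine_comp {b : ℝ} (hb : 0 < b) {X : Type*} [TopologicalSpace X] {f : X → ℂ}
    (hf : Continuous f) (h : ∀ x, f x ∈ strip b) : Continuous fun x => dsine b (f x) :=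
  (continuousOn_dsine hb).comp_continuous hf h

theorem continuous_stKernel {b : ℝ} (hb : 0 < b) {μ ν : Fin 3 → ℂ} (hμ : ∀ i, μ i ∈ strip b)
    (hν : ∀ i, ν i ∈ strip b) : Continuous fun y : ℝ => stKernel b μ ν (Complex.I * y) := by
  unfold stKernel
  refine continuous_finsetProd _ fun i _ => Continuous.mul ?_ ?_
  · exact continuous_dsine_comp hb (by fun_prop) fun y => by
      simpa [strip] using hμ i
  · exact continuous_dsine_comp hb (by fun_prop) fun y => by
      simpa [strip] using hν i

theorem differentiableAt_dsine {b : ℝ} (hb : 0 < b) {z : ℂ} (hz : z ∈ strip b) :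
    DifferentiableAt ℂ (dsine b) z :=
  (differentiableOn_dsine hb).differentiableAt ((isOpen_strip b).mem_nhds hz)

/-- Finitely many points of the strip have a common margin, which persists nearby. -/
theorem exists_margin {b : ℝ} {ι : Type*} [Finite ι] {f : ℂ → ι → ℂ} {t₀ : ℂ}
    (hf : ∀ i, ContinuousAt (fun t => f t i) t₀) (h : ∀ i, f t₀ i ∈ strip b) :
    ∃ x₀ > 0, ∃ R : ℝ, ∀ᶠ t in 𝓝 t₀, ∀ i,
      x₀ ≤ (f t i).re ∧ (f t i).re ≤ Q b - x₀ ∧ |(f t i).im| ≤ R := by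
  classical
  cases nonempty_fintype ι
  obtain ⟨x₀, hx₀, hx⟩ : ∃ x₀ > 0, ∀ i, x₀ < (f t₀ i).re ∧ (f t₀ i).re < Q b - x₀ := by
    have : ∀ᶠ x : ℝ in 𝓝[>] 0, ∀ i, x < (f t₀ i).re ∧ (f t₀ i).re < Q b - x := by
      refine eventually_all.2 fun i => Filter.Eventually.filter_mono nhdsWithin_le_nhds ?_
      refine (IsOpen.inter (isOpen_lt continuous_id continuous_const)
        (isOpen_lt continuous_const (continuous_const.sub continuous_id))).mem_nhds ?_
      simpa [strip] using h i
    obtain ⟨x, hx, hx0⟩ := (this.and self_mem_nhdsWithin).exists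
    exact ⟨x, hx0, hx⟩
  refine ⟨x₀, hx₀, ∑ i, |(f t₀ i).im| + 1, eventually_all.2 fun i => ?_⟩
  have hre : ContinuousAt (fun t => (f t i).re) t₀ :=
    Complex.continuous_re.continuousAt.comp (hf i)
  have him : ContinuousAt (fun t => |(f t i).im|) t₀ :=
    (Complex.continuous_im.continuousAt.comp (hf i)).abs
  have hle : |(f t₀ i).im| ≤ ∑ i, |(f t₀ i).im| :=
    Finset.single_le_sum (f := fun i => |(f t₀ i).im|) (fun _ _ => abs_nonneg _)
      (Finset.mem_univ i)
  filter_upwards [hre.eventually_const_lt (hx i).1, hre.eventually_lt_const (hx i).2,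
    him.eventually_lt_const (show |(f t₀ i).im| < ∑ i, |(f t₀ i).im| + 1 by linarith)]
    with t h1 h2 h3
  exact ⟨h1.le, h2.le, h3.le⟩

/-- The star-triangle integrand is locally uniformly dominated in its parameters. -/
theorem exists_stKernel_bound {b : ℝ} (hb : 0 < b) {μ ν : ℂ → Fin 3 → ℂ} {t₀ : ℂ}
    (hμc : ∀ i, ContinuousAt (fun t => μ t i) t₀) (hνc : ∀ i, ContinuousAt (fun t => ν t i) t₀)
    (hμ : ∀ i, μ t₀ i ∈ strip b) (hν : ∀ i, ν t₀ i ∈ strip b)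
    (hsum : ∑ i, ((μ t₀ i).re + (ν t₀ i).re) < 3 * Q b) :
    ∃ C > 0, ∃ a > 0, ∀ᶠ t in 𝓝 t₀, ∀ y : ℝ,
      ‖stKernel b (μ t) (ν t) (Complex.I * y)‖ ≤ C * Real.exp (-a * |y|) := by
  obtain ⟨x₁, hx₁, R₁, h₁⟩ := exists_margin hμc hμ
  obtain ⟨x₂, hx₂, R₂, h₂⟩ := exists_margin hνc hν
  obtain ⟨C, hC, h⟩ := exists_norm_stKernel_le hb (lt_min hx₁ hx₂) (max R₁ R₂)
  obtain ⟨s, hs1, hs2⟩ := exists_between hsum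
  have hcont : ContinuousAt (fun t => ∑ i, ((μ t i).re + (ν t i).re)) t₀ := by
    refine tendsto_finsetSum _ fun i _ => Tendsto.add ?_ ?_
    · exact Complex.continuous_re.continuousAt.comp (hμc i)
    · exact Complex.continuous_re.continuousAt.comp (hνc i)
  refine ⟨C, hC, decayRate * (3 * Q b - s), mul_pos decayRate_pos (by linarith), ?_⟩
  filter_upwards [h₁, h₂, hcont.eventually_lt_const hs1] with t ht₁ ht₂ hts y
  refine (h (μ t) (ν t) (fun i => ?_) (fun i => ?_) y).trans ?_
  · obtain ⟨h3, h4, h5⟩ := ht₁ i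
    exact ⟨(min_le_left _ _).trans h3, h4.trans (by linarith [min_le_left x₁ x₂]),
      h5.trans (le_max_left _ _)⟩
  · obtain ⟨h3, h4, h5⟩ := ht₂ i
    exact ⟨(min_le_right _ _).trans h3, h4.trans (by linarith [min_le_right x₁ x₂]),
      h5.trans (le_max_right _ _)⟩
  · have := decayRate_pos
    have h6 : -(decayRate * (3 * Q b - s)) = decayRate * (s - 3 * Q b) := by ring
    rw [h6]
    gcongr

theorem integrable_stKernel {b : ℝ} (hb : 0 < b) {μ ν : Fin 3 → ℂ} (hμ : ∀ i, μ i ∈ strip b)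
    (hν : ∀ i, ν i ∈ strip b) (hsum : ∑ i, ((μ i).re + (ν i).re) < 3 * Q b) :
    Integrable fun y : ℝ => stKernel b μ ν (Complex.I * y) := by
  obtain ⟨C, hC, a, ha, h⟩ := exists_stKernel_bound hb (μ := fun _ => μ) (ν := fun _ => ν) (t₀ := 0)
    (fun i => continuousAt_const) (fun i => continuousAt_const) hμ hν hsum
  exact ((integrable_exp_neg_mul_abs ha).const_mul C).mono' (continuous_stKernel hb hμ hν).aestronglyMeasurable
    (ae_of_all _ h.self_of_nhds)

/-- The star-triangle integral depends holomorphically on its parameters. -/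
theorem differentiableOn_stIntegral {b : ℝ} (hb : 0 < b) {U : Set ℂ} (hU : IsOpen U)
    {μ ν : ℂ → Fin 3 → ℂ} (hμd : ∀ i, DifferentiableOn ℂ (fun t => μ t i) U)
    (hνd : ∀ i, DifferentiableOn ℂ (fun t => ν t i) U)
    (hμ : ∀ t ∈ U, ∀ i, μ t i ∈ strip b) (hν : ∀ t ∈ U, ∀ i, ν t i ∈ strip b)
    (hsum : ∀ t ∈ U, ∑ i, ((μ t i).re + (ν t i).re) < 3 * Q b) :
    DifferentiableOn ℂ (fun t => stIntegral b (μ t) (ν t)) U := by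
  refine differentiableOn_integral_of_locally_bounded hU
    (fun t ht => (continuous_stKernel hb (hμ t ht) (hν t ht)).aestronglyMeasurable)
    (ae_of_all _ fun y => ?_) fun t ht => ?_
  · unfold stKernel
    refine DifferentiableOn.fun_finsetProd fun i _ => DifferentiableOn.mul ?_ ?_
    · refine (differentiableOn_dsine hb).comp ((hμd i).sub_const _) fun t ht => ?_
      simpa [strip] using hμ t ht i
    · refine (differentiableOn_dsine hb).comp ((hνd i).add_const _) fun t ht => ?_
      simpa [strip] using hν t ht i
  · have hUn := hU.mem_nhds ht
    obtain ⟨C, hC, a, ha, h⟩ := exists_stKernel_bound hb (t₀ := t)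
      (fun i => ((hμd i).differentiableAt hUn).continuousAt)
      (fun i => ((hνd i).differentiableAt hUn).continuousAt) (hμ t ht) (hν t ht) (hsum t ht)
    exact ⟨_, h, _, (integrable_exp_neg_mul_abs ha).const_mul C, ae_of_all _ fun y w hw => hw.1 y⟩

/-- Shifting the contour of the star-triangle integral by a real amount `c`. -/
theorem stIntegral_shift {b : ℝ} (hb : 0 < b) {μ ν : Fin 3 → ℂ} {c : ℝ} (hμ : ∀ i, μ i ∈ strip b)
    (hν : ∀ i, ν i ∈ strip b) (hμc : ∀ i, μ i - c ∈ strip b) (hνc : ∀ i, ν i + c ∈ strip b)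
    (hsum : ∑ i, ((μ i).re + (ν i).re) < 3 * Q b) :
    stIntegral b (fun i => μ i - c) (fun i => ν i + c) = stIntegral b μ ν := by
  set U : Set ℂ := {w | ∀ i, μ i - Complex.I * w ∈ strip b ∧ ν i + Complex.I * w ∈ strip b} with hU
  have hUo : IsOpen U := by
    rw [hU]
    simp only [Set.ofPred_forall]
    refine isOpen_iInter_of_finite fun i => IsOpen.inter ?_ ?_
    · exact (isOpen_strip b).preimage (f := fun w => μ i - Complex.I * w) (by fun_prop)
    · exact (isOpen_strip b).preimage (f := fun w => ν i + Complex.I * w) (by fun_prop)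
  have hUc : Convex ℝ U := by
    intro x hx y hy p q hp hq hpq i
    have hpq' : (p : ℂ) + q = 1 := by exact_mod_cast hpq
    have h1 := convex_strip b (hx i).1 (hy i).1 hp hq hpq
    have h2 := convex_strip b (hx i).2 (hy i).2 hp hq hpq
    simp only [Complex.real_smul] at h1 h2 ⊢
    rw [show (p : ℂ) * (μ i - Complex.I * x) + q * (μ i - Complex.I * y) =
      μ i - Complex.I * (p * x + q * y) by linear_combination μ i * hpq'] at h1
    rw [show (p : ℂ) * (ν i + Complex.I * x) + q * (ν i + Complex.I * y) =
      ν i + Complex.I * (p * x + q * y) by linear_combination ν i * hpq'] at h2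
    exact ⟨h1, h2⟩
  have hd := differentiableOn_stIntegral hb hUo (μ := fun w i => μ i - Complex.I * w)
    (ν := fun w i => ν i + Complex.I * w) (fun i => by fun_prop) (fun i => by fun_prop)
    (fun t ht i => (ht i).1) (fun t ht i => (ht i).2) (fun t ht => by
      refine lt_of_eq_of_lt (Finset.sum_congr rfl fun i _ => ?_) hsum
      simp
      ring)
  have hinv : ∀ w ∈ U, ∀ r : ℝ, stIntegral b (fun i => μ i - Complex.I * (w + r))
      (fun i => ν i + Complex.I * (w + r)) =
      stIntegral b (fun i => μ i - Complex.I * w) (fun i => ν i + Complex.I * w) := by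
    intro w _ r
    unfold stIntegral
    rw [← integral_add_right_eq_self (μ := volume) (fun y : ℝ => stKernel b
      (fun i => μ i - Complex.I * w) (fun i => ν i + Complex.I * w) (Complex.I * y)) r]
    congr 1 with y
    unfold stKernel
    congr 1 with i
    push_cast
    congr 2 <;> ring
  have h1 : -Complex.I * c ∈ U := by
    intro i
    rw [show Complex.I * (-Complex.I * c) = c by
      rw [← mul_assoc, mul_neg, Complex.I_mul_I, neg_neg, one_mul]]
    exact ⟨hμc i, hνc i⟩
  have h2 : (0 : ℂ) ∈ U := fun i => by simpa using ⟨hμ i, hν i⟩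
  have := eq_of_translation_invariant hUo hUc hd hinv h1 h2
  simpa [show ∀ x : ℂ, Complex.I * (Complex.I * x) = -x from fun x => by
    rw [← mul_assoc, Complex.I_mul_I]; ring] using this

/-! ### Invariance of the star-triangle integral under shifts of the parameters -/

/-- The trigonometric identity behind the shift invariance of the star-triangle integral. -/
theorem sin_star_triangle (a₁ a₂ a₃ c₁ c₂ c₃ : ℂ)
    (h : a₁ + a₂ + a₃ + c₁ + c₂ + c₃ = Real.pi) :
    Complex.sin a₁ * Complex.sin (a₂ + c₁) * Complex.sin (a₃ + c₁)
      - Complex.sin c₁ * Complex.sin (a₁ + c₂) * Complex.sin (a₁ + c₃) =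
    Complex.sin a₁ * Complex.sin a₂ * Complex.sin a₃
      - Complex.sin c₁ * Complex.sin c₂ * Complex.sin c₃ := by
  have h1 : Complex.sin c₃ = Complex.sin (a₁ + a₂ + a₃ + c₁ + c₂) := by
    rw [← Complex.sin_pi_sub, ← h]; congr 1; ring
  have h2 : Complex.sin (a₁ + c₃) = Complex.sin (a₂ + a₃ + c₁ + c₂) := by
    rw [← Complex.sin_pi_sub, ← h]; congr 1; ring
  rw [h1, h2]
  simp only [Complex.sin, add_mul, neg_add, Complex.exp_add, neg_mul, Complex.exp_neg]
  have e1 := Complex.exp_ne_zero (a₁ * Complex.I)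
  have e2 := Complex.exp_ne_zero (a₂ * Complex.I)
  have e3 := Complex.exp_ne_zero (a₃ * Complex.I)
  have e4 := Complex.exp_ne_zero (c₁ * Complex.I)
  have e5 := Complex.exp_ne_zero (c₂ * Complex.I)
  generalize Complex.exp (a₁ * Complex.I) = A at *
  generalize Complex.exp (a₂ * Complex.I) = B at *
  generalize Complex.exp (a₃ * Complex.I) = D at *
  generalize Complex.exp (c₁ * Complex.I) = E at *
  generalize Complex.exp (c₂ * Complex.I) = F at *
  field_simp
  ring

/-- The functional equation with the shift written on the argument. -/
theorem dsine_of_eq_add {b : ℝ} (hb : 0 < b) {x y : ℂ} (hxy : x = y + b) (h0 : 0 < y.re)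
    (h1 : x.re < Q b) : dsine b x = 2 * Complex.sin (Real.pi * b * y) * dsine b y := by
  subst hxy
  refine dsine_add hb h0 ?_
  simp [Q] at h1
  linarith

/-- The six-parameter star-triangle integral divided by its expected value. -/
def stRatio (b : ℝ) (m₁ m₂ m₃ n₁ n₂ n₃ : ℂ) : ℂ :=
  stIntegral b ![m₁, m₂, m₃] ![n₁, n₂, n₃] / stProd b ![m₁, m₂, m₃] ![n₁, n₂, n₃]

/-- Invariance of the normalized integral under `μ₁ → μ₁ + b`, `ν₁ → ν₁ - b`: the change of the
integrand is a difference `G(z + b) - G(z)`, which integrates to zero by a contour shift. -/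
theorem stRatio_shift {b : ℝ} (hb : 0 < b) {m₁ m₂ m₃ n₁ n₂ n₃ : ℂ} (hm₁ : 0 < m₁.re)
    (hm₂ : 0 < m₂.re) (hm₃ : 0 < m₃.re) (hn₁ : b < n₁.re) (hn₂ : 0 < n₂.re) (hn₃ : 0 < n₃.re)
    (hsum : m₁ + m₂ + m₃ + n₁ + n₂ + n₃ = Q b) :
    stRatio b (m₁ + b) m₂ m₃ (n₁ - b) n₂ n₃ = stRatio b m₁ m₂ m₃ n₁ n₂ n₃ := by
  have hre : m₁.re + m₂.re + m₃.re + n₁.re + n₂.re + n₃.re = Q b := by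
    simpa using congrArg Complex.re hsum
  have hmem : ∀ x : ℂ, 0 < x.re → x.re < Q b → x ∈ strip b := fun x h1 h2 => ⟨h1, h2⟩
  have hbi : 0 < b⁻¹ := inv_pos.2 hb
  have hQ : Q b = b + b⁻¹ := rfl
  -- the two integrands to be compared, and the function `g` with `g' z = g (z + b)`
  set f := stKernel b ![m₁, m₂, m₃] ![n₁, n₂, n₃] with hf
  set f' := stKernel b ![m₁ + b, m₂, m₃] ![n₁ - b, n₂, n₃] with hf'
  set g := stKernel b ![m₁ + b, m₂ + b, m₃ + b] ![n₁ - b, n₂, n₃] with hg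
  set g' := stKernel b ![m₁, m₂, m₃] ![n₁, n₂ + b, n₃ + b] with hg'
  set P := stProd b ![m₁, m₂, m₃] ![n₁, n₂, n₃] with hP
  set P' := stProd b ![m₁ + b, m₂, m₃] ![n₁ - b, n₂, n₃] with hP'
  have hP0 : P ≠ 0 := stProd_ne_zero _ _ _
  have hP'0 : P' ≠ 0 := stProd_ne_zero _ _ _
  set s : ℂ → ℂ := fun x => Complex.sin (Real.pi * b * x) with hs
  -- the functional equation, applied to the factors of the product that change
  have hPP : P' * (s (m₂ + n₁ - b) * s (m₃ + n₁ - b)) = P * (s (m₁ + n₂) * s (m₁ + n₃)) := by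
    have e1 : dsine b (m₁ + b + n₂) = 2 * s (m₁ + n₂) * dsine b (m₁ + n₂) :=
      dsine_of_eq_add hb (by ring) (by simp; linarith) (by simp; linarith)
    have e2 : dsine b (m₁ + b + n₃) = 2 * s (m₁ + n₃) * dsine b (m₁ + n₃) :=
      dsine_of_eq_add hb (by ring) (by simp; linarith) (by simp; linarith)
    have e3 : dsine b (m₂ + n₁) = 2 * s (m₂ + n₁ - b) * dsine b (m₂ + (n₁ - b)) := by
      rw [show m₂ + (n₁ - b) = m₂ + n₁ - b by ring]
      exact dsine_of_eq_add hb (by ring) (by simp; linarith) (by simp; linarith)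
    have e4 : dsine b (m₃ + n₁) = 2 * s (m₃ + n₁ - b) * dsine b (m₃ + (n₁ - b)) := by
      rw [show m₃ + (n₁ - b) = m₃ + n₁ - b by ring]
      exact dsine_of_eq_add hb (by ring) (by simp; linarith) (by simp; linarith)
    have e5 : dsine b (m₁ + b + (n₁ - b)) = dsine b (m₁ + n₁) := by congr 1; ring
    simp only [hP, hP', stProd, Fin.prod_univ_three, Matrix.cons_val_zero, Matrix.cons_val_one,
      Matrix.cons_val]
    rw [e1, e2, e3, e4, e5]
    ring
  have hs2 : s (m₁ + n₂) ≠ 0 := by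
    intro h0
    have e1 : dsine b (m₁ + b + n₂) = 2 * s (m₁ + n₂) * dsine b (m₁ + n₂) :=
      dsine_of_eq_add hb (by ring) (by simp; linarith) (by simp; linarith)
    rw [h0] at e1
    exact dsine_ne_zero b (m₁ + b + n₂) (by rw [e1]; ring)
  have hs3 : s (m₁ + n₃) ≠ 0 := by
    intro h0
    have e1 : dsine b (m₁ + b + n₃) = 2 * s (m₁ + n₃) * dsine b (m₁ + n₃) :=
      dsine_of_eq_add hb (by ring) (by simp; linarith) (by simp; linarith)
    rw [h0] at e1
    exact dsine_ne_zero b (m₁ + b + n₃) (by rw [e1]; ring)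
  -- the difference of the normalized integrands is proportional to `g z - g (z + b)`
  have hpt : ∀ y : ℝ, f' (Complex.I * y) / P' - f (Complex.I * y) / P =
      (4 * (s (m₁ + n₂) * s (m₁ + n₃)) * P)⁻¹ * (g (Complex.I * y) - g' (Complex.I * y)) := by
    intro y
    set z : ℂ := Complex.I * y with hz
    have hzre : z.re = 0 := by simp [hz]
    have a1 : dsine b (m₁ + b - z) = 2 * s (m₁ - z) * dsine b (m₁ - z) :=
      dsine_of_eq_add hb (by ring) (by simp [hzre]; linarith) (by simp [hzre]; linarith)
    have a2 : dsine b (m₂ + b - z) = 2 * s (m₂ - z) * dsine b (m₂ - z) :=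
      dsine_of_eq_add hb (by ring) (by simp [hzre]; linarith) (by simp [hzre]; linarith)
    have a3 : dsine b (m₃ + b - z) = 2 * s (m₃ - z) * dsine b (m₃ - z) :=
      dsine_of_eq_add hb (by ring) (by simp [hzre]; linarith) (by simp [hzre]; linarith)
    have c1 : dsine b (n₁ + z) = 2 * s (n₁ - b + z) * dsine b (n₁ - b + z) :=
      dsine_of_eq_add hb (by ring) (by simp [hzre]; linarith) (by simp [hzre]; linarith)
    have c2 : dsine b (n₂ + b + z) = 2 * s (n₂ + z) * dsine b (n₂ + z) :=
      dsine_of_eq_add hb (by ring) (by simp [hzre]; linarith) (by simp [hzre]; linarith)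
    have c3 : dsine b (n₃ + b + z) = 2 * s (n₃ + z) * dsine b (n₃ + z) :=
      dsine_of_eq_add hb (by ring) (by simp [hzre]; linarith) (by simp [hzre]; linarith)
    have htrig : s (m₁ - z) * s (m₂ + n₁ - b) * s (m₃ + n₁ - b)
        - s (n₁ - b + z) * s (m₁ + n₂) * s (m₁ + n₃) =
        s (m₁ - z) * s (m₂ - z) * s (m₃ - z) - s (n₁ - b + z) * s (n₂ + z) * s (n₃ + z) := by
      have hb' : (b : ℂ) ≠ 0 := Complex.ofReal_ne_zero.2 hb.ne'
      have := sin_star_triangle (Real.pi * b * (m₁ - z)) (Real.pi * b * (m₂ - z))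
        (Real.pi * b * (m₃ - z)) (Real.pi * b * (n₁ - b + z)) (Real.pi * b * (n₂ + z))
        (Real.pi * b * (n₃ + z)) (by
          have hQ' : (Q b : ℂ) = b + (b : ℂ)⁻¹ := by rw [hQ]; push_cast; ring
          rw [hQ'] at hsum
          have : m₁ + m₂ + m₃ + n₁ + n₂ + n₃ - b = (b : ℂ)⁻¹ := by rw [hsum]; ring
          calc _ = Real.pi * b * (m₁ + m₂ + m₃ + n₁ + n₂ + n₃ - b) := by ring
            _ = _ := by rw [this]; field_simp)
      simp only [hs]
      rw [← this]
      congr 3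
      · congr 2; ring_nf
      · ring_nf
      · congr 2; ring_nf
      · ring_nf
    have hF : f' z * (s (m₂ + n₁ - b) * s (m₃ + n₁ - b)) - f z * (s (m₁ + n₂) * s (m₁ + n₃)) =
        (g z - g' z) / 4 := by
      simp only [hf, hf', hg, hg', stKernel, Fin.prod_univ_three, Matrix.cons_val_zero,
        Matrix.cons_val_one, Matrix.cons_val]
      rw [a1, a2, a3, c1, c2, c3]
      linear_combination (2 * dsine b (m₁ - z) * dsine b (m₂ - z) * dsine b (m₃ - z) *
        dsine b (n₁ - b + z) * dsine b (n₂ + z) * dsine b (n₃ + z)) * htrig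
    have : f' z / P' = f' z * (s (m₂ + n₁ - b) * s (m₃ + n₁ - b)) /
        (P * (s (m₁ + n₂) * s (m₁ + n₃))) := by
      rw [← hPP, div_eq_div_iff hP'0 (by rw [hPP]; exact mul_ne_zero hP0 (mul_ne_zero hs2 hs3))]
      ring
    rw [this]
    field_simp
    linear_combination (1 : ℂ) * hF * 4
  -- a contour shift: `g` is holomorphic on the strip `0 ≤ Re z ≤ b`
  have hgg : stIntegral b ![m₁, m₂, m₃] ![n₁, n₂ + b, n₃ + b] =
      stIntegral b ![m₁ + b, m₂ + b, m₃ + b] ![n₁ - b, n₂, n₃] := by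
    rw [← stIntegral_shift hb (μ := ![m₁ + b, m₂ + b, m₃ + b]) (ν := ![n₁ - b, n₂, n₃]) (c := b)]
    · congr 1 <;> ext i <;> fin_cases i <;> simp
    · intro i; fin_cases i <;> simp [strip] <;> constructor <;> linarith
    · intro i; fin_cases i <;> simp [strip] <;> constructor <;> linarith
    · intro i; fin_cases i <;> simp [strip] <;> constructor <;> linarith
    · intro i; fin_cases i <;> simp [strip] <;> constructor <;> linarith
    · simp [Fin.sum_univ_three]; linarith
  have hint : ∀ μ ν : Fin 3 → ℂ, (∀ i, μ i ∈ strip b) → (∀ i, ν i ∈ strip b) →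
      ∑ i, ((μ i).re + (ν i).re) < 3 * Q b →
      Integrable fun y : ℝ => stKernel b μ ν (Complex.I * y) := fun μ ν h1 h2 h3 =>
    integrable_stKernel hb h1 h2 h3
  have if' : Integrable fun y : ℝ => f' (Complex.I * y) := by
    refine hint _ _ ?_ ?_ ?_
    · intro i; fin_cases i <;> simp [strip] <;> constructor <;> linarith
    · intro i; fin_cases i <;> simp [strip] <;> constructor <;> linarith
    · simp [Fin.sum_univ_three]; linarith
  have if0 : Integrable fun y : ℝ => f (Complex.I * y) := by
    refine hint _ _ ?_ ?_ ?_
    · intro i; fin_cases i <;> simp [strip] <;> constructor <;> linarith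
    · intro i; fin_cases i <;> simp [strip] <;> constructor <;> linarith
    · simp [Fin.sum_univ_three]; linarith
  have ig : Integrable fun y : ℝ => g (Complex.I * y) := by
    refine hint _ _ ?_ ?_ ?_
    · intro i; fin_cases i <;> simp [strip] <;> constructor <;> linarith
    · intro i; fin_cases i <;> simp [strip] <;> constructor <;> linarith
    · simp [Fin.sum_univ_three]; linarith
  have ig' : Integrable fun y : ℝ => g' (Complex.I * y) := by
    refine hint _ _ ?_ ?_ ?_
    · intro i; fin_cases i <;> simp [strip] <;> constructor <;> linarith
    · intro i; fin_cases i <;> simp [strip] <;> constructor <;> linarith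
    · simp [Fin.sum_univ_three]; linarith
  have := integral_congr_ae (μ := volume) (ae_of_all _ hpt)
  rw [integral_sub (if'.div_const _) (if0.div_const _), integral_const_mul, integral_sub ig ig',
    integral_div, integral_div] at this
  rw [stRatio, stRatio, ← sub_eq_zero]
  refine this.trans ?_
  rw [mul_eq_zero]
  right
  rw [sub_eq_zero]
  exact hgg.symm

/-! ### The normalized star-triangle integral as a function of one parameter -/

/-- Liouville's theorem for a periodic function on a vertical strip wider than its period: it
extends periodically to an entire function. -/
theorem eq_of_periodic_of_bounded {W b a C : ℝ} (hb : 0 < b) (ha : 0 < a) (haW : a + b < W)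
    {f : ℂ → ℂ} (hd : DifferentiableOn ℂ f {z | 0 < z.re ∧ z.re < W})
    (hper : ∀ z : ℂ, 0 < z.re → z.re + b < W → f (z + b) = f z)
    (hbd : ∀ z : ℂ, a ≤ z.re → z.re ≤ a + b → ‖f z‖ ≤ C) {z w : ℂ}
    (hz : 0 < z.re ∧ z.re < W) (hw : 0 < w.re ∧ w.re < W) : f z = f w := by
  have hnat : ∀ (k : ℕ) (z : ℂ), 0 < z.re → z.re + k * b < W → f (z + k * b) = f z := by
    intro k
    induction k with
    | zero => intro z _ _; simp
    | succ k ih =>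
      intro z h0 h1
      push_cast at h1 ⊢
      have hk : (0 : ℝ) ≤ k * b := by positivity
      rw [show z + (k + 1) * (b : ℂ) = z + k * b + b by ring, hper _ (by simp; linarith)
        (by simp; linarith), ih z h0 (by linarith)]
  have hint : ∀ (k : ℤ) (z : ℂ), (0 < z.re ∧ z.re < W) →
      (0 < (z - k * b).re ∧ (z - k * b).re < W) → f (z - k * b) = f z := by
    intro k z hz hzk
    simp only [Complex.sub_re, Complex.mul_re, Complex.intCast_re, Complex.ofReal_re,
      Complex.intCast_im, zero_mul, sub_zero] at hzk
    obtain ⟨n, rfl | rfl⟩ := k.eq_nat_or_neg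
    · have := hnat n (z - n * b) (by simpa using hzk.1) (by simpa using hz.2)
      simpa using this.symm
    · have := hnat n z hz.1 (by simpa using hzk.2)
      simpa using this
  -- subtracting `N z` periods moves `z` to the strip `a ≤ Re z < a + b`
  set N : ℂ → ℤ := fun z => ⌊(z.re - a) / b⌋ with hN
  have hNre : ∀ z : ℂ, a ≤ (z - N z * b).re ∧ (z - N z * b).re < a + b := by
    intro z
    simp only [Complex.sub_re, Complex.mul_re, Complex.intCast_re, Complex.ofReal_re,
      Complex.intCast_im, zero_mul, sub_zero]
    have h1 := Int.floor_le ((z.re - a) / b)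
    have h2 := Int.lt_floor_add_one ((z.re - a) / b)
    rw [le_div_iff₀ hb] at h1
    rw [div_lt_iff₀ hb] at h2
    constructor <;> simp only [hN] <;> linarith
  set F : ℂ → ℂ := fun z => f (z - N z * b) with hF
  have hFf : ∀ z : ℂ, (0 < z.re ∧ z.re < W) → F z = f z := fun z hz =>
    hint _ z hz ⟨by linarith [(hNre z).1], by linarith [(hNre z).2]⟩
  have hopen : IsOpen {z : ℂ | 0 < z.re ∧ z.re < W} :=
    (isOpen_lt continuous_const Complex.continuous_re).inter
      (isOpen_lt Complex.continuous_re continuous_const)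
  have hFd : Differentiable ℂ F := by
    intro z₀
    have hmem : z₀ - N z₀ * b ∈ {z : ℂ | 0 < z.re ∧ z.re < W} :=
      ⟨by linarith [(hNre z₀).1], by linarith [(hNre z₀).2]⟩
    have hc : Continuous fun z : ℂ => z - N z₀ * b := by fun_prop
    have h1 : DifferentiableAt ℂ (fun z => f (z - N z₀ * b)) z₀ :=
      (hd.differentiableAt (hopen.mem_nhds hmem)).comp z₀ (by fun_prop)
    refine h1.congr_of_eventuallyEq ?_
    filter_upwards [(hopen.preimage hc).mem_nhds hmem] with z hz
    have := hint (N z - N z₀) (z - N z₀ * b) hz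
    have e : z - N z₀ * b - ((N z - N z₀ : ℤ) : ℂ) * b = z - N z * b := by push_cast; ring
    rw [e] at this
    exact this ⟨by linarith [(hNre z).1], by linarith [(hNre z).2]⟩
  have hFb : Bornology.IsBounded (Set.range F) := by
    refine (isBounded_iff_forall_norm_le).2 ⟨C, ?_⟩
    rintro _ ⟨z, rfl⟩
    exact hbd _ (hNre z).1 (hNre z).2.le
  rw [← hFf z hz, ← hFf w hw]
  exact hFd.apply_eq_apply_of_bounded hFb z w

theorem mem_strip_of_sum_eq {b : ℝ} {μ ν : Fin 3 → ℂ} (hμ : ∀ i, 0 < (μ i).re)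
    (hν : ∀ i, 0 < (ν i).re) (hsum : ∑ i, (μ i + ν i) = Q b) :
    (∀ i, μ i ∈ strip b) ∧ (∀ i, ν i ∈ strip b) ∧ ∀ i j, μ i + ν j ∈ strip b := by
  have h := congrArg Complex.re hsum
  simp only [Fin.sum_univ_three, Complex.add_re, Complex.ofReal_re] at h
  have h0 := hμ 0
  have h1 := hμ 1
  have h2 := hμ 2
  have h3 := hν 0
  have h4 := hν 1
  have h5 := hν 2
  refine ⟨fun i => ⟨hμ i, ?_⟩, fun i => ⟨hν i, ?_⟩, fun i j => ⟨add_pos (hμ i) (hν j), ?_⟩⟩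
  · fin_cases i <;> simp <;> linarith
  · fin_cases i <;> simp <;> linarith
  · fin_cases i <;> fin_cases j <;> simp <;> linarith

theorem sum_re_lt_of_sum_eq {b : ℝ} (hb : 0 < b) {μ ν : Fin 3 → ℂ}
    (hsum : ∑ i, (μ i + ν i) = Q b) : ∑ i, ((μ i).re + (ν i).re) < 3 * Q b := by
  have h := congrArg Complex.re hsum
  simp only [Fin.sum_univ_three, Complex.add_re, Complex.ofReal_re] at h ⊢
  linarith [Q_pos hb]

theorem differentiableOn_stRatio {b : ℝ} (hb : 0 < b) {U : Set ℂ} (hU : IsOpen U)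
    {μ ν : ℂ → Fin 3 → ℂ} (hμd : ∀ i, DifferentiableOn ℂ (fun t => μ t i) U)
    (hνd : ∀ i, DifferentiableOn ℂ (fun t => ν t i) U)
    (hμ : ∀ t ∈ U, ∀ i, 0 < (μ t i).re) (hν : ∀ t ∈ U, ∀ i, 0 < (ν t i).re)
    (hsum : ∀ t ∈ U, ∑ i, (μ t i + ν t i) = Q b) :
    DifferentiableOn ℂ (fun t => stIntegral b (μ t) (ν t) / stProd b (μ t) (ν t)) U := by
  have hm := fun t ht => mem_strip_of_sum_eq (hμ t ht) (hν t ht) (hsum t ht)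
  refine DifferentiableOn.div (differentiableOn_stIntegral hb hU hμd hνd (fun t ht => (hm t ht).1)
    (fun t ht => (hm t ht).2.1) fun t ht => sum_re_lt_of_sum_eq hb (hsum t ht)) ?_
    fun t _ => stProd_ne_zero _ _ _
  unfold stProd
  refine DifferentiableOn.fun_finsetProd fun i _ => DifferentiableOn.fun_finsetProd fun j _ => ?_
  exact (differentiableOn_dsine hb).comp ((hμd i).add (hνd j)) fun t ht => (hm t ht).2.2 i j

/-- The decay of the integral in the imaginary direction of `μ₁ - ν₁` is exactly that of the
product, so that the ratio is bounded. -/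
theorem exists_norm_stRatio_le {b : ℝ} (hb : 0 < b) {w m₂ m₃ n₂ n₃ : ℂ} {a₀ a₁ : ℝ} (ha₀ : 0 < a₀)
    (ha₁ : a₁ < w.re) (hw : 0 < w.re) (hm₂ : 0 < m₂.re) (hm₃ : 0 < m₃.re) (hn₂ : 0 < n₂.re)
    (hn₃ : 0 < n₃.re) (hsum : w + m₂ + m₃ + n₂ + n₃ = Q b) :
    ∃ C : ℝ, ∀ τ : ℂ, a₀ ≤ τ.re → τ.re ≤ a₁ → ‖stRatio b τ m₂ m₃ (w - τ) n₂ n₃‖ ≤ C := by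
  have hre : w.re + m₂.re + m₃.re + n₂.re + n₃.re = Q b := by
    simpa using congrArg Complex.re hsum
  have hk := decayRate_pos
  obtain ⟨x₀, hx₀, l1, l2, l3, l4, l5, l6⟩ : ∃ x₀ > 0, x₀ ≤ a₀ ∧ x₀ ≤ w.re - a₁ ∧ x₀ ≤ m₂.re ∧
      x₀ ≤ m₃.re ∧ x₀ ≤ n₂.re ∧ x₀ ≤ n₃.re :=
    ⟨min (min a₀ (w.re - a₁)) (min (min m₂.re m₃.re) (min n₂.re n₃.re)), by
      simp only [gt_iff_lt, lt_min_iff]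
      exact ⟨⟨ha₀, by linarith⟩, ⟨hm₂, hm₃⟩, hn₂, hn₃⟩, by simp, by simp, by simp, by simp,
      by simp, by simp⟩
  set R : ℝ := |w.im| + |m₂.im| + |m₃.im| + |n₂.im| + |n₃.im| with hR
  obtain ⟨C, hC, h⟩ := exists_norm_dsine_le_of_im_near hb hx₀ R
  have aw := abs_nonneg w.im
  have am2 := abs_nonneg m₂.im
  have am3 := abs_nonneg m₃.im
  have an2 := abs_nonneg n₂.im
  have an3 := abs_nonneg n₃.im
  set K : ℂ := (dsine b w * (dsine b (m₂ + n₂) * dsine b (m₂ + n₃)) *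
    (dsine b (m₃ + n₂) * dsine b (m₃ + n₃)))⁻¹ with hK
  set G : ℝ → ℝ := fun y => Real.exp (-(2 * decayRate * w.re) * |y|) with hG
  have hGi : Integrable G := integrable_exp_neg_mul_abs (by positivity)
  refine ⟨C ^ 10 * ‖K‖ * ∫ y, G y, fun τ h0 h1 => ?_⟩
  -- the integral is `O(exp (-k (Q - Re w) |Im τ|))`, and the product is at least of this size
  set T := τ.im with hT
  set k := decayRate with hkdef
  have hker : ∀ y : ℝ, ‖stKernel b ![τ, m₂, m₃] ![w - τ, n₂, n₃] (Complex.I * y)‖ ≤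
      C ^ 6 * Real.exp (k * (w.re - Q b) * |T|) * G y := by
    intro y
    have b1 := h (τ - Complex.I * y) (T - y) (by simp; linarith) (by simp; linarith)
      (by simp [← hT]; positivity)
    have b2 := h (w - τ + Complex.I * y) (-(T - y)) (by simp; linarith) (by simp; linarith)
      (by simp [← hT]; ring_nf; linarith)
    have b3 := h (m₂ - Complex.I * y) (-y) (by simp; linarith) (by simp; linarith)
      (by simp; linarith)
    have b4 := h (m₃ - Complex.I * y) (-y) (by simp; linarith) (by simp; linarith)
      (by simp; linarith)
    have b5 := h (n₂ + Complex.I * y) y (by simp; linarith) (by simp; linarith)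
      (by simp; linarith)
    have b6 := h (n₃ + Complex.I * y) y (by simp; linarith) (by simp; linarith)
      (by simp; linarith)
    simp only [stKernel, Fin.prod_univ_three, Matrix.cons_val_zero, Matrix.cons_val_one,
      Matrix.cons_val, norm_mul]
    calc _ ≤ _ := mul_le_mul (mul_le_mul (mul_le_mul b1 b2 (norm_nonneg _) (by positivity))
          (mul_le_mul b3 b5 (norm_nonneg _) (by positivity)) (by positivity) (by positivity))
          (mul_le_mul b4 b6 (norm_nonneg _) (by positivity)) (by positivity) (by positivity)
      _ = C ^ 6 * (Real.exp (k * ((τ - Complex.I * y).re - Q b / 2) * |T - y|) *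
          Real.exp (k * ((w - τ + Complex.I * y).re - Q b / 2) * |-(T - y)|) *
          (Real.exp (k * ((m₂ - Complex.I * y).re - Q b / 2) * |-y|) *
          Real.exp (k * ((n₂ + Complex.I * y).re - Q b / 2) * |y|)) *
          (Real.exp (k * ((m₃ - Complex.I * y).re - Q b / 2) * |-y|) *
          Real.exp (k * ((n₃ + Complex.I * y).re - Q b / 2) * |y|))) := by ring
      _ ≤ C ^ 6 * (Real.exp (k * (w.re - Q b) * |T|) * G y) := by
          refine mul_le_mul_of_nonneg_left ?_ (by positivity)
          simp only [hG, ← Real.exp_add]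
          apply Real.exp_le_exp.2
          have hab : |T| - |y| ≤ |T - y| := abs_sub_abs_le_abs_sub T y
          simp only [abs_neg, Complex.sub_re, Complex.add_re, Complex.mul_re, Complex.I_re,
            Complex.I_im, Complex.ofReal_re, Complex.ofReal_im, zero_mul, mul_zero, sub_zero,
            add_zero]
          have : (w.re - Q b) * |T - y| ≤ (w.re - Q b) * (|T| - |y|) :=
            mul_le_mul_of_nonpos_left hab (by linarith)
          have e : k * (τ.re - Q b / 2) * |T - y| + k * (w.re - τ.re - Q b / 2) * |T - y| =
            k * ((w.re - Q b) * |T - y|) := by ring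
          have e' : k * (m₂.re - Q b / 2) * |y| + k * (n₂.re - Q b / 2) * |y| +
              (k * (m₃.re - Q b / 2) * |y| + k * (n₃.re - Q b / 2) * |y|) =
              k * (-(Q b + w.re)) * |y| := by
            have : m₂.re = Q b - w.re - m₃.re - n₂.re - n₃.re := by linarith
            rw [this]; ring
          nlinarith [mul_le_mul_of_nonneg_left this hk.le]
      _ = _ := by ring
  have hprod : ‖(stProd b ![τ, m₂, m₃] ![w - τ, n₂, n₃])⁻¹‖ ≤
      C ^ 4 * ‖K‖ * Real.exp (k * (Q b - w.re) * |T|) := by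
    have b1 := h (Q b - (τ + n₂)) (-T) (by simp; linarith) (by simp; linarith)
      (by simp [← hT]; linarith)
    have b2 := h (Q b - (τ + n₃)) (-T) (by simp; linarith) (by simp; linarith)
      (by simp [← hT]; linarith)
    have b3 := h (Q b - (m₂ + (w - τ))) T (by simp; linarith) (by simp; linarith)
      (by
        simp [← hT]
        rw [show T - w.im + -m₂.im - T = -(w.im + m₂.im) by ring, abs_neg]
        linarith [abs_add_le w.im m₂.im])
    have b4 := h (Q b - (m₃ + (w - τ))) T (by simp; linarith) (by simp; linarith)
      (by
        simp [← hT]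
        rw [show T - w.im + -m₃.im - T = -(w.im + m₃.im) by ring, abs_neg]
        linarith [abs_add_le w.im m₃.im])
    rw [dsine_reflect] at b1 b2 b3 b4
    have e : (stProd b ![τ, m₂, m₃] ![w - τ, n₂, n₃])⁻¹ = K *
        ((dsine b (τ + n₂))⁻¹ * (dsine b (τ + n₃))⁻¹ * ((dsine b (m₂ + (w - τ)))⁻¹ *
        (dsine b (m₃ + (w - τ)))⁻¹)) := by
      simp only [hK, stProd, Fin.prod_univ_three, Matrix.cons_val_zero, Matrix.cons_val_one,
        Matrix.cons_val, add_sub_cancel, ← mul_inv]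
      congr 1
      ring
    rw [e, norm_mul, norm_mul, norm_mul, norm_mul]
    calc _ ≤ ‖K‖ * _ := mul_le_mul_of_nonneg_left (mul_le_mul
          (mul_le_mul b1 b2 (norm_nonneg _) (by positivity))
          (mul_le_mul b3 b4 (norm_nonneg _) (by positivity)) (by positivity) (by positivity))
          (norm_nonneg _)
      _ = C ^ 4 * ‖K‖ * (Real.exp (k * ((Q b - (τ + n₂)).re - Q b / 2) * |-T|) *
          Real.exp (k * ((Q b - (τ + n₃)).re - Q b / 2) * |-T|) *
          (Real.exp (k * ((Q b - (m₂ + (w - τ))).re - Q b / 2) * |T|) *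
          Real.exp (k * ((Q b - (m₃ + (w - τ))).re - Q b / 2) * |T|))) := by ring
      _ = _ := by
          simp only [← Real.exp_add]
          congr 2
          simp
          have : m₂.re = Q b - w.re - m₃.re - n₂.re - n₃.re := by linarith
          rw [this]; ring
  rw [stRatio, div_eq_mul_inv, norm_mul]
  have hI : ‖stIntegral b ![τ, m₂, m₃] ![w - τ, n₂, n₃]‖ ≤
      C ^ 6 * Real.exp (k * (w.re - Q b) * |T|) * ∫ y, G y := by
    rw [← integral_const_mul]
    exact norm_integral_le_of_norm_le (hGi.const_mul _) (ae_of_all _ hker)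
  have hGn : 0 ≤ ∫ y, G y := integral_nonneg fun y => (Real.exp_pos _).le
  calc _ ≤ _ := mul_le_mul hI hprod (norm_nonneg _) (by positivity)
    _ = C ^ 10 * ‖K‖ * (Real.exp (k * (w.re - Q b) * |T|) * Real.exp (k * (Q b - w.re) * |T|)) *
        ∫ y, G y := by ring
    _ = _ := by
        rw [← Real.exp_add, show k * (w.re - Q b) * |T| + k * (Q b - w.re) * |T| = 0 by ring,
          Real.exp_zero, mul_one]

/-- The normalized integral depends on `μ₁, ν₁` only through `μ₁ + ν₁`, if `Re (μ₁ + ν₁) > b`. -/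
theorem stRatio_eq_of_add_eq {b : ℝ} (hb : 0 < b) {m₁ m₁' m₂ m₃ n₁ n₁' n₂ n₃ : ℂ}
    (hm₁ : 0 < m₁.re) (hm₁' : 0 < m₁'.re) (hm₂ : 0 < m₂.re) (hm₃ : 0 < m₃.re) (hn₁ : 0 < n₁.re)
    (hn₁' : 0 < n₁'.re) (hn₂ : 0 < n₂.re) (hn₃ : 0 < n₃.re)
    (hsum : m₁ + m₂ + m₃ + n₁ + n₂ + n₃ = Q b) (hadd : m₁' + n₁' = m₁ + n₁)
    (hlt : b < (m₁ + n₁).re) :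
    stRatio b m₁ m₂ m₃ n₁ n₂ n₃ = stRatio b m₁' m₂ m₃ n₁' n₂ n₃ := by
  set w := m₁ + n₁ with hw
  have hsumw : w + m₂ + m₃ + n₂ + n₃ = Q b := by rw [hw, ← hsum]; ring
  have hre : w.re + m₂.re + m₃.re + n₂.re + n₃.re = Q b := by
    simpa using congrArg Complex.re hsumw
  obtain ⟨C, hC⟩ := exists_norm_stRatio_le hb (a₀ := (w.re - b) / 2) (a₁ := (w.re - b) / 2 + b)
    (by linarith) (by linarith) (by linarith) hm₂ hm₃ hn₂ hn₃ hsumw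
  have main := eq_of_periodic_of_bounded (W := w.re) (b := b) (a := (w.re - b) / 2)
    (f := fun τ => stRatio b τ m₂ m₃ (w - τ) n₂ n₃) hb (by linarith) (by linarith) ?_ ?_ hC
    (z := m₁) (w := m₁') ⟨hm₁, by simp [hw]; linarith⟩ ⟨hm₁', by rw [← hadd]; simp; linarith⟩
  · have e1 : w - m₁ = n₁ := by rw [hw]; ring
    have e2 : w - m₁' = n₁' := by rw [← hadd]; ring
    simpa only [e1, e2] using main
  · refine differentiableOn_stRatio hb ?_ (μ := fun τ => ![τ, m₂, m₃])
      (ν := fun τ => ![w - τ, n₂, n₃]) ?_ ?_ ?_ ?_ ?_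
    · exact (isOpen_lt continuous_const Complex.continuous_re).inter
        (isOpen_lt Complex.continuous_re continuous_const)
    · intro i; fin_cases i <;> simp <;> fun_prop
    · intro i; fin_cases i <;> simp <;> fun_prop
    · rintro t ⟨h1, h2⟩ i; fin_cases i <;> simp <;> assumption
    · rintro t ⟨h1, h2⟩ i; fin_cases i <;> simp <;> assumption
    · intro t _
      simp only [Fin.sum_univ_three, Matrix.cons_val_zero, Matrix.cons_val_one,
        Matrix.cons_val]
      rw [← hsumw]; ring
  · intro z h0 h1
    have := stRatio_shift hb (m₁ := z) (m₂ := m₂) (m₃ := m₃) (n₁ := w - z) (n₂ := n₂) (n₃ := n₃)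
      h0 hm₂ hm₃ (by simp; linarith) hn₂ hn₃ (by rw [← hsumw]; ring)
    rw [← this]
    congr 1
    ring

theorem stRatio_swap (b : ℝ) (m₁ m₂ m₃ n₁ n₂ n₃ : ℂ) :
    stRatio b m₁ m₂ m₃ n₁ n₂ n₃ = stRatio b m₁ m₂ m₃ n₂ n₁ n₃ := by
  simp only [stRatio, stIntegral, stKernel, stProd, Fin.prod_univ_three, Matrix.cons_val_zero,
    Matrix.cons_val_one, Matrix.cons_val]
  congr 1
  · congr 1 with y; ring
  · ring

/-! ### Pinching the contour of the star-triangle integral -/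

/-- `S_b` is positive on the interval `(0, Q)`. -/
theorem exists_dsine_ofReal_eq (b x : ℝ) : ∃ r : ℝ, 0 < r ∧ dsine b x = r := by
  refine ⟨Real.exp (∫ t in Set.Ioi (0 : ℝ), (((2 * x - Q b) / (2 * t)
      - Real.sinh ((2 * x - Q b) * t) / (2 * Real.sinh (b * t) * Real.sinh (t / b))) / t)),
    Real.exp_pos _, ?_⟩
  rw [dsine, Complex.ofReal_exp, ← integral_complex_ofReal, logSb]
  congr 2
  ext t
  push_cast
  rfl

theorem tendsto_csin_mul_div (c : ℂ) :
    Tendsto (fun t : ℝ => Complex.sin (c * t) / t) (𝓝[>] 0) (𝓝 c) := by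
  have h1 : HasDerivAt (fun t : ℂ => Complex.sin (c * t)) c ((0 : ℝ) : ℂ) := by
    have := ((hasDerivAt_id ((0 : ℝ) : ℂ)).const_mul c).csin
    simpa using this
  have h := hasDerivAt_iff_tendsto_slope_zero.1 h1.comp_ofReal
  simp only [zero_add, Complex.ofReal_zero, mul_zero, Complex.sin_zero, sub_zero] at h
  refine (h.mono_left (nhdsWithin_mono _ fun x (hx : 0 < x) => ne_of_gt hx)).congr fun t => ?_
  rw [Complex.real_smul, div_eq_inv_mul, Complex.ofReal_inv]

theorem tendsto_dsine {b : ℝ} (hb : 0 < b) {z : ℂ} (hz : z ∈ strip b) {f : ℝ → ℂ} {l : Filter ℝ}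
    (hf : Tendsto f l (𝓝 z)) : Tendsto (fun e => dsine b (f e)) l (𝓝 (dsine b z)) :=
  (differentiableAt_dsine hb hz).continuousAt.tendsto.comp hf

/-- The residue of `S_b` at the origin is the same whether it is computed with the period `b` or
with the period `1/b`; together with `S_b(b) S_b(1/b) = 1` this gives `S_b(b) = b`. -/
theorem dsine_self {b : ℝ} (hb : 0 < b) : dsine b b = b := by
  have hbi : 0 < b⁻¹ := inv_pos.2 hb
  have hQ : Q b = b + b⁻¹ := rfl
  have hev : ∀ᶠ e : ℝ in 𝓝[>] 0, 0 < e ∧ e < b ∧ e < b⁻¹ := by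
    filter_upwards [self_mem_nhdsWithin, mem_nhdsWithin_of_mem_nhds (Iio_mem_nhds hb),
      mem_nhdsWithin_of_mem_nhds (Iio_mem_nhds hbi)] with e h1 h2 h3 using ⟨h1, h2, h3⟩
  have hid : ∀ c : ℝ, Tendsto (fun e : ℝ => (e : ℂ) + c) (𝓝[>] 0) (𝓝 (c : ℂ)) := by
    intro c
    refine Tendsto.mono_left ?_ nhdsWithin_le_nhds
    exact (Complex.continuous_ofReal.add continuous_const).tendsto' _ _ (by simp)
  have l1 := tendsto_dsine hb (z := b) ⟨by simpa using hb, by simp [hQ]; linarith⟩ (hid b)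
  have l2 := tendsto_dsine hb (z := (b⁻¹ : ℝ)) ⟨by simpa using hbi, by simp [hQ]; linarith⟩
    (hid b⁻¹)
  have l3 := tendsto_csin_mul_div (Real.pi * b)
  have l4 := tendsto_csin_mul_div (Real.pi * (b⁻¹ : ℝ))
  have heq : dsine b b * (Real.pi * (b⁻¹ : ℝ)) = dsine b (b⁻¹ : ℝ) * (Real.pi * b) := by
    refine tendsto_nhds_unique (l1.mul l4) ((l2.mul l3).congr' ?_)
    filter_upwards [hev] with e he
    have h1 := dsine_add hb (z := e) (by simpa using he.1) (by simpa using he.2.2)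
    have h2 := dsine_add hbi (z := e) (by simpa using he.1) (by simpa using he.2.1)
    rw [dsine_inv_param, dsine_inv_param] at h2
    rw [h1, h2]
    ring
  have hrefl : dsine b (b⁻¹ : ℝ) = (dsine b b)⁻¹ := by
    rw [← dsine_reflect]
    congr 1
    rw [hQ]; push_cast; ring
  obtain ⟨r, hr, hrb⟩ := exists_dsine_ofReal_eq b b
  rw [hrefl, hrb] at heq
  rw [hrb]
  have heq' : r * (Real.pi * b⁻¹) = r⁻¹ * (Real.pi * b) := by exact_mod_cast heq
  have hsq : r ^ 2 = b ^ 2 := by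
    field_simp at heq'
    exact heq'
  have : r = b := by
    have := (sq_eq_sq₀ hr.le hb.le).1 hsq
    exact this
  rw [this]

/-- Lower bound for the sine in the strip `0 ≤ Re z ≤ π/2`. -/
theorem norm_le_norm_sin {z : ℂ} (h0 : 0 ≤ z.re) (h1 : z.re ≤ Real.pi / 2) :
    2 / Real.pi * ‖z‖ ≤ ‖Complex.sin z‖ := by
  have hpi := Real.pi_pos
  have hs : ‖Complex.sin z‖ ^ 2 = Real.sin z.re ^ 2 + Real.sinh z.im ^ 2 := by
    have : Complex.sin z = (Real.sin z.re * Real.cosh z.im : ℝ) +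
        (Real.cos z.re * Real.sinh z.im : ℝ) * Complex.I := by
      conv_lhs => rw [← Complex.re_add_im z]
      rw [Complex.sin_add_mul_I]
      push_cast
      ring
    rw [this, ← Complex.normSq_eq_norm_sq, Complex.normSq_add_mul_I]
    have e1 := Real.sin_sq_add_cos_sq z.re
    have e2 := Real.cosh_sq z.im
    nlinarith
  have h2 : 2 / Real.pi * z.re ≤ Real.sin z.re := Real.mul_le_sin h0 h1
  have h3 : z.im ^ 2 ≤ Real.sinh z.im ^ 2 := by
    rw [sq_le_sq, Real.abs_sinh]
    exact Real.self_le_sinh_iff.2 (abs_nonneg _)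
  have h4 : 2 / Real.pi ≤ 1 := by
    rw [div_le_one hpi]
    exact Real.two_le_pi
  have h5 : 0 ≤ 2 / Real.pi := by positivity
  refine (sq_le_sq₀ (by positivity) (norm_nonneg _)).1 ?_
  rw [hs, mul_pow, ← Complex.normSq_eq_norm_sq, Complex.normSq_apply]
  have h6 : (2 / Real.pi * z.re) ^ 2 ≤ Real.sin z.re ^ 2 :=
    pow_le_pow_left₀ (by positivity) h2 2
  have h7 : (2 / Real.pi) ^ 2 ≤ 1 := pow_le_one₀ h5 h4
  nlinarith [sq_nonneg z.im]

set_option maxHeartbeats 1600000 in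
/-- When `μ₁ = ν₂ = ε → 0` the contour is pinched at the origin: the kernel becomes the Poisson
kernel `π⁻¹ ε / (ε² + y²)`, and the normalized integral tends to `1`. -/
theorem tendsto_stRatio_pinch {b : ℝ} (hb : 0 < b) {m₂ m₃ n₃ σ : ℂ} (hm₂ : 0 < m₂.re)
    (hm₃ : 0 < m₃.re) (hn₃ : 0 < n₃.re) (hσ : 0 < σ.re) (hsum : m₂ + m₃ + n₃ + σ = Q b) :
    Tendsto (fun e : ℝ => stRatio b e m₂ m₃ (σ - 2 * e) e n₃) (𝓝[>] 0) (𝓝 1) := by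
  have hre : m₂.re + m₃.re + n₃.re + σ.re = Q b := by
    simpa using congrArg Complex.re hsum
  have hbi : 0 < b⁻¹ := inv_pos.2 hb
  have hQ : Q b = b + b⁻¹ := rfl
  have hpi := Real.pi_pos
  -- the part of the integrand and of the product that is regular at `e = 0`
  set H : ℝ → ℝ → ℂ := fun e y =>
    stKernel b ![b + e, m₂, m₃] ![σ - 2 * e, b + e, n₃] (Complex.I * y) with hH
  set P : ℝ → ℂ := fun e => dsine b (σ - e) * dsine b (n₃ + e) * (dsine b (m₂ + σ - 2 * e) *
    dsine b (m₂ + e) * dsine b (m₂ + n₃)) * (dsine b (m₃ + σ - 2 * e) * dsine b (m₃ + e) *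
    dsine b (m₃ + n₃)) * dsine b (b + 2 * e) with hP
  set Z : ℝ → ℝ → ℂ := fun e v => e * (2 * Complex.sin (2 * (Real.pi * b) * e)) /
    (4 * (Complex.sin (Real.pi * b * (1 - Complex.I * v) * e) *
      Complex.sin (Real.pi * b * (1 + Complex.I * v) * e))) with hZ
  have hsmall : ∀ᶠ e : ℝ in 𝓝[>] 0, 0 < e ∧ e < b⁻¹ / 4 ∧ 2 * e < σ.re := by
    filter_upwards [self_mem_nhdsWithin,
      mem_nhdsWithin_of_mem_nhds (Iio_mem_nhds (show 0 < b⁻¹ / 4 by linarith)),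
      mem_nhdsWithin_of_mem_nhds (Iio_mem_nhds (show 0 < σ.re / 2 by linarith))]
      with e h1 h2 h3
    exact ⟨h1, h2, by linarith [Set.mem_Iio.1 h3]⟩
  -- substitute `y = e v` and use the functional equation for the three factors that are singular at
  -- the origin
  have hfact : ∀ e : ℝ, 0 < e → e < b⁻¹ / 4 →
      stRatio b e m₂ m₃ (σ - 2 * e) e n₃ = ∫ v : ℝ, H e (e * v) / P e * Z e v := by
    intro e he he'
    have hd : ∀ z : ℂ, z.re = e → dsine b (b + z) =
        2 * Complex.sin (Real.pi * b * z) * dsine b z := by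
      intro z hz
      rw [add_comm]
      exact dsine_add hb (by rw [hz]; exact he) (by rw [hz]; linarith)
    have h2e : dsine b (b + 2 * e) = 2 * Complex.sin (2 * (Real.pi * b) * e) *
        dsine b (e + e) := by
      rw [show (b : ℂ) + 2 * e = (e + e) + b by ring, dsine_add hb (by simp; linarith)
        (by simp; linarith)]
      ring_nf
    have hscale := Measure.integral_comp_mul_left (fun y : ℝ => stKernel b ![(e : ℂ), m₂, m₃]
      ![σ - 2 * e, e, n₃] (Complex.I * y)) e
    rw [abs_of_pos (inv_pos.2 he), eq_inv_smul_iff₀ he.ne'] at hscale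
    rw [stRatio, stIntegral, ← hscale, Complex.real_smul, ← integral_const_mul, ← integral_div]
    congr 1 with v
    have e1 := hd (e - Complex.I * (e * v : ℝ)) (by simp)
    have e2 := hd (e + Complex.I * (e * v : ℝ)) (by simp)
    have hs1 : Complex.sin (Real.pi * b * (e - Complex.I * (e * v : ℝ))) ≠ 0 := by
      intro h0
      rw [h0] at e1
      exact dsine_ne_zero b _ (by rw [e1]; ring)
    have hs2 : Complex.sin (Real.pi * b * (e + Complex.I * (e * v : ℝ))) ≠ 0 := by
      intro h0
      rw [h0] at e2
      exact dsine_ne_zero b _ (by rw [e2]; ring)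
    have hs3 : Complex.sin (2 * (Real.pi * b) * e) ≠ 0 := by
      intro h0
      rw [h0] at h2e
      exact dsine_ne_zero b _ (by rw [h2e]; ring)
    simp only [hH, hP, hZ, stKernel, stProd, Fin.prod_univ_three, Matrix.cons_val_zero,
      Matrix.cons_val_one, Matrix.cons_val]
    rw [h2e, add_sub_assoc (b : ℂ), e1, add_assoc (b : ℂ), e2,
      show (Real.pi : ℂ) * b * (1 - Complex.I * v) * e =
        Real.pi * b * (e - Complex.I * (e * v : ℝ)) by push_cast; ring,
      show (Real.pi : ℂ) * b * (1 + Complex.I * v) * e =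
        Real.pi * b * (e + Complex.I * (e * v : ℝ)) by push_cast; ring,
      show (e : ℂ) + (σ - 2 * e) = σ - e by ring, show (e : ℂ) + n₃ = n₃ + e by ring,
      show m₂ + (σ - 2 * e) = m₂ + σ - 2 * e by ring,
      show m₃ + (σ - 2 * e) = m₃ + σ - 2 * e by ring]
    have g1 := dsine_ne_zero b (σ - e)
    have g2 := dsine_ne_zero b (n₃ + e)
    have g3 := dsine_ne_zero b (m₂ + σ - 2 * e)
    have g4 := dsine_ne_zero b (m₂ + e)
    have g5 := dsine_ne_zero b (m₂ + n₃)
    have g6 := dsine_ne_zero b (m₃ + σ - 2 * e)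
    have g7 := dsine_ne_zero b (m₃ + e)
    have g8 := dsine_ne_zero b (m₃ + n₃)
    have g9 := dsine_ne_zero b (e + e)
    generalize Complex.sin (2 * (Real.pi * b) * e) = A₁ at *
    generalize Complex.sin (Real.pi * b * (e - Complex.I * (e * v : ℝ))) = A₂ at *
    generalize Complex.sin (Real.pi * b * (e + Complex.I * (e * v : ℝ))) = A₃ at *
    field_simp
    ring
  -- limits of the regular parts
  have hto : Tendsto (fun e : ℝ => (e : ℂ)) (𝓝[>] 0) (𝓝 0) :=
    (Complex.continuous_ofReal.tendsto' 0 0 (by simp)).mono_left nhdsWithin_le_nhds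
  have hS : ∀ (z c : ℂ), z ∈ strip b →
      Tendsto (fun e : ℝ => dsine b (z + c * e)) (𝓝[>] 0) (𝓝 (dsine b z)) := fun z c hz =>
    tendsto_dsine hb hz (by simpa using (hto.const_mul c).const_add z)
  have hmem : ∀ z : ℂ, 0 < z.re → z.re < Q b → z ∈ strip b := fun z h1 h2 => ⟨h1, h2⟩
  have hbs : (b : ℂ) ∈ strip b := hmem _ (by simpa using hb) (by simp [hQ]; linarith)
  have hPlim : Tendsto P (𝓝[>] 0)
      (𝓝 (dsine b σ * dsine b n₃ * dsine b m₂ * dsine b m₃ * b)) := by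
    have t1 := hS σ (-1) (hmem _ (by linarith) (by linarith))
    have t2 := hS n₃ 1 (hmem _ (by linarith) (by linarith))
    have t3 := hS (m₂ + σ) (-2) (hmem _ (by simp; linarith) (by simp; linarith))
    have t4 := hS m₂ 1 (hmem _ (by linarith) (by linarith))
    have t6 := hS (m₃ + σ) (-2) (hmem _ (by simp; linarith) (by simp; linarith))
    have t7 := hS m₃ 1 (hmem _ (by linarith) (by linarith))
    have t9 := hS b 2 hbs
    have := (((t1.mul t2).mul ((t3.mul t4).mul_const (dsine b (m₂ + n₃)))).mul
      ((t6.mul t7).mul_const (dsine b (m₃ + n₃)))).mul t9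
    have e1 : dsine b (m₂ + σ) = (dsine b (m₃ + n₃))⁻¹ := by
      rw [← dsine_reflect, ← hsum]; congr 1; ring
    have e2 : dsine b (m₃ + σ) = (dsine b (m₂ + n₃))⁻¹ := by
      rw [← dsine_reflect, ← hsum]; congr 1; ring
    rw [dsine_self hb, e1, e2] at this
    have g5 := dsine_ne_zero b (m₂ + n₃)
    have g8 := dsine_ne_zero b (m₃ + n₃)
    have hval : dsine b σ * dsine b n₃ * dsine b m₂ * dsine b m₃ * (b : ℂ) =
        dsine b σ * dsine b n₃ * ((dsine b (m₃ + n₃))⁻¹ * dsine b m₂ * dsine b (m₂ + n₃)) *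
        ((dsine b (m₂ + n₃))⁻¹ * dsine b m₃ * dsine b (m₃ + n₃)) * b := by
      field_simp
    rw [hval]
    refine this.congr fun e => ?_
    simp only [hP]
    ring_nf
  have hHlim : ∀ v : ℝ, Tendsto (fun e : ℝ => H e (e * v)) (𝓝[>] 0)
      (𝓝 (dsine b σ * dsine b n₃ * dsine b m₂ * dsine b m₃ * b * b)) := by
    intro v
    have t1 := hS b (1 - Complex.I * v) hbs
    have t2 := hS σ (-2 + Complex.I * v) (hmem _ (by linarith) (by linarith))
    have t3 := hS m₂ (-(Complex.I * v)) (hmem _ (by linarith) (by linarith))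
    have t4 := hS b (1 + Complex.I * v) hbs
    have t5 := hS m₃ (-(Complex.I * v)) (hmem _ (by linarith) (by linarith))
    have t6 := hS n₃ (Complex.I * v) (hmem _ (by linarith) (by linarith))
    have := ((t1.mul t2).mul (t3.mul t4)).mul (t5.mul t6)
    rw [dsine_self hb] at this
    rw [show dsine b σ * dsine b n₃ * dsine b m₂ * dsine b m₃ * b * b =
      b * dsine b σ * (dsine b m₂ * b) * (dsine b m₃ * dsine b n₃) by ring]
    refine this.congr fun e => ?_
    simp only [hH, stKernel, Fin.prod_univ_three, Matrix.cons_val_zero,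
      Matrix.cons_val_one, Matrix.cons_val]
    push_cast
    rw [show (b : ℂ) + (1 - Complex.I * v) * e = b + e - Complex.I * (e * v) by ring,
      show σ + (-2 + Complex.I * v) * e = σ - 2 * e + Complex.I * (e * v) by ring,
      show m₂ + -(Complex.I * v) * e = m₂ - Complex.I * (e * v) by ring,
      show (b : ℂ) + (1 + Complex.I * v) * e = b + e + Complex.I * (e * v) by ring,
      show m₃ + -(Complex.I * v) * e = m₃ - Complex.I * (e * v) by ring,
      show n₃ + Complex.I * v * e = n₃ + Complex.I * (e * v) by ring]
  have hv0 : ∀ v : ℝ, (1 - Complex.I * v) * (1 + Complex.I * v) = ((1 + v ^ 2 : ℝ) : ℂ) := by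
    intro v
    push_cast
    linear_combination (-(v : ℂ) ^ 2) * Complex.I_sq
  -- the singular factors give the Poisson kernel
  have hZlim : ∀ v : ℝ, Tendsto (fun e : ℝ => Z e v) (𝓝[>] 0)
      (𝓝 ((b : ℂ)⁻¹ * ((Real.pi⁻¹ * (1 + v ^ 2)⁻¹ : ℝ) : ℂ))) := by
    intro v
    have t1 := tendsto_csin_mul_div (2 * (Real.pi * b))
    have t2 := tendsto_csin_mul_div (Real.pi * b * (1 - Complex.I * v))
    have t3 := tendsto_csin_mul_div (Real.pi * b * (1 + Complex.I * v))
    have hb' : (b : ℂ) ≠ 0 := Complex.ofReal_ne_zero.2 hb.ne'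
    have hpi' : (Real.pi : ℂ) ≠ 0 := Complex.ofReal_ne_zero.2 hpi.ne'
    have h1 : ((1 + v ^ 2 : ℝ) : ℂ) ≠ 0 := Complex.ofReal_ne_zero.2 (by positivity)
    have h2 : (Real.pi * b * (1 - Complex.I * v)) * (Real.pi * b * (1 + Complex.I * v)) =
        Real.pi ^ 2 * b ^ 2 * ((1 + v ^ 2 : ℝ) : ℂ) := by
      rw [← hv0]; ring
    have := (t1.const_mul 2).div ((t2.mul t3).const_mul 4) (by
      rw [h2]
      exact mul_ne_zero (by norm_num)
        (mul_ne_zero (mul_ne_zero (pow_ne_zero 2 hpi') (pow_ne_zero 2 hb')) h1))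
    rw [h2] at this
    have hval : (b : ℂ)⁻¹ * ((Real.pi⁻¹ * (1 + v ^ 2)⁻¹ : ℝ) : ℂ) =
        2 * (2 * (Real.pi * b)) / (4 * (Real.pi ^ 2 * b ^ 2 * ((1 + v ^ 2 : ℝ) : ℂ))) := by
      rw [Complex.ofReal_mul, Complex.ofReal_inv, Complex.ofReal_inv]
      field_simp
      ring
    rw [hval]
    refine this.congr' ?_
    filter_upwards [self_mem_nhdsWithin] with e (he : 0 < e)
    have he' : (e : ℂ) ≠ 0 := Complex.ofReal_ne_zero.2 he.ne'
    simp only [hZ, Pi.div_apply]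
    field_simp
  -- domination by a multiple of `(1 + v²)⁻¹`
  obtain ⟨C, hC, a, ha, hbd⟩ := exists_stKernel_bound hb (t₀ := 0)
    (μ := fun t => ![b + t, m₂, m₃]) (ν := fun t => ![σ - 2 * t, b + t, n₃])
    (fun i => by fin_cases i <;> simp <;> fun_prop) (fun i => by fin_cases i <;> simp <;> fun_prop)
    (fun i => by fin_cases i <;> simp [strip] <;> constructor <;> linarith)
    (fun i => by fin_cases i <;> simp [strip] <;> constructor <;> linarith)
    (by simp [Fin.sum_univ_three]; linarith)
  have hP0 : dsine b σ * dsine b n₃ * dsine b m₂ * dsine b m₃ * (b : ℂ) ≠ 0 := by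
    have := Complex.ofReal_ne_zero.2 hb.ne'
    exact mul_ne_zero (mul_ne_zero (mul_ne_zero (mul_ne_zero (dsine_ne_zero _ _)
      (dsine_ne_zero _ _)) (dsine_ne_zero _ _)) (dsine_ne_zero _ _)) this
  have hPinv := (hPlim.inv₀ hP0).norm
  obtain ⟨B, hB⟩ : ∃ B : ℝ, ∀ᶠ e in 𝓝[>] (0 : ℝ), ‖(P e)⁻¹‖ ≤ B :=
    ⟨_, (hPinv.eventually_lt_const (lt_add_one _)).mono fun _ h => h.le⟩
  have hlim : Tendsto (fun e : ℝ => ∫ v : ℝ, H e (e * v) / P e * Z e v) (𝓝[>] 0)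
      (𝓝 (∫ v : ℝ, ((Real.pi⁻¹ * (1 + v ^ 2)⁻¹ : ℝ) : ℂ))) := by
    refine tendsto_integral_filter_of_dominated_convergence
      (fun v => C * B * (Real.pi / (4 * b)) * (1 + v ^ 2)⁻¹) ?_ ?_
      (integrable_inv_one_add_sq.const_mul _) (ae_of_all _ fun v => ?_)
    · filter_upwards [hsmall] with e he
      have hc : Continuous fun y : ℝ => H e y := by
        refine continuous_stKernel hb ?_ ?_
        · intro i; fin_cases i <;> simp [strip] <;> constructor <;> linarith
        · intro i; fin_cases i <;> simp [strip] <;> constructor <;> linarith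
      have hc' : Continuous fun v : ℝ => H e (e * v) := hc.comp (by fun_prop)
      refine ((hc'.div_const _).aestronglyMeasurable).mul ?_
      simp only [hZ]
      exact Measurable.aestronglyMeasurable (by fun_prop)
    · filter_upwards [hsmall, hB, hto.eventually hbd] with e he hBe hbe
      refine ae_of_all _ fun v => ?_
      rw [div_eq_mul_inv, norm_mul, norm_mul]
      have h1 : ‖H e (e * v)‖ ≤ C := by
        refine (hbe (e * v)).trans ?_
        rw [mul_le_iff_le_one_right hC, Real.exp_le_one_iff]
        have := abs_nonneg (e * v)
        nlinarith
      have hpb : 0 < Real.pi * b := by positivity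
      have h2 : ‖Z e v‖ ≤ Real.pi / (4 * b) * (1 + v ^ 2)⁻¹ := by
        have he1 : Real.pi * b * e ≤ Real.pi / 2 := by
          have : b * e ≤ 1 / 4 := by
            calc b * e ≤ b * (b⁻¹ / 4) := by gcongr; exact he.2.1.le
              _ = 1 / 4 := by field_simp
          nlinarith
        have s1 := norm_le_norm_sin (z := Real.pi * b * (1 - Complex.I * v) * e)
          (by simp; have := he.1; positivity) (by simpa using he1)
        have s2 := norm_le_norm_sin (z := Real.pi * b * (1 + Complex.I * v) * e)
          (by simp; have := he.1; positivity) (by simpa using he1)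
        have s3 : ‖Complex.sin (2 * (Real.pi * b) * e)‖ ≤ 2 * (Real.pi * b) * e := by
          rw [show (2 * (Real.pi * b) * e : ℂ) = ((2 * (Real.pi * b) * e : ℝ) : ℂ) by push_cast; ring,
            ← Complex.ofReal_sin, Complex.norm_real, Real.norm_eq_abs]
          have h0 : 0 ≤ 2 * (Real.pi * b) * e := by have := he.1; positivity
          exact (Real.abs_sin_le_abs).trans (abs_of_nonneg h0).le
        have hprod := mul_le_mul s1 s2 (by positivity) (norm_nonneg _)
        have hn : ‖Real.pi * b * (1 - Complex.I * v) * (e : ℂ)‖ *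
            ‖Real.pi * b * (1 + Complex.I * v) * (e : ℂ)‖ =
            (Real.pi * b * e) ^ 2 * (1 + v ^ 2) := by
          rw [← norm_mul, show (Real.pi * b * (1 - Complex.I * v) * (e : ℂ)) *
            (Real.pi * b * (1 + Complex.I * v) * (e : ℂ)) =
            (((Real.pi * b * e) ^ 2 * (1 + v ^ 2) : ℝ) : ℂ) by
              rw [Complex.ofReal_mul, ← hv0]; push_cast; ring, Complex.norm_real,
            Real.norm_of_nonneg (by positivity)]
        have hlow : 4 * b ^ 2 * e ^ 2 * (1 + v ^ 2) ≤
            ‖Complex.sin (Real.pi * b * (1 - Complex.I * v) * e)‖ *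
            ‖Complex.sin (Real.pi * b * (1 + Complex.I * v) * e)‖ := by
          refine le_trans (le_of_eq ?_) hprod
          rw [mul_mul_mul_comm, hn]
          field_simp
          ring
        simp only [hZ]
        rw [norm_div, norm_mul, norm_mul, norm_mul, norm_mul, Complex.norm_real,
          Real.norm_of_nonneg he.1.le, Complex.norm_two, show ‖(4 : ℂ)‖ = 4 by norm_num]
        have he0 := he.1
        calc _ ≤ e * (2 * (2 * (Real.pi * b) * e)) / (4 * (4 * b ^ 2 * e ^ 2 * (1 + v ^ 2))) := by
              gcongr
          _ = _ := by field_simp; ring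
      have hB0 : 0 ≤ B := (norm_nonneg _).trans hBe
      calc _ ≤ C * B * (Real.pi / (4 * b) * (1 + v ^ 2)⁻¹) := by gcongr
        _ = _ := by ring
    · have := ((hHlim v).div hPlim hP0).mul (hZlim v)
      have hb' : (b : ℂ) ≠ 0 := Complex.ofReal_ne_zero.2 hb.ne'
      have hval : dsine b σ * dsine b n₃ * dsine b m₂ * dsine b m₃ * b * b /
          (dsine b σ * dsine b n₃ * dsine b m₂ * dsine b m₃ * b) *
          ((b : ℂ)⁻¹ * ((Real.pi⁻¹ * (1 + v ^ 2)⁻¹ : ℝ) : ℂ)) =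
          ((Real.pi⁻¹ * (1 + v ^ 2)⁻¹ : ℝ) : ℂ) := by
        generalize dsine b σ * dsine b n₃ * dsine b m₂ * dsine b m₃ = A at hP0 ⊢
        have hA : A ≠ 0 := left_ne_zero_of_mul hP0
        field_simp
      rw [hval] at this
      exact this
  have hone : ∫ v : ℝ, ((Real.pi⁻¹ * (1 + v ^ 2)⁻¹ : ℝ) : ℂ) = 1 := by
    rw [integral_complex_ofReal, integral_const_mul, integral_univ_inv_one_add_sq,
      inv_mul_cancel₀ hpi.ne', Complex.ofReal_one]
  rw [hone] at hlim
  refine hlim.congr' ?_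
  filter_upwards [hsmall] with e he
  exact (hfact e he.1 he.2.1).symm

/-! ### The star-triangle identity -/

/-- The case `b < Re (μ₁ + ν₁)` of the star-triangle identity: the parameters can then be moved,
keeping `μ₁ + ν₁` or `μ₁ + ν₂` fixed, to a configuration where the contour is about to be pinched. -/
theorem stRatio_eq_one_of_lt {b : ℝ} (hb : 0 < b) {m₁ m₂ m₃ n₁ n₂ n₃ : ℂ}
    (hm₁ : 0 < m₁.re) (hm₂ : 0 < m₂.re) (hm₃ : 0 < m₃.re) (hn₁ : 0 < n₁.re)
    (hn₂ : 0 < n₂.re) (hn₃ : 0 < n₃.re) (hsum : m₁ + m₂ + m₃ + n₁ + n₂ + n₃ = Q b)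
    (hlt : b < (m₁ + n₁).re) : stRatio b m₁ m₂ m₃ n₁ n₂ n₃ = 1 := by
  set σ := m₁ + n₁ + n₂ with hσ
  have hσre : σ.re = m₁.re + n₁.re + n₂.re := by simp [hσ]
  have hwre : (m₁ + n₁).re = m₁.re + n₁.re := rfl
  set η : ℝ := ((m₁ + n₁).re - b) / 2 with hη
  have hη0 : 0 < η := by rw [hη]; linarith
  have hη2 : m₁.re + n₁.re = b + 2 * η := by rw [hη, hwre]; ring
  refine tendsto_nhds_unique (tendsto_const_nhds.congr' ?_) (tendsto_stRatio_pinch hb hm₂ hm₃ hn₃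
    (σ := σ) (by linarith) (by rw [← hsum, hσ]; ring))
  filter_upwards [self_mem_nhdsWithin, mem_nhdsWithin_of_mem_nhds (Iio_mem_nhds hη0),
    mem_nhdsWithin_of_mem_nhds (Iio_mem_nhds hn₂)] with e (h1 : 0 < e) (h2 : e < η) (h3 : e < n₂.re)
  -- `(μ₁, ν₁, ν₂)` moves to `(σ - η - n₂, η, n₂)`, `(σ - η - e, η, e)` and `(e, σ - 2 e, e)`; each
  -- step keeps a sum whose real part is larger than `b`
  rw [stRatio_eq_of_add_eq hb (m₁' := m₁ + n₁ - η) (n₁' := η) hm₁ (by simp; linarith) hm₂ hm₃ hn₁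
      (by simpa using hη0) hn₂ hn₃ hsum (by ring) hlt, stRatio_swap,
    stRatio_eq_of_add_eq hb (m₁' := σ - η - e) (n₁' := e) (by simp; linarith)
      (by simp; linarith) hm₂ hm₃ hn₂ (by simpa using h1) (by simpa using hη0) hn₃
      (by rw [← hsum]; ring) (by rw [hσ]; ring) (by simp; linarith), stRatio_swap,
    stRatio_eq_of_add_eq hb (m₁' := e) (n₁' := σ - 2 * e) (by simp; linarith)
      (by simpa using h1) hm₂ hm₃ (by simpa using hη0) (by simp; linarith) (by simpa using h1) hn₃
      (by rw [← hsum, hσ]; ring) (by ring) (by simp; linarith)]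

/-- The star-triangle identity for the normalized integral; the general case follows from
`stRatio_eq_one_of_lt` by analytic continuation along a segment that moves all the weight to the
parameter `μ₁`. -/
theorem stRatio_eq_one {b : ℝ} (hb : 0 < b) {m₁ m₂ m₃ n₁ n₂ n₃ : ℂ}
    (hm₁ : 0 < m₁.re) (hm₂ : 0 < m₂.re) (hm₃ : 0 < m₃.re) (hn₁ : 0 < n₁.re)
    (hn₂ : 0 < n₂.re) (hn₃ : 0 < n₃.re) (hsum : m₁ + m₂ + m₃ + n₁ + n₂ + n₃ = Q b) :
    stRatio b m₁ m₂ m₃ n₁ n₂ n₃ = 1 := by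
  have hre : m₁.re + m₂.re + m₃.re + n₁.re + n₂.re + n₃.re = Q b := by
    simpa using congrArg Complex.re hsum
  have hbi : 0 < b⁻¹ := inv_pos.2 hb
  have hQ : Q b = b + b⁻¹ := rfl
  set μ : ℂ → Fin 3 → ℂ := fun t => ![m₁ + t * (Q b - m₁), (1 - t) * m₂, (1 - t) * m₃] with hμ
  set ν : ℂ → Fin 3 → ℂ := fun t => ![(1 - t) * n₁, (1 - t) * n₂, (1 - t) * n₃] with hν
  set U : Set ℂ := {t | (∀ i, 0 < (μ t i).re) ∧ ∀ i, 0 < (ν t i).re} with hU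
  have hμd : ∀ i, Differentiable ℂ fun t => μ t i := fun i => by
    fin_cases i <;> simp [hμ] <;> fun_prop
  have hνd : ∀ i, Differentiable ℂ fun t => ν t i := fun i => by
    fin_cases i <;> simp [hν] <;> fun_prop
  have hUo : IsOpen U := by
    rw [hU, Set.ofPred_and]
    simp only [Set.ofPred_forall]
    exact (isOpen_iInter_of_finite fun i => isOpen_lt continuous_const
      (Complex.continuous_re.comp (hμd i).continuous)).inter
      (isOpen_iInter_of_finite fun i => isOpen_lt continuous_const
      (Complex.continuous_re.comp (hνd i).continuous))
  -- all parameters are affine functions of `t`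
  have haff : ∀ p q x y : ℂ, ∀ r s : ℝ, 0 ≤ r → 0 ≤ s → r + s = 1 → 0 < (p + x * q).re →
      0 < (p + y * q).re → 0 < (p + (r • x + s • y) * q).re := by
    intro p q x y r s hr hs hrs hx hy
    have : p + (r • x + s • y) * q = (r : ℂ) * (p + x * q) + (s : ℂ) * (p + y * q) := by
      have h1 : (r : ℂ) + s = 1 := by exact_mod_cast hrs
      simp only [Complex.real_smul]
      linear_combination (-p) * h1
    rw [this, Complex.add_re, Complex.re_ofReal_mul, Complex.re_ofReal_mul]
    rcases hr.eq_or_lt with h | h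
    · have : s = 1 := by linarith
      rw [← h, this]; linarith
    · have := mul_pos h hx
      have := mul_nonneg hs hy.le
      linarith
  have hUc : Convex ℝ U := by
    intro x hx y hy r s hr hs hrs
    have hform : ∀ (n t : ℂ), (1 - t) * n = n + t * (-n) := fun n t => by ring
    have hone : ∀ n : ℂ, 0 < ((1 - x) * n).re → 0 < ((1 - y) * n).re →
        0 < ((1 - (r • x + s • y)) * n).re := by
      intro n
      simp only [hform]
      exact haff _ _ _ _ _ _ hr hs hrs
    refine ⟨fun i => ?_, fun i => ?_⟩
    · have h1 := hx.1 i
      have h2 := hy.1 i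
      fin_cases i
      · exact haff _ _ _ _ _ _ hr hs hrs h1 h2
      · exact hone _ h1 h2
      · exact hone _ h1 h2
    · have h1 := hx.2 i
      have h2 := hy.2 i
      fin_cases i
      · exact hone _ h1 h2
      · exact hone _ h1 h2
      · exact hone _ h1 h2
  have hsumt : ∀ t, ∑ i, (μ t i + ν t i) = Q b := by
    intro t
    simp only [Fin.sum_univ_three, hμ, hν, Matrix.cons_val_zero, Matrix.cons_val_one,
      Matrix.cons_val]
    linear_combination (1 - t) * hsum
  have han := (differentiableOn_stRatio hb hUo (fun i => (hμd i).differentiableOn)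
    (fun i => (hνd i).differentiableOn) (fun t ht => ht.1) (fun t ht => ht.2)
    fun t _ => hsumt t).analyticOnNhd hUo
  have hst : ∀ t, stIntegral b (μ t) (ν t) / stProd b (μ t) (ν t) = stRatio b (m₁ + t * (Q b - m₁))
      ((1 - t) * m₂) ((1 - t) * m₃) ((1 - t) * n₁) ((1 - t) * n₂) ((1 - t) * n₃) := fun t => rfl
  -- near the end of the segment, at `t₁ = 1 - δ`, the special case applies: there
  -- `Re μ₁ ≥ (1 - δ) Q ≥ Q - b⁻¹ / 2 > b`
  set t₁ : ℝ := 1 - min (1 / 2) (b⁻¹ / (2 * Q b)) with ht₁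
  have hQ0 := Q_pos hb
  have hmin0 : 0 < min (1 / 2) (b⁻¹ / (2 * Q b)) := lt_min (by norm_num) (by positivity)
  have hmin1 : min (1 / 2) (b⁻¹ / (2 * Q b)) ≤ 1 / 2 := min_le_left _ _
  have hmin2 : min (1 / 2) (b⁻¹ / (2 * Q b)) * Q b ≤ b⁻¹ / 2 := by
    calc _ ≤ b⁻¹ / (2 * Q b) * Q b := by gcongr; exact min_le_right _ _
      _ = _ := by field_simp
  set δ := min (1 / 2) (b⁻¹ / (2 * Q b)) with hδ
  have hre1 : ∀ n : ℂ, 0 < n.re → 0 < ((1 - (t₁ : ℂ)) * n).re := by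
    intro n hn
    rw [ht₁, show (1 : ℂ) - ((1 - δ : ℝ) : ℂ) = (δ : ℂ) by push_cast; ring, Complex.re_ofReal_mul]
    positivity
  have hm1re : (m₁ + (t₁ : ℂ) * (Q b - m₁)).re = m₁.re + t₁ * (Q b - m₁.re) := by
    rw [Complex.add_re, Complex.re_ofReal_mul, Complex.sub_re, Complex.ofReal_re]
  have ht₁U : (t₁ : ℂ) ∈ U := by
    refine ⟨fun i => ?_, fun i => ?_⟩
    · fin_cases i
      · change 0 < (m₁ + (t₁ : ℂ) * (Q b - m₁)).re
        rw [hm1re]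
        have := mul_pos (show 0 < t₁ by linarith) (show 0 < Q b - m₁.re by linarith)
        linarith
      · exact hre1 _ hm₂
      · exact hre1 _ hm₃
    · fin_cases i
      · exact hre1 _ hn₁
      · exact hre1 _ hn₂
      · exact hre1 _ hn₃
  have hev : (fun t => stIntegral b (μ t) (ν t) / stProd b (μ t) (ν t)) =ᶠ[𝓝 (t₁ : ℂ)]
      fun _ => (1 : ℂ) := by
    have hcont : ContinuousAt (fun t => (μ t 0 + ν t 0).re) (t₁ : ℂ) :=
      (Complex.continuous_re.comp ((hμd 0).continuous.add (hνd 0).continuous)).continuousAt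
    have hval : b < (μ t₁ 0 + ν t₁ 0).re := by
      change b < (m₁ + (t₁ : ℂ) * (Q b - m₁) + (1 - t₁) * n₁).re
      have h1 := hre1 n₁ hn₁
      rw [Complex.add_re, hm1re]
      have h2 : m₁.re + t₁ * (Q b - m₁.re) = Q b - δ * (Q b - m₁.re) := by rw [ht₁]; ring
      have h3 : δ * (Q b - m₁.re) ≤ δ * Q b := by gcongr; linarith
      linarith
    filter_upwards [hUo.mem_nhds ht₁U, hcont.eventually_const_lt hval] with t ht hlt
    rw [hst]
    exact stRatio_eq_one_of_lt hb (ht.1 0) (ht.1 1) (ht.1 2) (ht.2 0) (ht.2 1) (ht.2 2)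
      (by linear_combination (1 - t) * hsum) hlt
  have h0U : (0 : ℂ) ∈ U := by
    refine ⟨fun i => ?_, fun i => ?_⟩ <;> fin_cases i <;> simpa [hμ, hν]
  have := han.eqOn_of_preconnected_of_eventuallyEq analyticOnNhd_const hUc.isPreconnected ht₁U hev h0U
  simp only [hst] at this
  simpa using this

/-- The star-triangle identity for the double sine function: if `∑ (μᵢ + νᵢ) = Q` then
`∫ ∏ᵢ S_b(μᵢ - iy) S_b(νᵢ + iy) dy = ∏ᵢⱼ S_b(μᵢ + νⱼ)`. -/
theorem stIntegral_eq_stProd {b : ℝ} (hb : 0 < b) {μ ν : Fin 3 → ℂ} (hμ : ∀ i, 0 < (μ i).re)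
    (hν : ∀ i, 0 < (ν i).re) (hsum : ∑ i, (μ i + ν i) = Q b) :
    stIntegral b μ ν = stProd b μ ν := by
  have h := stRatio_eq_one hb (hμ 0) (hμ 1) (hμ 2) (hν 0) (hν 1) (hν 2)
    (by rw [← hsum, Fin.sum_univ_three]; ring)
  have e : ∀ f : Fin 3 → ℂ, ![f 0, f 1, f 2] = f := fun f => by
    ext i; fin_cases i <;> rfl
  rw [stRatio, e, e] at h
  exact (div_eq_one_iff_eq (stProd_ne_zero _ _ _)).1 h

/-! ### The kernel identities -/

theorem D_eq (b : ℝ) (β x : ℂ) : D b β x =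
    Sb b (Q b / 2 - Complex.I * x - Complex.I * β) /
      Sb b (Q b / 2 - Complex.I * x + Complex.I * β) := rfl

/-- The Clebsch-Gordan coefficient written out as a product of ratios of double sine functions. -/
theorem cgAn_eq (b : ℝ) (α₃ α₂ α₁ x₃ x₂ x₁ : ℂ) : cgAn b α₃ α₂ α₁ x₃ x₂ x₁ =
    Complex.exp (-(Real.pi * Complex.I * (confDim b α₃ - confDim b α₁ - confDim b α₂) / 2)) *
    (Sb b (Q b - (α₁ + α₂) / 2 - α₃ - Complex.I * (x₂ - x₁)) /
      Sb b ((α₁ + α₂) / 2 - Complex.I * (x₂ - x₁))) *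
    (Sb b ((α₃ - α₂) / 2 - Complex.I * (x₂ - x₃)) /
      Sb b (Q b - α₁ + (α₂ - α₃) / 2 - Complex.I * (x₂ - x₃))) *
    (Sb b ((α₃ - α₁) / 2 - Complex.I * (x₃ - x₁)) /
      Sb b (Q b - α₂ + (α₁ - α₃) / 2 - Complex.I * (x₃ - x₁))) := by
  have hI := Complex.I_sq
  simp only [cgAn, D_eq]
  congr 1
  · congr 1
    · congr 1
      congr 1 <;> congr 1
      · linear_combination (α₃ / 2 + 1 / 2 * (α₁ + α₂ + α₃ - Q b)) * hI
      · linear_combination (α₃ / 2 - 1 / 2 * (α₁ + α₂ + α₃ - Q b)) * hI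
    · congr 1 <;> congr 1
      · linear_combination (α₁ / 2 + 1 / 2 * (Q b + α₂ - α₃ - α₁)) * hI
      · linear_combination (α₁ / 2 - 1 / 2 * (Q b + α₂ - α₃ - α₁)) * hI
  · congr 1 <;> congr 1
    · linear_combination (α₂ / 2 + 1 / 2 * (Q b + α₁ - α₃ - α₂)) * hI
    · linear_combination (α₂ / 2 - 1 / 2 * (Q b + α₁ - α₃ - α₂)) * hI

theorem Sb_div_Sb_eq {b : ℝ} {x y z : ℂ} (hx : x ∈ strip b) (hz : z ∈ strip b) (hyz : y + z = Q b) :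
    Sb b x / Sb b y = dsine b x * dsine b z := by
  obtain rfl : z = Q b - y := by rw [← hyz]; ring
  have hy : y ∈ strip b := by
    have h1 := hz.1
    have h2 := hz.2
    simp only [Complex.sub_re, Complex.ofReal_re] at h1 h2
    exact ⟨by linarith, by linarith⟩
  rw [Sb_eq_dsine hx, Sb_eq_dsine hy, dsine_reflect, div_eq_mul_inv]

theorem D_neg_I_mul_eq {b : ℝ} {α x : ℂ} (h1 : Q b / 2 - α - Complex.I * x ∈ strip b)
    (h2 : Q b / 2 - α + Complex.I * x ∈ strip b) : D b (-Complex.I * α) x =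
    dsine b (Q b / 2 - α - Complex.I * x) * dsine b (Q b / 2 - α + Complex.I * x) := by
  have hI := Complex.I_sq
  rw [← Sb_div_Sb_eq (y := Q b / 2 + α - Complex.I * x) h1 h2 (by ring), D_eq]
  congr 1 <;> congr 1
  · linear_combination α * hI
  · linear_combination (-α) * hI

theorem confDim_reflect (b : ℝ) (α : ℂ) : confDim b (Q b - α) = confDim b α := by
  simp only [confDim]; ring


/-- The kernel identity for `D_{-i(Q-α₁)}`, an instance of the star-triangle identity. -/
theorem kernel_identity {b : ℝ} (hb : 0 < b) {α₁ α₂ α₃ x₁ x₂ x₃ : ℂ}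
    (hν₁ : 0 < (Q b - (α₁ + α₂) / 2 - α₃ - Complex.I * x₂).re)
    (hμ₁ : 0 < (Q b - (α₁ + α₂) / 2 + Complex.I * x₂).re)
    (hν₂ : 0 < ((α₃ - α₁) / 2 - Complex.I * x₃).re)
    (hμ₂ : 0 < (α₂ + (α₃ - α₁) / 2 + Complex.I * x₃).re)
    (hν₃ : 0 < (α₁ - Q b / 2 - Complex.I * x₁).re)
    (hμ₃ : 0 < (α₁ - Q b / 2 + Complex.I * x₁).re) :
    Integrable (fun y : ℝ => cgAn b α₃ α₂ α₁ x₃ x₂ y * D b (-Complex.I * (Q b - α₁)) (y - x₁)) ∧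
    Sb b (2 * (Q b - α₁))
        * ∫ y : ℝ, cgAn b α₃ α₂ α₁ x₃ x₂ y * D b (-Complex.I * (Q b - α₁)) (y - x₁)
      = Sb b (α₂ + α₃ - α₁) * Sb b (2 * Q b - α₁ - α₂ - α₃)
        * cgAn b α₃ α₂ (Q b - α₁) x₃ x₂ x₁ := by
  set μ : Fin 3 → ℂ := ![Q b - (α₁ + α₂) / 2 + Complex.I * x₂, α₂ + (α₃ - α₁) / 2 + Complex.I * x₃,
    α₁ - Q b / 2 + Complex.I * x₁] with hμ
  set ν : Fin 3 → ℂ := ![Q b - (α₁ + α₂) / 2 - α₃ - Complex.I * x₂,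
    (α₃ - α₁) / 2 - Complex.I * x₃, α₁ - Q b / 2 - Complex.I * x₁] with hν
  have hμp : ∀ i, 0 < (μ i).re := by intro i; fin_cases i; exacts [hμ₁, hμ₂, hμ₃]
  have hνp : ∀ i, 0 < (ν i).re := by intro i; fin_cases i; exacts [hν₁, hν₂, hν₃]
  have hsum : ∑ i, (μ i + ν i) = Q b := by
    simp only [Fin.sum_univ_three, hμ, hν, Matrix.cons_val_zero, Matrix.cons_val_one,
      Matrix.cons_val]
    ring
  obtain ⟨hμs, hνs, hμν⟩ := mem_strip_of_sum_eq hμp hνp hsum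
  -- the factors of the integrand that do not depend on `y`; `X` is the common singular factor, whose
  -- value is immaterial because both sides contain it
  set A := Complex.exp (-(Real.pi * Complex.I *
    (confDim b α₃ - confDim b α₁ - confDim b α₂) / 2)) with hA
  set X := Sb b ((α₃ - α₂) / 2 - Complex.I * (x₂ - x₃)) with hX
  have hker : ∀ y : ℝ, cgAn b α₃ α₂ α₁ x₃ x₂ y * D b (-Complex.I * (Q b - α₁)) (y - x₁) =
      A * (X / Sb b (μ 1 + ν 0)) * stKernel b μ ν (Complex.I * y) := by
    intro y
    have hμy : ∀ i, μ i - Complex.I * y ∈ strip b := fun i => by simpa [strip] using hμs i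
    have hνy : ∀ i, ν i + Complex.I * y ∈ strip b := fun i => by simpa [strip] using hνs i
    have e1 : Sb b (Q b - (α₁ + α₂) / 2 - α₃ - Complex.I * (x₂ - y)) /
        Sb b ((α₁ + α₂) / 2 - Complex.I * (x₂ - y)) =
        dsine b (ν 0 + Complex.I * y) * dsine b (μ 0 - Complex.I * y) := by
      rw [← Sb_div_Sb_eq (hνy 0) (hμy 0) (y := (α₁ + α₂) / 2 - Complex.I * (x₂ - y))
        (by simp [hμ]; ring)]
      congr 2
      simp [hν]; ring
    have e2 : Sb b ((α₃ - α₁) / 2 - Complex.I * (x₃ - y)) /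
        Sb b (Q b - α₂ + (α₁ - α₃) / 2 - Complex.I * (x₃ - y)) =
        dsine b (ν 1 + Complex.I * y) * dsine b (μ 1 - Complex.I * y) := by
      rw [← Sb_div_Sb_eq (hνy 1) (hμy 1)
        (y := Q b - α₂ + (α₁ - α₃) / 2 - Complex.I * (x₃ - y)) (by simp [hμ]; ring)]
      congr 2
      simp [hν]; ring
    have t1 : Q b / 2 - (Q b - α₁) - Complex.I * (y - x₁) = μ 2 - Complex.I * y := by
      simp [hμ]; ring
    have t2 : Q b / 2 - (Q b - α₁) + Complex.I * (y - x₁) = ν 2 + Complex.I * y := by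
      simp [hν]; ring
    have e3 : D b (-Complex.I * (Q b - α₁)) (y - x₁) =
        dsine b (ν 2 + Complex.I * y) * dsine b (μ 2 - Complex.I * y) := by
      rw [D_neg_I_mul_eq (by rw [t1]; exact hμy 2) (by rw [t2]; exact hνy 2), t1, t2, mul_comm]
    rw [cgAn_eq, e1, e2, e3, show Q b - α₁ + (α₂ - α₃) / 2 - Complex.I * (x₂ - x₃) = μ 1 + ν 0 by
      simp [hμ, hν]; ring]
    simp only [stKernel, Fin.prod_univ_three]
    ring
  refine ⟨((integrable_stKernel hb hμs hνs (sum_re_lt_of_sum_eq hb hsum)).const_mul _).congr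
    (ae_of_all _ fun y => (hker y).symm), ?_⟩
  simp only [hker]
  rw [integral_const_mul]
  change _ * (_ * stIntegral b μ ν) = _
  rw [stIntegral_eq_stProd hb hμp hνp hsum]
  have hr : ∀ i j, Q b - (μ i + ν j) ∈ strip b := fun i j => by
    have := hμν i j
    simp only [strip, Set.mem_ofPred_eq, Complex.sub_re, Complex.ofReal_re] at this ⊢
    constructor <;> linarith
  have c1 : Sb b (2 * (Q b - α₁)) = (dsine b (μ 2 + ν 2))⁻¹ := by
    rw [← dsine_reflect, ← Sb_eq_dsine (hr 2 2)]
    congr 1; simp [hμ, hν]; ring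
  have c2 : Sb b (α₂ + α₃ - α₁) = dsine b (μ 1 + ν 1) := by
    rw [← Sb_eq_dsine (hμν 1 1)]
    congr 1; simp [hμ, hν]; ring
  have c3 : Sb b (2 * Q b - α₁ - α₂ - α₃) = dsine b (μ 0 + ν 0) := by
    rw [← Sb_eq_dsine (hμν 0 0)]
    congr 1; simp [hμ, hν]; ring
  have d1 : Sb b (Q b - (Q b - α₁ + α₂) / 2 - α₃ - Complex.I * (x₂ - x₁)) /
      Sb b ((Q b - α₁ + α₂) / 2 - Complex.I * (x₂ - x₁)) =
      dsine b (μ 2 + ν 0) * dsine b (μ 0 + ν 2) := by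
    rw [← Sb_div_Sb_eq (hμν 2 0) (hμν 0 2) (y := (Q b - α₁ + α₂) / 2 - Complex.I * (x₂ - x₁))
      (by simp [hμ, hν]; ring)]
    congr 2; simp [hμ, hν]; ring
  have d2 : Sb b (Q b - (Q b - α₁) + (α₂ - α₃) / 2 - Complex.I * (x₂ - x₃)) =
      (dsine b (μ 0 + ν 1))⁻¹ := by
    rw [← dsine_reflect, ← Sb_eq_dsine (hr 0 1)]
    congr 1; simp [hμ, hν]; ring
  have d3 : Sb b ((α₃ - (Q b - α₁)) / 2 - Complex.I * (x₃ - x₁)) /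
      Sb b (Q b - α₂ + (Q b - α₁ - α₃) / 2 - Complex.I * (x₃ - x₁)) =
      dsine b (μ 2 + ν 1) * dsine b (μ 1 + ν 2) := by
    rw [← Sb_div_Sb_eq (hμν 2 1) (hμν 1 2)
      (y := Q b - α₂ + (Q b - α₁ - α₃) / 2 - Complex.I * (x₃ - x₁)) (by simp [hμ, hν]; ring)]
    congr 2; simp [hμ, hν]; ring
  rw [cgAn_eq, confDim_reflect, d1, d2, d3, c1, c2, c3, Sb_eq_dsine (hμν 1 0), stProd, ← hA, ← hX]
  simp only [Fin.prod_univ_three]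
  have g1 := dsine_ne_zero b (μ 2 + ν 2)
  have g2 := dsine_ne_zero b (μ 1 + ν 0)
  field_simp

/-- The kernel identity for `D_{-iα₃}` acting on the variable `x₃`. -/
theorem kernel_identity_three {b : ℝ} (hb : 0 < b) {α₁ α₂ α₃ x₁ x₂ x₃ : ℂ}
    (hν₁ : 0 < ((α₃ - α₂) / 2 - Complex.I * x₂).re)
    (hμ₁ : 0 < (α₁ + (α₃ - α₂) / 2 + Complex.I * x₂).re)
    (hν₂ : 0 < (α₂ + (α₃ - α₁) / 2 - Complex.I * x₁).re)
    (hμ₂ : 0 < ((α₃ - α₁) / 2 + Complex.I * x₁).re)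
    (hν₃ : 0 < (Q b / 2 - α₃ - Complex.I * x₃).re)
    (hμ₃ : 0 < (Q b / 2 - α₃ + Complex.I * x₃).re) :
    Integrable (fun y : ℝ => D b (-Complex.I * α₃) (x₃ - y) * cgAn b α₃ α₂ α₁ y x₂ x₁) ∧
    Sb b (2 * α₃) * ∫ y : ℝ, D b (-Complex.I * α₃) (x₃ - y) * cgAn b α₃ α₂ α₁ y x₂ x₁
      = Sb b (α₁ + α₃ - α₂) * Sb b (α₂ + α₃ - α₁) * cgAn b (Q b - α₃) α₂ α₁ x₃ x₂ x₁ := by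
  set μ : Fin 3 → ℂ := ![α₁ + (α₃ - α₂) / 2 + Complex.I * x₂, (α₃ - α₁) / 2 + Complex.I * x₁,
    Q b / 2 - α₃ + Complex.I * x₃] with hμ
  set ν : Fin 3 → ℂ := ![(α₃ - α₂) / 2 - Complex.I * x₂, α₂ + (α₃ - α₁) / 2 - Complex.I * x₁,
    Q b / 2 - α₃ - Complex.I * x₃] with hν
  have hμp : ∀ i, 0 < (μ i).re := by intro i; fin_cases i; exacts [hμ₁, hμ₂, hμ₃]
  have hνp : ∀ i, 0 < (ν i).re := by intro i; fin_cases i; exacts [hν₁, hν₂, hν₃]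
  have hsum : ∑ i, (μ i + ν i) = Q b := by
    simp only [Fin.sum_univ_three, hμ, hν, Matrix.cons_val_zero, Matrix.cons_val_one,
      Matrix.cons_val]
    ring
  obtain ⟨hμs, hνs, hμν⟩ := mem_strip_of_sum_eq hμp hνp hsum
  have hr : ∀ i j, Q b - (μ i + ν j) ∈ strip b := fun i j => by
    have := hμν i j
    simp only [strip, Set.mem_ofPred_eq, Complex.sub_re, Complex.ofReal_re] at this ⊢
    constructor <;> linarith
  set A := Complex.exp (-(Real.pi * Complex.I *
    (confDim b α₃ - confDim b α₁ - confDim b α₂) / 2)) with hA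
  set X := Sb b ((α₁ + α₂) / 2 - Complex.I * (x₂ - x₁)) with hX
  have hn1 : Sb b (Q b - (α₁ + α₂) / 2 - α₃ - Complex.I * (x₂ - x₁)) =
      (dsine b (μ 0 + ν 1))⁻¹ := by
    rw [← dsine_reflect, ← Sb_eq_dsine (hr 0 1)]
    congr 1; simp [hμ, hν]; ring
  have hker : ∀ y : ℝ, D b (-Complex.I * α₃) (x₃ - y) * cgAn b α₃ α₂ α₁ y x₂ x₁ =
      A * ((dsine b (μ 0 + ν 1))⁻¹ / X) * stKernel b μ ν (Complex.I * y) := by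
    intro y
    have hμy : ∀ i, μ i - Complex.I * y ∈ strip b := fun i => by simpa [strip] using hμs i
    have hνy : ∀ i, ν i + Complex.I * y ∈ strip b := fun i => by simpa [strip] using hνs i
    have e1 : Sb b ((α₃ - α₂) / 2 - Complex.I * (x₂ - y)) /
        Sb b (Q b - α₁ + (α₂ - α₃) / 2 - Complex.I * (x₂ - y)) =
        dsine b (ν 0 + Complex.I * y) * dsine b (μ 0 - Complex.I * y) := by
      rw [← Sb_div_Sb_eq (hνy 0) (hμy 0)
        (y := Q b - α₁ + (α₂ - α₃) / 2 - Complex.I * (x₂ - y)) (by simp [hμ]; ring)]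
      congr 2
      simp [hν]; ring
    have e2 : Sb b ((α₃ - α₁) / 2 - Complex.I * (y - x₁)) /
        Sb b (Q b - α₂ + (α₁ - α₃) / 2 - Complex.I * (y - x₁)) =
        dsine b (μ 1 - Complex.I * y) * dsine b (ν 1 + Complex.I * y) := by
      rw [← Sb_div_Sb_eq (hμy 1) (hνy 1)
        (y := Q b - α₂ + (α₁ - α₃) / 2 - Complex.I * (y - x₁)) (by simp [hν]; ring)]
      congr 2
      simp [hμ]; ring
    have t1 : Q b / 2 - α₃ - Complex.I * (x₃ - y) = ν 2 + Complex.I * y := by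
      simp [hν]; ring
    have t2 : Q b / 2 - α₃ + Complex.I * (x₃ - y) = μ 2 - Complex.I * y := by
      simp [hμ]; ring
    have e3 : D b (-Complex.I * α₃) (x₃ - y) =
        dsine b (ν 2 + Complex.I * y) * dsine b (μ 2 - Complex.I * y) := by
      rw [D_neg_I_mul_eq (by rw [t1]; exact hνy 2) (by rw [t2]; exact hμy 2), t1, t2]
    rw [cgAn_eq, e1, e2, e3, hn1]
    simp only [stKernel, Fin.prod_univ_three]
    ring
  refine ⟨((integrable_stKernel hb hμs hνs (sum_re_lt_of_sum_eq hb hsum)).const_mul _).congr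
    (ae_of_all _ fun y => (hker y).symm), ?_⟩
  simp only [hker]
  rw [integral_const_mul]
  change _ * (_ * stIntegral b μ ν) = _
  rw [stIntegral_eq_stProd hb hμp hνp hsum]
  have c1 : Sb b (2 * α₃) = (dsine b (μ 2 + ν 2))⁻¹ := by
    rw [← dsine_reflect, ← Sb_eq_dsine (hr 2 2)]
    congr 1; simp [hμ, hν]; ring
  have c2 : Sb b (α₁ + α₃ - α₂) = dsine b (μ 0 + ν 0) := by
    rw [← Sb_eq_dsine (hμν 0 0)]
    congr 1; simp [hμ, hν]; ring
  have c3 : Sb b (α₂ + α₃ - α₁) = dsine b (μ 1 + ν 1) := by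
    rw [← Sb_eq_dsine (hμν 1 1)]
    congr 1; simp [hμ, hν]; ring
  have d1 : Sb b (Q b - (α₁ + α₂) / 2 - (Q b - α₃) - Complex.I * (x₂ - x₁)) =
      dsine b (μ 1 + ν 0) := by
    rw [← Sb_eq_dsine (hμν 1 0)]
    congr 1; simp [hμ, hν]; ring
  have d2 : Sb b ((Q b - α₃ - α₂) / 2 - Complex.I * (x₂ - x₃)) /
      Sb b (Q b - α₁ + (α₂ - (Q b - α₃)) / 2 - Complex.I * (x₂ - x₃)) =
      dsine b (μ 2 + ν 0) * dsine b (μ 0 + ν 2) := by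
    rw [← Sb_div_Sb_eq (hμν 2 0) (hμν 0 2)
      (y := Q b - α₁ + (α₂ - (Q b - α₃)) / 2 - Complex.I * (x₂ - x₃)) (by simp [hμ, hν]; ring)]
    congr 2; simp [hμ, hν]; ring
  have d3 : Sb b ((Q b - α₃ - α₁) / 2 - Complex.I * (x₃ - x₁)) /
      Sb b (Q b - α₂ + (α₁ - (Q b - α₃)) / 2 - Complex.I * (x₃ - x₁)) =
      dsine b (μ 1 + ν 2) * dsine b (μ 2 + ν 1) := by
    rw [← Sb_div_Sb_eq (hμν 1 2) (hμν 2 1)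
      (y := Q b - α₂ + (α₁ - (Q b - α₃)) / 2 - Complex.I * (x₃ - x₁)) (by simp [hμ, hν]; ring)]
    congr 2; simp [hμ, hν]; ring
  rw [cgAn_eq, confDim_reflect, d1, d2, d3, c1, c2, c3, stProd, ← hA, ← hX]
  simp only [Fin.prod_univ_three]
  have g1 := dsine_ne_zero b (μ 2 + ν 2)
  have g2 := dsine_ne_zero b (μ 0 + ν 1)
  field_simp

/-! ### Holomorphic extension of the elements of `P_α` -/

/-- For an integrable element of `L²`, the `L²` inverse Fourier transform is given by the
integral. -/
theorem fourierInv_L2_ae_eq (F : L2) (hF : Integrable (F : ℝ → ℂ)) :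
    ((𝓕⁻ F : L2) : ℝ → ℂ) =ᵐ[volume] 𝓕⁻ (F : ℝ → ℂ) := by
  have hcont : Continuous (𝓕⁻ (F : ℝ → ℂ)) :=
    VectorFourier.fourierIntegral_continuous Real.continuous_fourierChar
      (L := -innerₗ ℝ) (by simp; fun_prop) hF
  refine ae_eq_of_integral_contDiff_smul_eq ?_ hcont.locallyIntegrable fun g hg hgc => ?_
  · exact (Lp.memLp (𝓕⁻ F)).locallyIntegrable (by norm_num)
  set φ : ℝ → ℂ := fun x => g x with hφ
  have hφc : HasCompactSupport φ := hgc.comp_left (g := fun r : ℝ => (r : ℂ)) (by simp)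
  have hφd : ContDiff ℝ (⊤ : ℕ∞) φ := Complex.ofRealCLM.contDiff.comp hg
  set s := hφc.toSchwartzMap hφd with hs
  have hsφ : ∀ x, s x = φ x := fun x => rfl
  have h1 := congrArg (fun T => T s) (Lp.fourierInv_toTemperedDistribution_eq F)
  simp only [TemperedDistribution.fourierInv_apply, Lp.toTemperedDistribution_apply] at h1
  rw [SchwartzMap.fourierInv_coe] at h1
  have h2 := VectorFourier.integral_fourierIntegral_smul_eq_flip (e := Real.fourierChar)
    (μ := (volume : Measure ℝ)) (ν := (volume : Measure ℝ)) (L := -innerₗ ℝ)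
    Real.continuous_fourierChar
    (by simp; fun_prop) s.integrable hF
  have h3 : (-innerₗ ℝ).flip = -innerₗ ℝ := by
    ext; simp
  rw [h3] at h2
  have h4 := h1.symm.trans h2
  simp only [hsφ, hφ, smul_eq_mul, Complex.real_smul] at h4 ⊢
  exact h4

/-- `h` is holomorphic and bounded by `B` on the strip `|Im z| < c`. -/
def StripBounded (c B : ℝ) (h : ℂ → ℂ) : Prop :=
  DifferentiableOn ℂ h (hStrip (-c) c) ∧ ∀ z ∈ hStrip (-c) c, ‖h z‖ ≤ B

/-- If `e^{±2πc'k} F ∈ L²` then the inverse Fourier transform of `F` extends to a bounded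
holomorphic function on any strip `|Im z| < c` with `c < c'`. -/
theorem exists_stripBounded_of_fourier {c c' : ℝ} (hc0 : 0 < c) (hc : c < c') (F G G' : L2)
    (hG : PosGraph (fun k => Complex.exp (-(2 * Real.pi * c' * k))) F G)
    (hG' : PosGraph (fun k => Complex.exp (-(2 * Real.pi * c' * k))) G' F) :
    ∃ B h, StripBounded c B h ∧ ((𝓕⁻ F : L2) : ℝ → ℂ) =ᵐ[volume] fun x => h x := by
  have hpi := Real.pi_pos
  -- the weighted function is a product of two square-integrable functions
  have hw : Integrable fun k : ℝ => Real.exp (2 * Real.pi * c * |k|) * ‖F k‖ := by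
    have hdec : MemLp (fun k : ℝ => Real.exp (-(2 * Real.pi * (c' - c)) * |k|)) 2 := by
      rw [memLp_two_iff_integrable_sq (by fun_prop)]
      have := integrable_exp_neg_mul_abs (a := 2 * (2 * Real.pi * (c' - c)))
        (by have := sub_pos.2 hc; positivity)
      refine this.congr (ae_of_all _ fun k => ?_)
      simp only
      rw [← Real.exp_nat_mul]
      congr 1
      push_cast; ring
    have hsum : MemLp (fun k : ℝ => ‖(G : ℝ → ℂ) k‖ + ‖(G' : ℝ → ℂ) k‖) 2 :=
      (Lp.memLp G).norm.add (Lp.memLp G').norm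
    refine (hdec.integrable_mul hsum).mono' ?_ ?_
    · exact AEStronglyMeasurable.mul (by fun_prop) (Lp.aestronglyMeasurable F).norm
    · filter_upwards [hG, hG'] with k h1 h2
      have e1 : ‖(G : ℝ → ℂ) k‖ = Real.exp (-(2 * Real.pi * c' * k)) * ‖(F : ℝ → ℂ) k‖ := by
        rw [h1, norm_mul, Complex.norm_exp]; congr 2; simp
      have e2 : ‖(G' : ℝ → ℂ) k‖ = Real.exp (2 * Real.pi * c' * k) * ‖(F : ℝ → ℂ) k‖ := by
        rw [h2, norm_mul, Complex.norm_exp, ← mul_assoc, ← Real.exp_add]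
        simp
      simp only [Pi.mul_apply, norm_mul, norm_norm,
        Real.norm_of_nonneg (Real.exp_pos _).le]
      rw [e1, e2, ← add_mul, ← mul_assoc, mul_add, ← Real.exp_add, ← Real.exp_add]
      gcongr
      rcases le_total 0 k with hk | hk
      · rw [abs_of_nonneg hk]
        refine le_add_of_nonneg_of_le (Real.exp_pos _).le (Real.exp_le_exp.2 (le_of_eq ?_))
        ring
      · rw [abs_of_nonpos hk]
        refine le_add_of_le_of_nonneg (Real.exp_le_exp.2 (le_of_eq ?_)) (Real.exp_pos _).le
        ring
  have hF : Integrable (F : ℝ → ℂ) := by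
    refine hw.mono' (Lp.aestronglyMeasurable F) (ae_of_all _ fun k => ?_)
    refine le_mul_of_one_le_left (norm_nonneg _) (Real.one_le_exp (by positivity))
  have hbd : ∀ z ∈ hStrip (-c) c, ∀ k : ℝ, ‖Complex.exp (2 * Real.pi * Complex.I * k * z) *
      (F : ℝ → ℂ) k‖ ≤ Real.exp (2 * Real.pi * c * |k|) * ‖(F : ℝ → ℂ) k‖ := by
    intro z hz k
    rw [norm_mul, Complex.norm_exp]
    gcongr
    have : (2 * Real.pi * Complex.I * k * z).re = 2 * Real.pi * (-(k * z.im)) := by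
      simp; ring
    rw [this, mul_assoc (2 * Real.pi)]
    gcongr
    refine (neg_le_abs _).trans ?_
    rw [abs_mul, mul_comm]
    gcongr
    exact abs_le.2 ⟨hz.1.le, hz.2.le⟩
  refine ⟨∫ k : ℝ, Real.exp (2 * Real.pi * c * |k|) * ‖(F : ℝ → ℂ) k‖,
    fun z => ∫ k : ℝ, Complex.exp (2 * Real.pi * Complex.I * k * z) * (F : ℝ → ℂ) k, ⟨?_, ?_⟩, ?_⟩
  · refine differentiableOn_integral_of_locally_bounded (isOpen_hStrip _ _) (fun z hz => ?_)
      (ae_of_all _ fun k => ?_) fun z hz => ⟨Set.univ, univ_mem, _, hw, ae_of_all _ fun k w hw => ?_⟩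
    · exact AEStronglyMeasurable.mul (by fun_prop) (Lp.aestronglyMeasurable F)
    · fun_prop
    · exact hbd w hw.2 k
  · intro z hz
    exact norm_integral_le_of_norm_le hw (ae_of_all _ fun k => hbd z hz k)
  · refine (fourierInv_L2_ae_eq F hF).trans (ae_of_all _ fun x => ?_)
    rw [Real.fourierInv_eq']
    congr 1 with k
    simp only [smul_eq_mul]
    congr 2
    simp
    ring

/-- Every element of `P_α` is the restriction to the real line of a bounded holomorphic function on
a strip: this uses only that `K^{±1}` act on `P_α`. -/
theorem exists_stripBounded_of_mem_P {b : ℝ} (hb : 0 < b) {α : ℂ} {f : L2} (hf : f ∈ P b α) :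
    ∃ B h, StripBounded (b / 4) B h ∧ (f : ℝ → ℂ) =ᵐ[volume] fun x => h x := by
  let N : Submodule ℂ L2 :=
    { carrier := {f | ∃ B h, StripBounded (b / 4) B h ∧ (f : ℝ → ℂ) =ᵐ[volume] fun x => h x}
      add_mem' := by
        rintro f g ⟨B, h, hh, hfh⟩ ⟨B', h', hh', hgh⟩
        refine ⟨B + B', h + h', ⟨hh.1.add hh'.1, fun z hz => (norm_add_le _ _).trans
          (add_le_add (hh.2 z hz) (hh'.2 z hz))⟩, ?_⟩
        filter_upwards [Lp.coeFn_add f g, hfh, hgh] with x h1 h2 h3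
        rw [h1, Pi.add_apply, h2, h3, Pi.add_apply]
      zero_mem' := ⟨0, 0, ⟨differentiableOn_const 0, by simp⟩, by
        filter_upwards [Lp.coeFn_zero ℂ 2 (volume : Measure ℝ)] with x h1
        simp⟩
      smul_mem' := by
        rintro a f ⟨B, h, hh, hfh⟩
        refine ⟨‖a‖ * B, a • h, ⟨hh.1.const_smul a, fun z hz => ?_⟩, ?_⟩
        · rw [Pi.smul_apply, norm_smul]
          exact mul_le_mul_of_nonneg_left (hh.2 z hz) (norm_nonneg _)
        · filter_upwards [Lp.coeFn_smul a f, hfh] with x h1 h2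
          rw [h1, Pi.smul_apply, h2, Pi.smul_apply] }
  have hle : P b α ≤ N := by
    refine sSup_le fun V hV f hf => ?_
    obtain ⟨-, -, ⟨g, -, hg⟩, g', -, hg'⟩ := hV f hf
    -- `K` multiplies the Fourier transform by `exp (-π b k)`, that is, `c' = b / 2`
    have := exists_stripBounded_of_fourier (c := b / 4) (c' := b / 2) (by linarith) (by linarith) (𝓕 f)
      (𝓕 g)
      (𝓕 g') ?_ ?_
    · rwa [FourierTransform.fourierInv_fourier_eq] at this
    · refine hg.trans (ae_of_all _ fun k => ?_)
      simp only
      congr 2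
      push_cast; ring
    · refine hg'.trans (ae_of_all _ fun k => ?_)
      simp only
      congr 2
      push_cast; ring
  exact hle hf

/-! ### Analytic properties of the Clebsch-Gordan kernel -/

/-- Contours can be shifted for a holomorphic function on a horizontal strip that decays
exponentially. -/
theorem integral_add_eq_integral_add {a c C κ : ℝ} (hκ : 0 < κ) {F : ℂ → ℂ}
    (hF : DifferentiableOn ℂ F (hStrip a c))
    (hb : ∀ z ∈ hStrip a c, ‖F z‖ ≤ C * Real.exp (-κ * |z.re|)) {w₁ w₂ : ℂ}
    (h₁ : w₁ ∈ hStrip a c) (h₂ : w₂ ∈ hStrip a c) :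
    ∫ x : ℝ, F (x + w₁) = ∫ x : ℝ, F (x + w₂) := by
  have hadd : ∀ (x : ℝ) (w : ℂ), w ∈ hStrip a c → (x : ℂ) + w ∈ hStrip a c := fun x w hw => by
    simpa [hStrip] using hw
  have hC : 0 ≤ C := by
    have := (norm_nonneg _).trans (hb w₁ h₁)
    exact nonneg_of_mul_nonneg_left this (Real.exp_pos _)
  refine eq_of_translation_invariant (isOpen_hStrip a c) (convex_hStrip a c)
    (Φ := fun w => ∫ x : ℝ, F (x + w)) ?_ ?_ h₁ h₂
  · refine differentiableOn_integral_of_locally_bounded (isOpen_hStrip a c) (fun w hw => ?_)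
      (ae_of_all _ fun x => ?_) fun w₀ hw₀ => ⟨Metric.ball w₀ 1, Metric.ball_mem_nhds _ one_pos,
        fun x => C * Real.exp (κ * (|w₀.re| + 1)) * Real.exp (-κ * |x|),
        (integrable_exp_neg_mul_abs hκ).const_mul _, ae_of_all _ fun x w hw => ?_⟩
    · exact (hF.continuousOn.comp_continuous (by fun_prop) fun x => hadd x w hw).aestronglyMeasurable
    · exact hF.comp (by fun_prop) fun w hw => hadd x w hw
    · refine (hb _ (hadd x w hw.2)).trans ?_
      beta_reduce
      rw [mul_assoc, ← Real.exp_add]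
      refine mul_le_mul_of_nonneg_left (Real.exp_le_exp.2 ?_) hC
      have h3 : |(w - w₀).re| < 1 := (Complex.abs_re_le_norm _).trans_lt (by
        simpa [dist_eq_norm] using Metric.mem_ball.1 hw.1)
      have h4 : |x| ≤ |((x : ℂ) + w).re| + (|(w - w₀).re| + |w₀.re|) := by
        have e : x = ((x : ℂ) + w).re - ((w - w₀).re + w₀.re) := by simp
        calc |x| = |((x : ℂ) + w).re - ((w - w₀).re + w₀.re)| := by rw [← e]
          _ ≤ _ := (abs_sub _ _).trans (add_le_add le_rfl (abs_add_le _ _))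
      nlinarith
  · intro w hw r
    have := integral_add_right_eq_self (μ := volume) (fun x : ℝ => F (x + w)) r
    rw [← this]
    congr 1 with x
    congr 1
    push_cast; ring

/-- The product `S_b(p - iu) S_b(q + iu)`, from which all kernels are built. -/
def dsinePair (b : ℝ) (p q u : ℂ) : ℂ := dsine b (p - Complex.I * u) * dsine b (q + Complex.I * u)

theorem exists_norm_dsinePair_le {b : ℝ} (hb : 0 < b) {x₀ : ℝ} (hx₀ : 0 < x₀) (R : ℝ) :
    ∃ C : ℝ, 0 < C ∧ ∀ p q u : ℂ, x₀ ≤ (p - Complex.I * u).re → (p - Complex.I * u).re ≤ Q b - x₀ →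
      x₀ ≤ (q + Complex.I * u).re → (q + Complex.I * u).re ≤ Q b - x₀ → |p.im| ≤ R → |q.im| ≤ R →
      ‖dsinePair b p q u‖ ≤ C * Real.exp (decayRate * (p.re + q.re - Q b) * |u.re|) := by
  obtain ⟨C, hC, h⟩ := exists_norm_dsine_le_of_im_near hb hx₀ R
  refine ⟨C * C, by positivity, fun p q u h1 h2 h3 h4 h5 h6 => ?_⟩
  have e1 := h (p - Complex.I * u) (-u.re) h1 h2 (by simpa using h5)
  have e2 := h (q + Complex.I * u) u.re h3 h4 (by simpa using h6)
  rw [dsinePair, norm_mul]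
  refine (mul_le_mul e1 e2 (norm_nonneg _) (by positivity)).trans (le_of_eq ?_)
  rw [mul_mul_mul_comm, ← Real.exp_add, abs_neg]
  congr 2
  simp
  ring

/-- The Clebsch-Gordan coefficient in terms of the restriction of `S_b` to the strip. -/
def cgKernel (b : ℝ) (α₃ α₂ α₁ x₃ x₂ x₁ : ℂ) : ℂ :=
  Complex.exp (-(Real.pi * Complex.I * (confDim b α₃ - confDim b α₁ - confDim b α₂) / 2)) *
    dsinePair b (Q b - (α₁ + α₂) / 2 - α₃) (Q b - (α₁ + α₂) / 2) (x₂ - x₁) *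
    dsinePair b ((α₃ - α₂) / 2) (α₁ + (α₃ - α₂) / 2) (x₂ - x₃) *
    dsinePair b ((α₃ - α₁) / 2) (α₂ + (α₃ - α₁) / 2) (x₃ - x₁)

/-- Parameters `α_k` near the line `Re α = Q/2` and positions with `Im x₂ > Im x₃ > Im x₁`, with a
margin `m` from the singularities of the Clebsch-Gordan kernel. -/
structure CGRegion (b m : ℝ) (α₃ α₂ α₁ x₃ x₂ x₁ : ℂ) : Prop where
  re₁ : |α₁.re - Q b / 2| ≤ m / 3
  re₂ : |α₂.re - Q b / 2| ≤ m / 3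
  re₃ : |α₃.re - Q b / 2| ≤ m / 3
  le₂₃ : m ≤ x₂.im - x₃.im
  ge₂₃ : x₂.im - x₃.im ≤ Q b / 8
  le₃₁ : m ≤ x₃.im - x₁.im
  ge₃₁ : x₃.im - x₁.im ≤ Q b / 8

section

variable {b m : ℝ} {α₃ α₂ α₁ x₃ x₂ x₁ : ℂ}

/-- All arguments of `S_b` in the kernel keep the distance `m/3` from the boundary of the strip. -/
theorem CGRegion.margins (h : CGRegion b m α₃ α₂ α₁ x₃ x₂ x₁) (hm : 0 < m) :
    ∀ z ∈ ({Q b - (α₁ + α₂) / 2 - α₃ - Complex.I * (x₂ - x₁),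
      Q b - (α₁ + α₂) / 2 + Complex.I * (x₂ - x₁), (α₃ - α₂) / 2 - Complex.I * (x₂ - x₃),
      α₁ + (α₃ - α₂) / 2 + Complex.I * (x₂ - x₃), (α₃ - α₁) / 2 - Complex.I * (x₃ - x₁),
      α₂ + (α₃ - α₁) / 2 + Complex.I * (x₃ - x₁)} : Set ℂ), m / 3 ≤ z.re ∧ z.re ≤ Q b - m / 3 := by
  obtain ⟨h1, h2, h3, h4, h5, h6, h7⟩ := h
  rw [abs_le] at h1 h2 h3
  have hdiv : ∀ z : ℂ, (z / 2).re = z.re / 2 := fun z => by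
    simp
  intro z hz
  simp only [Set.mem_insert_iff, Set.mem_singleton_iff] at hz
  rcases hz with rfl | rfl | rfl | rfl | rfl | rfl <;>
  · simp only [Complex.sub_re, Complex.add_re, Complex.mul_re, Complex.I_re, Complex.I_im,
      Complex.ofReal_re, hdiv, Complex.sub_im]
    constructor <;> linarith

theorem CGRegion.mem_strip (h : CGRegion b m α₃ α₂ α₁ x₃ x₂ x₁) (hm : 0 < m) :
    ∀ z ∈ ({Q b - (α₁ + α₂) / 2 - α₃ - Complex.I * (x₂ - x₁),
      Q b - (α₁ + α₂) / 2 + Complex.I * (x₂ - x₁), (α₃ - α₂) / 2 - Complex.I * (x₂ - x₃),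
      α₁ + (α₃ - α₂) / 2 + Complex.I * (x₂ - x₃), (α₃ - α₁) / 2 - Complex.I * (x₃ - x₁),
      α₂ + (α₃ - α₁) / 2 + Complex.I * (x₃ - x₁)} : Set ℂ), z ∈ strip b := fun z hz => by
  have := h.margins hm z hz
  exact ⟨by linarith, by linarith⟩

theorem CGRegion.cgAn_eq (h : CGRegion b m α₃ α₂ α₁ x₃ x₂ x₁) (hm : 0 < m) :
    cgAn b α₃ α₂ α₁ x₃ x₂ x₁ = cgKernel b α₃ α₂ α₁ x₃ x₂ x₁ := by
  have hs := h.mem_strip hm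
  rw [ModularDouble.cgAn_eq, cgKernel, Sb_div_Sb_eq (hs _ (by simp)) (hs (Q b - (α₁ + α₂) / 2 +
      Complex.I * (x₂ - x₁)) (by simp)) (by ring), Sb_div_Sb_eq (hs _ (by simp))
      (hs (α₁ + (α₃ - α₂) / 2 + Complex.I * (x₂ - x₃)) (by simp)) (by ring),
    Sb_div_Sb_eq (hs _ (by simp)) (hs (α₂ + (α₃ - α₁) / 2 + Complex.I * (x₃ - x₁)) (by simp))
      (by ring)]
  rfl

/-- A rate at which the Clebsch-Gordan kernel decays exponentially on the regions `CGRegion`. -/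
def cgRate (b : ℝ) : ℝ := decayRate * (Q b / 4)

theorem cgRate_pos (hb : 0 < b) : 0 < cgRate b := by
  have := decayRate_pos
  have := Q_pos hb
  unfold cgRate
  positivity

theorem exists_norm_cgKernel_le (hb : 0 < b) (hm : 0 < m) (R : ℝ) :
    ∃ C : ℝ, 0 < C ∧ ∀ α₃ α₂ α₁ x₃ x₂ x₁ : ℂ, CGRegion b m α₃ α₂ α₁ x₃ x₂ x₁ → |α₁.im| ≤ R →
      |α₂.im| ≤ R → |α₃.im| ≤ R → ‖cgKernel b α₃ α₂ α₁ x₃ x₂ x₁‖ ≤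
        C * (Real.exp (-cgRate b * |x₂.re - x₃.re|) * Real.exp (-cgRate b * |x₃.re - x₁.re|)) := by
  have hQ := Q_pos hb
  have hk := decayRate_pos
  obtain ⟨C, hC, hpair⟩ := exists_norm_dsinePair_le hb (x₀ := m / 3) (by positivity) (2 * R)
  obtain ⟨A, hA⟩ : ∃ A : ℝ, ∀ α₃ α₂ α₁ : ℂ, (|α₁.re - Q b / 2| ≤ Q b ∧ |α₂.re - Q b / 2| ≤ Q b ∧
      |α₃.re - Q b / 2| ≤ Q b) → |α₁.im| ≤ R → |α₂.im| ≤ R → |α₃.im| ≤ R →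
      ‖Complex.exp (-(Real.pi * Complex.I *
        (confDim b α₃ - confDim b α₁ - confDim b α₂) / 2))‖ ≤ Real.exp A := by
    have hconf : ∀ α : ℂ, |α.re - Q b / 2| ≤ Q b → |α.im| ≤ R →
        ‖confDim b α‖ ≤ (2 * Q b + R) * (3 * Q b + R) := by
      intro α h1 h2
      have hR : 0 ≤ R := (abs_nonneg _).trans h2
      rw [abs_le] at h1
      have h3 : ‖α‖ ≤ 2 * Q b + R := (Complex.norm_le_abs_re_add_abs_im α).trans
        (add_le_add (abs_le.2 ⟨by linarith, by linarith⟩) h2)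
      rw [confDim, norm_mul]
      refine mul_le_mul h3 ?_ (norm_nonneg _) (by positivity)
      refine (norm_sub_le _ _).trans ?_
      rw [Complex.norm_real, Real.norm_of_nonneg hQ.le]
      linarith
    refine ⟨Real.pi * (3 * ((2 * Q b + R) * (3 * Q b + R))) / 2, fun α₃ α₂ α₁ h h1 h2 h3 => ?_⟩
    refine (Complex.norm_exp_le_exp_norm _).trans (Real.exp_le_exp.2 ?_)
    rw [norm_neg, norm_div, norm_mul, norm_mul, Complex.norm_I, mul_one, Complex.norm_real,
      Real.norm_of_nonneg Real.pi_pos.le, Complex.norm_two]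
    gcongr
    refine (norm_sub_le _ _).trans ?_
    refine (add_le_add_left (norm_sub_le _ _) _).trans ?_
    linarith [hconf _ h.1 h1, hconf _ h.2.1 h2, hconf _ h.2.2 h3]
  refine ⟨Real.exp A * C * C * C, by positivity, fun α₃ α₂ α₁ x₃ x₂ x₁ hreg h1 h2 h3 => ?_⟩
  have hmar := hreg.margins hm
  obtain ⟨r1, r2, r3, t1, t2, t3, t4⟩ := hreg
  have hmQ : m ≤ Q b / 8 := t1.trans t2
  have hph := hA α₃ α₂ α₁ ⟨by linarith, by linarith, by linarith⟩ h1 h2 h3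
  have hdiv : ∀ z : ℂ, (z / 2).re = z.re / 2 := fun z => by
    simp
  have hdivi : ∀ z : ℂ, (z / 2).im = z.im / 2 := fun z => by
    simp
  rw [abs_le] at h1 h2 h3 r1 r2 r3
  have him : ∀ y : ℝ, -(2 * R) ≤ y → y ≤ 2 * R → |y| ≤ 2 * R := fun y ha hb => abs_le.2 ⟨ha, hb⟩
  have p1 := hpair (Q b - (α₁ + α₂) / 2 - α₃) (Q b - (α₁ + α₂) / 2) (x₂ - x₁)
    (hmar _ (by simp)).1 (hmar _ (by simp)).2 (hmar _ (by simp)).1 (hmar _ (by simp)).2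
    (by apply him <;> simp [hdivi] <;> linarith) (by apply him <;> simp [hdivi] <;> linarith)
  have p2 := hpair ((α₃ - α₂) / 2) (α₁ + (α₃ - α₂) / 2) (x₂ - x₃)
    (hmar _ (by simp)).1 (hmar _ (by simp)).2 (hmar _ (by simp)).1 (hmar _ (by simp)).2
    (by apply him <;> simp [hdivi] <;> linarith) (by apply him <;> simp [hdivi] <;> linarith)
  have p3 := hpair ((α₃ - α₁) / 2) (α₂ + (α₃ - α₁) / 2) (x₃ - x₁)
    (hmar _ (by simp)).1 (hmar _ (by simp)).2 (hmar _ (by simp)).1 (hmar _ (by simp)).2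
    (by apply him <;> simp [hdivi] <;> linarith) (by apply him <;> simp [hdivi] <;> linarith)
  have hexp : ∀ p q u : ℂ, p.re + q.re ≤ Q b - Q b / 4 →
      Real.exp (decayRate * (p.re + q.re - Q b) * |u.re|) ≤ Real.exp (-cgRate b * |u.re|) := by
    intro p q u h
    refine Real.exp_le_exp.2 (mul_le_mul_of_nonneg_right ?_ (abs_nonneg _))
    rw [cgRate, ← mul_neg]
    exact mul_le_mul_of_nonneg_left (by linarith) hk.le
  have q1 : ‖dsinePair b (Q b - (α₁ + α₂) / 2 - α₃) (Q b - (α₁ + α₂) / 2) (x₂ - x₁)‖ ≤ C := by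
    refine p1.trans (mul_le_of_le_one_right hC.le ((hexp _ _ _ ?_).trans ?_))
    · simp [hdiv]; linarith
    · exact Real.exp_le_one_iff.2 (mul_nonpos_of_nonpos_of_nonneg (neg_nonpos.2 (cgRate_pos hb).le)
        (abs_nonneg _))
  have q2 := p2.trans (mul_le_mul_of_nonneg_left (hexp _ _ _ (by simp [hdiv]; linarith)) hC.le)
  have q3 := p3.trans (mul_le_mul_of_nonneg_left (hexp _ _ _ (by simp [hdiv]; linarith)) hC.le)
  rw [Complex.sub_re] at q2 q3
  rw [cgKernel, norm_mul, norm_mul, norm_mul]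
  calc _ ≤ Real.exp A * C * (C * Real.exp (-cgRate b * |x₂.re - x₃.re|)) *
        (C * Real.exp (-cgRate b * |x₃.re - x₁.re|)) := by gcongr
    _ = _ := by ring

/-- The kernel depends continuously on everything. -/
theorem CGRegion.continuousAt {X : Type*} [TopologicalSpace X] (hb : 0 < b) (hm : 0 < m)
    {a₃ a₂ a₁ y₃ y₂ y₁ : X → ℂ} {t : X} (h : CGRegion b m (a₃ t) (a₂ t) (a₁ t) (y₃ t) (y₂ t) (y₁ t))
    (ha₃ : ContinuousAt a₃ t) (ha₂ : ContinuousAt a₂ t) (ha₁ : ContinuousAt a₁ t)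
    (hy₃ : ContinuousAt y₃ t) (hy₂ : ContinuousAt y₂ t) (hy₁ : ContinuousAt y₁ t) :
    ContinuousAt (fun t => cgKernel b (a₃ t) (a₂ t) (a₁ t) (y₃ t) (y₂ t) (y₁ t)) t := by
  have hs := h.mem_strip hm
  have hd : ∀ f : X → ℂ, ContinuousAt f t → f t ∈ strip b →
      ContinuousAt (fun t => dsine b (f t)) t := fun f hf hft =>
    ContinuousAt.comp (g := dsine b) (differentiableAt_dsine hb hft).continuousAt hf
  unfold cgKernel dsinePair confDim
  refine ContinuousAt.mul (ContinuousAt.mul (ContinuousAt.mul (by fun_prop) (ContinuousAt.mul ?_ ?_))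
    (ContinuousAt.mul ?_ ?_)) (ContinuousAt.mul ?_ ?_) <;>
  exact hd _ (by fun_prop) (hs _ (by simp))

/-- The kernel is holomorphic in everything. -/
theorem CGRegion.differentiableAt (hb : 0 < b) (hm : 0 < m)
    {a₃ a₂ a₁ y₃ y₂ y₁ : ℂ → ℂ} {t : ℂ} (h : CGRegion b m (a₃ t) (a₂ t) (a₁ t) (y₃ t) (y₂ t) (y₁ t))
    (ha₃ : DifferentiableAt ℂ a₃ t) (ha₂ : DifferentiableAt ℂ a₂ t) (ha₁ : DifferentiableAt ℂ a₁ t)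
    (hy₃ : DifferentiableAt ℂ y₃ t) (hy₂ : DifferentiableAt ℂ y₂ t)
    (hy₁ : DifferentiableAt ℂ y₁ t) :
    DifferentiableAt ℂ (fun t => cgKernel b (a₃ t) (a₂ t) (a₁ t) (y₃ t) (y₂ t) (y₁ t)) t := by
  have hs := h.mem_strip hm
  have hd : ∀ f : ℂ → ℂ, DifferentiableAt ℂ f t → f t ∈ strip b →
      DifferentiableAt ℂ (fun t => dsine b (f t)) t := fun f hf hft =>
    DifferentiableAt.fun_comp' t (g := dsine b) (differentiableAt_dsine hb hft) hf
  unfold cgKernel dsinePair confDim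
  refine DifferentiableAt.mul (DifferentiableAt.mul (DifferentiableAt.mul (by fun_prop)
    (DifferentiableAt.mul ?_ ?_)) (DifferentiableAt.mul ?_ ?_)) (DifferentiableAt.mul ?_ ?_) <;>
  exact hd _ (by fun_prop) (hs _ (by simp))

end

theorem integrable_cgWeight {κ : ℝ} (hκ : 0 < κ) (r : ℝ) : Integrable fun x : ℝ × ℝ =>
    Real.exp (-κ * |x.1 - r|) * Real.exp (-κ * |r - x.2|) := by
  have h := integrable_exp_neg_mul_abs hκ
  exact (h.comp_sub_right r).mul_prod (h.comp_sub_left r)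

theorem integral_cgWeight (κ r : ℝ) : ∫ x : ℝ × ℝ,
    Real.exp (-κ * |x.1 - r|) * Real.exp (-κ * |r - x.2|) =
      (∫ x : ℝ, Real.exp (-κ * |x|)) ^ 2 := by
  rw [Measure.volume_eq_prod, integral_prod_mul (fun x : ℝ => Real.exp (-κ * |x - r|))
    (fun x : ℝ => Real.exp (-κ * |r - x|)),
    integral_sub_right_eq_self (fun x : ℝ => Real.exp (-κ * |x|)) r,
    integral_sub_left_eq_self (fun x : ℝ => Real.exp (-κ * |x|)) volume r, sq]

variable {b m : ℝ} {α₃ α₂ α₁ x₃ x₂ x₁ : ℂ}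

/-- The region of the kernel in `cgReg`. -/
theorem cgRegion_of_re_eq {z : ℂ} {d : ℝ} (h₁ : |α₁.re - Q b / 2| ≤ m / 3)
    (h₂ : |α₂.re - Q b / 2| ≤ m / 3) (h₃ : |α₃.re - Q b / 2| ≤ m / 3) (hl : m + |z.im| ≤ d)
    (hu : d + |z.im| ≤ Q b / 8) (s t : ℝ) :
    CGRegion b m α₃ α₂ α₁ z (s + Complex.I * d) (t - Complex.I * d) := by
  have ha := neg_abs_le z.im
  have hb := le_abs_self z.im
  exact ⟨h₁, h₂, h₃, by simp; linarith, by simp; linarith, by simp; linarith, by simp; linarith⟩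

theorem aestronglyMeasurable_cgKernel (hb : 0 < b) (hm : 0 < m) {z : ℂ} {w₁ w₂ : ℂ}
    (hreg : ∀ s t : ℝ, CGRegion b m α₃ α₂ α₁ z (s + w₁) (t - w₂)) :
    AEStronglyMeasurable (fun x : ℝ × ℝ => cgKernel b α₃ α₂ α₁ z (x.1 + w₁) (x.2 - w₂))
      volume := by
  refine Continuous.aestronglyMeasurable (continuous_iff_continuousAt.2 fun x => ?_)
  exact (hreg x.1 x.2).continuousAt (X := ℝ × ℝ) (a₃ := fun _ => α₃) (a₂ := fun _ => α₂)
    (a₁ := fun _ => α₁) (y₃ := fun _ => z) (y₂ := fun x => (x.1 : ℂ) + w₁)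
    (y₁ := fun x => (x.2 : ℂ) - w₂) hb hm (by fun_prop) (by fun_prop) (by fun_prop) (by fun_prop)
    (by fun_prop) (by fun_prop)

/-- The Clebsch-Gordan integral against a bounded function converges absolutely, with a bound that
is uniform in the parameters. -/
theorem exists_cgKernel_integral_bound (hb : 0 < b) (hm : 0 < m) (R : ℝ) :
    ∃ C : ℝ, 0 < C ∧ ∀ (α₃ α₂ α₁ z : ℂ) (d : ℝ),
      (∀ s t : ℝ, CGRegion b m α₃ α₂ α₁ z (s + Complex.I * d) (t - Complex.I * d)) →
      |α₁.im| ≤ R → |α₂.im| ≤ R → |α₃.im| ≤ R → ∀ (ψ : ℝ × ℝ → ℂ) (B : ℝ),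
      AEStronglyMeasurable ψ volume → (∀ᵐ x, ‖ψ x‖ ≤ B) →
      Integrable (fun x : ℝ × ℝ =>
        cgKernel b α₃ α₂ α₁ z (x.1 + Complex.I * d) (x.2 - Complex.I * d) * ψ x) ∧
      ‖∫ x : ℝ × ℝ, cgKernel b α₃ α₂ α₁ z (x.1 + Complex.I * d) (x.2 - Complex.I * d) * ψ x‖
        ≤ C * B := by
  obtain ⟨C, hC, h⟩ := exists_norm_cgKernel_le hb hm R
  have hκ := cgRate_pos hb
  set W := (∫ x : ℝ, Real.exp (-cgRate b * |x|)) ^ 2 with hW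
  refine ⟨C * (W + 1), by positivity, fun α₃ α₂ α₁ z d hreg h1 h2 h3 ψ B hψ hB => ?_⟩
  have hB0 : 0 ≤ B := by
    obtain ⟨x, hx⟩ := hB.exists
    exact (norm_nonneg _).trans hx
  have hint : Integrable fun x : ℝ × ℝ => C * B * (Real.exp (-cgRate b * |x.1 - z.re|) *
      Real.exp (-cgRate b * |z.re - x.2|)) := (integrable_cgWeight hκ z.re).const_mul _
  have hbd : ∀ᵐ x : ℝ × ℝ, ‖cgKernel b α₃ α₂ α₁ z (x.1 + Complex.I * d) (x.2 - Complex.I * d) *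
      ψ x‖ ≤ C * B * (Real.exp (-cgRate b * |x.1 - z.re|) *
      Real.exp (-cgRate b * |z.re - x.2|)) := by
    filter_upwards [hB] with x hx
    have h4 := h _ _ _ _ _ _ (hreg x.1 x.2) h1 h2 h3
    rw [norm_mul]
    refine (mul_le_mul h4 hx (norm_nonneg _) (by positivity)).trans (le_of_eq ?_)
    simp
    ring
  refine ⟨hint.mono' ((aestronglyMeasurable_cgKernel hb hm hreg).mul hψ) hbd, ?_⟩
  refine (norm_integral_le_of_norm_le hint hbd).trans ?_
  rw [integral_const_mul, integral_cgWeight, ← hW]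
  nlinarith [mul_nonneg hC.le hB0]

/-- Continuity of the Clebsch-Gordan integral in the parameters and in the test function. -/
theorem tendsto_cgKernel_integral (hb : 0 < b) (hm : 0 < m) {ι : Type*} {l : Filter ι}
    [l.IsCountablyGenerated] {a₃ a₂ a₁ : ι → ℂ} (h₃ : Tendsto a₃ l (𝓝 α₃))
    (h₂ : Tendsto a₂ l (𝓝 α₂)) (h₁ : Tendsto a₁ l (𝓝 α₁)) {z : ℂ} {d : ℝ}
    (hreg : ∀ᶠ i in l, ∀ s t : ℝ,
      CGRegion b m (a₃ i) (a₂ i) (a₁ i) z (s + Complex.I * d) (t - Complex.I * d))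
    (hreg₀ : ∀ s t : ℝ, CGRegion b m α₃ α₂ α₁ z (s + Complex.I * d) (t - Complex.I * d))
    {ψ : ι → ℝ × ℝ → ℂ} {ψ₀ : ℝ × ℝ → ℂ} {B : ℝ}
    (hψm : ∀ᶠ i in l, AEStronglyMeasurable (ψ i) volume) (hψB : ∀ᶠ i in l, ∀ᵐ x, ‖ψ i x‖ ≤ B)
    (hψ : ∀ᵐ x, Tendsto (fun i => ψ i x) l (𝓝 (ψ₀ x))) :
    Tendsto (fun i => ∫ x : ℝ × ℝ,
      cgKernel b (a₃ i) (a₂ i) (a₁ i) z (x.1 + Complex.I * d) (x.2 - Complex.I * d) * ψ i x) l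
      (𝓝 (∫ x : ℝ × ℝ,
        cgKernel b α₃ α₂ α₁ z (x.1 + Complex.I * d) (x.2 - Complex.I * d) * ψ₀ x)) := by
  have him : ∀ {a : ι → ℂ} {A : ℂ}, Tendsto a l (𝓝 A) → ∀ᶠ i in l, |(a i).im| < |A.im| + 1 :=
    fun ha => ((Complex.continuous_im.tendsto _).comp ha).abs.eventually_lt_const (by simp)
  set R := |α₁.im| + |α₂.im| + |α₃.im| + 1 with hR
  have n1 := abs_nonneg α₁.im
  have n2 := abs_nonneg α₂.im
  have n3 := abs_nonneg α₃.im
  obtain ⟨C, hC, h⟩ := exists_norm_cgKernel_le hb hm R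
  refine tendsto_integral_filter_of_dominated_convergence (fun x => C * B *
    (Real.exp (-cgRate b * |x.1 - z.re|) * Real.exp (-cgRate b * |z.re - x.2|))) ?_ ?_
    ((integrable_cgWeight (cgRate_pos hb) z.re).const_mul _) ?_
  · filter_upwards [hreg, hψm] with i hi hm'
    exact (aestronglyMeasurable_cgKernel hb hm hi).mul hm'
  · filter_upwards [hreg, hψB, him h₁, him h₂, him h₃] with i hi hBi h1 h2 h3
    filter_upwards [hBi] with x hx
    have h4 := h _ _ _ _ _ _ (hi x.1 x.2) (by linarith) (by linarith) (by linarith)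
    rw [norm_mul]
    refine (mul_le_mul h4 hx (norm_nonneg _) (by positivity)).trans (le_of_eq ?_)
    simp
    ring
  · filter_upwards [hψ] with x hx
    refine Tendsto.mul ?_ hx
    have hc : ContinuousAt (fun p : ℂ × ℂ × ℂ => cgKernel b p.1 p.2.1 p.2.2 z
        (x.1 + Complex.I * d) (x.2 - Complex.I * d)) (α₃, α₂, α₁) :=
      CGRegion.continuousAt (X := ℂ × ℂ × ℂ) (t := (α₃, α₂, α₁)) (a₃ := fun p => p.1)
        (a₂ := fun p => p.2.1) (a₁ := fun p => p.2.2) (y₃ := fun _ => z)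
        (y₂ := fun _ => (x.1 : ℂ) + Complex.I * d) (y₁ := fun _ => (x.2 : ℂ) - Complex.I * d)
        hb hm (hreg₀ x.1 x.2) (by fun_prop) (by fun_prop) (by fun_prop) (by fun_prop)
        (by fun_prop) (by fun_prop)
    have hp : Tendsto (fun i => (a₃ i, a₂ i, a₁ i)) l (𝓝 (α₃, α₂, α₁)) :=
      h₃.prodMk_nhds (h₂.prodMk_nhds h₁)
    have := Tendsto.comp (f := fun i => (a₃ i, a₂ i, a₁ i)) hc.tendsto hp
    exact this

/-- The Clebsch-Gordan integral is a holomorphic function of `x₃` near the real line. -/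
theorem differentiableOn_cgKernel_integral (hb : 0 < b) {d : ℝ} (hd : 0 < d) (hdQ : 3 * d ≤ Q b / 4)
    (h₁ : |α₁.re - Q b / 2| ≤ d / 6) (h₂ : |α₂.re - Q b / 2| ≤ d / 6)
    (h₃ : |α₃.re - Q b / 2| ≤ d / 6) {ψ : ℝ × ℝ → ℂ} {B : ℝ} (hψ : AEStronglyMeasurable ψ volume)
    (hB : ∀ᵐ x, ‖ψ x‖ ≤ B) :
    DifferentiableOn ℂ (fun z => ∫ x : ℝ × ℝ,
      cgKernel b α₃ α₂ α₁ z (x.1 + Complex.I * d) (x.2 - Complex.I * d) * ψ x)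
      (hStrip (-(d / 2)) (d / 2)) := by
  have hreg : ∀ z ∈ hStrip (-(d / 2)) (d / 2), ∀ s t : ℝ,
      CGRegion b (d / 2) α₃ α₂ α₁ z (s + Complex.I * d) (t - Complex.I * d) := by
    intro z hz
    have habs : |z.im| ≤ d / 2 := abs_le.2 ⟨hz.1.le, hz.2.le⟩
    exact cgRegion_of_re_eq (by linarith) (by linarith) (by linarith) (by linarith) (by linarith)
  have hm : 0 < d / 2 := half_pos hd
  obtain ⟨C, hC, h⟩ := exists_norm_cgKernel_le hb hm (|α₁.im| + |α₂.im| + |α₃.im|)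
  have n1 := abs_nonneg α₁.im
  have n2 := abs_nonneg α₂.im
  have n3 := abs_nonneg α₃.im
  have hκ := cgRate_pos hb
  refine differentiableOn_integral_of_locally_bounded (isOpen_hStrip _ _) (fun z hz =>
    (aestronglyMeasurable_cgKernel hb hm (hreg z hz)).mul hψ) (ae_of_all _ fun x z hz => ?_)
    fun z₀ hz₀ => ⟨Metric.ball z₀ 1, Metric.ball_mem_nhds _ one_pos, fun x =>
      C * B * Real.exp (2 * cgRate b) * (Real.exp (-cgRate b * |x.1 - z₀.re|) *
        Real.exp (-cgRate b * |z₀.re - x.2|)), (integrable_cgWeight hκ z₀.re).const_mul _, ?_⟩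
  · refine (DifferentiableAt.mul_const ?_ _).differentiableWithinAt
    exact (hreg z hz x.1 x.2).differentiableAt (t := z) (a₃ := fun _ => α₃) (a₂ := fun _ => α₂)
      (a₁ := fun _ => α₁) (y₃ := fun z => z) (y₂ := fun _ => (x.1 : ℂ) + Complex.I * d)
      (y₁ := fun _ => (x.2 : ℂ) - Complex.I * d) hb hm (by fun_prop) (by fun_prop) (by fun_prop)
      (by fun_prop) (by fun_prop) (by fun_prop)
  · filter_upwards [hB] with x hx z hz
    have h4 := h _ _ _ _ _ _ (hreg z hz.2 x.1 x.2) (by linarith) (by linarith) (by linarith)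
    have hB0 : 0 ≤ B := (norm_nonneg _).trans hx
    rw [norm_mul]
    refine (mul_le_mul h4 hx (norm_nonneg _) (by positivity)).trans ?_
    have h5 : |z.re - z₀.re| ≤ 1 := by
      rw [← Complex.sub_re]
      exact (Complex.abs_re_le_norm _).trans (by
        simpa [dist_eq_norm] using (Metric.mem_ball.1 hz.1).le)
    rw [abs_le] at h5
    have e1 : |x.1 - z₀.re| - 1 ≤ |((x.1 : ℂ) + Complex.I * d).re - z.re| := by
      have : ((x.1 : ℂ) + Complex.I * d).re = x.1 := by simp
      rw [this]
      have := abs_sub_abs_le_abs_sub (x.1 - z₀.re) (x.1 - z.re)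
      have h6 : |x.1 - z₀.re - (x.1 - z.re)| ≤ 1 := abs_le.2 ⟨by linarith, by linarith⟩
      linarith
    have e2 : |z₀.re - x.2| - 1 ≤ |z.re - ((x.2 : ℂ) - Complex.I * d).re| := by
      have : ((x.2 : ℂ) - Complex.I * d).re = x.2 := by simp
      rw [this]
      have := abs_sub_abs_le_abs_sub (z₀.re - x.2) (z.re - x.2)
      have h6 : |z₀.re - x.2 - (z.re - x.2)| ≤ 1 := abs_le.2 ⟨by linarith, by linarith⟩
      linarith
    rw [mul_right_comm, mul_assoc (C * B) (Real.exp (2 * cgRate b)), ← Real.exp_add,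
      ← Real.exp_add, ← Real.exp_add]
    refine mul_le_mul_of_nonneg_left (Real.exp_le_exp.2 ?_) (by positivity)
    nlinarith

/-- Shifting the contours in the regularized Clebsch-Gordan integral. -/
theorem cgKernel_integral_shift (hb : 0 < b) (h₁ : α₁.re = Q b / 2) (h₂ : α₂.re = Q b / 2)
    (h₃ : α₃.re = Q b / 2) {c B : ℝ} {f g : ℂ → ℂ} (hf : StripBounded c B f)
    (hg : StripBounded c B g) {e d : ℝ} (he : 0 < e) (hed : e ≤ d) (hdc : d < c)
    (hdQ : d < Q b / 8) (r : ℝ) :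
    ∫ x : ℝ × ℝ, cgKernel b α₃ α₂ α₁ r (x.1 + Complex.I * e) (x.2 - Complex.I * e) *
        (f x.1 * g x.2) =
      ∫ x : ℝ × ℝ, cgKernel b α₃ α₂ α₁ r (x.1 + Complex.I * d) (x.2 - Complex.I * d) *
        (f (x.1 + Complex.I * ((d - e : ℝ) : ℂ)) * g (x.2 - Complex.I * ((d - e : ℝ) : ℂ))) := by
  set U := hStrip (e / 2) (min c (Q b / 8)) with hU
  set F : ℂ → ℝ × ℝ → ℂ := fun w x => cgKernel b α₃ α₂ α₁ r (x.1 + w) (x.2 - w) *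
    (f (x.1 + w - Complex.I * e) * g (x.2 - w + Complex.I * e)) with hF
  have hm : 0 < e / 2 := half_pos he
  have hκ := cgRate_pos hb
  have habs : ∀ {a : ℂ}, a.re = Q b / 2 → |a.re - Q b / 2| ≤ e / 2 / 3 := fun ha => by
    rw [ha, sub_self, abs_zero]; positivity
  have hreg : ∀ w ∈ U, ∀ s t : ℝ, CGRegion b (e / 2) α₃ α₂ α₁ r (s + w) (t - w) := by
    intro w hw s t
    have hw1 := hw.1
    have hw2 : w.im < Q b / 8 := hw.2.trans_le (min_le_right _ _)
    refine ⟨habs h₁, habs h₂, habs h₃, ?_, ?_, ?_, ?_⟩ <;> simp <;> linarith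
  have hsf : ∀ w ∈ U, ∀ s : ℝ, (s : ℂ) + w - Complex.I * e ∈ hStrip (-c) c ∧
      (s : ℂ) - w + Complex.I * e ∈ hStrip (-c) c := by
    intro w hw s
    have hw1 := hw.1
    have hw2 : w.im < c := hw.2.trans_le (min_le_left _ _)
    refine ⟨⟨?_, ?_⟩, ?_, ?_⟩ <;> simp <;> linarith
  have hUo : IsOpen U := isOpen_hStrip _ _
  obtain ⟨C, hC, h⟩ := exists_norm_cgKernel_le hb hm (|α₁.im| + |α₂.im| + |α₃.im|)
  have n1 := abs_nonneg α₁.im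
  have n2 := abs_nonneg α₂.im
  have n3 := abs_nonneg α₃.im
  have hdiff : DifferentiableOn ℂ (fun w => ∫ x, F w x) U := by
    refine differentiableOn_integral_of_locally_bounded hUo (fun w hw => ?_)
      (ae_of_all _ fun x w hw => ?_) fun w₀ hw₀ => ⟨Metric.ball w₀ 1,
        Metric.ball_mem_nhds _ one_pos, fun x =>
        C * (B * B) * Real.exp (2 * cgRate b * (|w₀.re| + 1)) *
        (Real.exp (-cgRate b * |x.1 - r|) * Real.exp (-cgRate b * |r - x.2|)),
        (integrable_cgWeight hκ r).const_mul _, ae_of_all _ fun x w hw => ?_⟩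
    · refine (aestronglyMeasurable_cgKernel hb hm (hreg w hw)).mul
        (Continuous.aestronglyMeasurable (Continuous.mul ?_ ?_))
      · exact hf.1.continuousOn.comp_continuous (by fun_prop) fun x => (hsf w hw x.1).1
      · exact hg.1.continuousOn.comp_continuous (by fun_prop) fun x => (hsf w hw x.2).2
    · refine DifferentiableAt.differentiableWithinAt (DifferentiableAt.mul ?_
        (DifferentiableAt.mul ?_ ?_))
      · exact (hreg w hw x.1 x.2).differentiableAt (t := w) (a₃ := fun _ => α₃) (a₂ := fun _ => α₂)
          (a₁ := fun _ => α₁) (y₃ := fun z => r) (y₂ := fun w => (x.1 : ℂ) + w)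
          (y₁ := fun w => (x.2 : ℂ) - w) hb hm (by fun_prop) (by fun_prop) (by fun_prop)
          (by fun_prop) (by fun_prop) (by fun_prop)
      · exact DifferentiableAt.fun_comp' w (g := f) (hf.1.differentiableAt
          ((isOpen_hStrip _ _).mem_nhds (hsf w hw x.1).1)) (by fun_prop)
      · exact DifferentiableAt.fun_comp' w (g := g) (hg.1.differentiableAt
          ((isOpen_hStrip _ _).mem_nhds (hsf w hw x.2).2)) (by fun_prop)
    · have h4 := h _ _ _ _ _ _ (hreg w hw.2 x.1 x.2) (by linarith) (by linarith) (by linarith)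
      have h5 := hf.2 _ (hsf w hw.2 x.1).1
      have h6 := hg.2 _ (hsf w hw.2 x.2).2
      have hB0 : 0 ≤ B := (norm_nonneg _).trans h5
      have h7 : |w.re| ≤ |w₀.re| + 1 := by
        have h8 : |w.re - w₀.re| ≤ 1 := by
          rw [← Complex.sub_re]
          exact (Complex.abs_re_le_norm _).trans (by
            simpa [dist_eq_norm] using (Metric.mem_ball.1 hw.1).le)
        have := abs_sub_abs_le_abs_sub w.re w₀.re
        linarith
      have e1 : |x.1 - r| - |w.re| ≤ |((x.1 : ℂ) + w).re - (r : ℂ).re| := by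
        have := abs_sub_abs_le_abs_sub (x.1 - r) (-w.re)
        rw [abs_neg] at this
        refine this.trans (le_of_eq ?_)
        simp only [Complex.add_re, Complex.ofReal_re]
        congr 1; ring
      have e2 : |r - x.2| - |w.re| ≤ |(r : ℂ).re - ((x.2 : ℂ) - w).re| := by
        have := abs_sub_abs_le_abs_sub (r - x.2) (-w.re)
        rw [abs_neg] at this
        refine this.trans (le_of_eq ?_)
        simp only [Complex.sub_re, Complex.ofReal_re]
        congr 1; ring
      simp only [hF]
      rw [norm_mul, norm_mul]
      refine (mul_le_mul h4 (mul_le_mul h5 h6 (norm_nonneg _) hB0) (by positivity)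
        (by positivity)).trans ?_
      rw [mul_right_comm, mul_assoc (C * (B * B)) (Real.exp (2 * cgRate b * (|w₀.re| + 1))),
        ← Real.exp_add, ← Real.exp_add, ← Real.exp_add]
      refine mul_le_mul_of_nonneg_left (Real.exp_le_exp.2 ?_) (by positivity)
      nlinarith
  have hinv : ∀ w ∈ U, ∀ s : ℝ, ∫ x, F (w + s) x = ∫ x, F w x := by
    intro w _ s
    rw [← integral_add_right_eq_self (μ := (volume : Measure (ℝ × ℝ))) (F w) (s, -s)]
    congr 1 with x
    simp only [hF, Prod.fst_add, Prod.snd_add]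
    push_cast
    rw [show (x.1 : ℂ) + s + w = x.1 + (w + s) by ring,
      show (x.2 : ℂ) + -s - w = x.2 - (w + s) by ring]
  have hmemU : ∀ t : ℝ, e ≤ t → t ≤ d → Complex.I * t ∈ U := by
    intro t h1 h2
    refine ⟨?_, ?_⟩
    · simp; linarith
    · simp; exact ⟨by linarith, by linarith⟩
  have hmain := eq_of_translation_invariant hUo (convex_hStrip _ _) hdiff hinv
    (hmemU e le_rfl hed) (hmemU d hed le_rfl)
  simp only [hF] at hmain
  convert hmain using 4 with x x
  · congr 1 <;> congr 1 <;> ring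
  · congr 1 <;> congr 1 <;> push_cast <;> ring

/-! ### The kernel of the reflection operators -/

theorem norm_cos_div_sin_le {z : ℂ} (h0 : Real.sin z.re ≠ 0) :
    ‖Complex.cos z / Complex.sin z‖ ≤ |Real.sin z.re|⁻¹ := by
  have hs : |Real.sin z.re| * Real.cosh z.im ≤ ‖Complex.sin z‖ := by
    have h1 := Complex.abs_re_le_norm (Complex.sin z)
    have h2 : (Complex.sin z).re = Real.sin z.re * Real.cosh z.im := by
      rw [Complex.sin_eq]
      simp [← Complex.ofReal_sin, ← Complex.ofReal_cos, ← Complex.ofReal_cosh,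
        ← Complex.ofReal_sinh]
    rwa [h2, abs_mul, abs_of_pos (Real.cosh_pos _)] at h1
  have hc : ‖Complex.cos z‖ ≤ Real.cosh z.im := by
    rw [Complex.cos, norm_div, Complex.norm_two, Real.cosh_eq]
    gcongr
    refine (norm_add_le _ _).trans (le_of_eq ?_)
    rw [Complex.norm_exp, Complex.norm_exp]
    simp [add_comm]
  rw [norm_div]
  have := abs_pos.2 h0
  have hch := Real.cosh_pos z.im
  calc _ ≤ Real.cosh z.im / (|Real.sin z.re| * Real.cosh z.im) := by gcongr
    _ = _ := by field_simp

/-- One half of the kernel of the reflection operator, with poles in the lower half plane only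
(near the real line): `D_{-iα}` with `α = Q/2 - a`, divided by `S_b(2a)`, is the sum of two such
terms, see `dsinePair_div_eq`. The parameter `p` is one of `b`, `b⁻¹`. -/
def reflKernel (p : ℝ) (a u : ℂ) : ℂ :=
  dsinePair p (a + p) (a + p) u / (2 * dsine p (2 * a + p)) *
    (Complex.cos (Real.pi * p * (a - Complex.I * u)) /
      Complex.sin (Real.pi * p * (a - Complex.I * u)))

/-- Partial fractions: after the functional equation the singular factor of the kernel is
`sin (A + B) / (sin A sin B) = cot A + cot B`. -/
theorem dsinePair_div_eq {p : ℝ} (hp : 0 < p) {a : ℂ} (h0 : 0 < a.re) (h1 : 2 * a.re < p⁻¹)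
    (u : ℝ) : dsinePair p a a u / dsine p (2 * a) = reflKernel p a u + reflKernel p a (-u) := by
  have e1 := dsine_add hp (z := a - Complex.I * u) (by simpa using h0) (by simp; linarith)
  have e2 := dsine_add hp (z := a + Complex.I * u) (by simpa using h0) (by simp; linarith)
  have e3 := dsine_add hp (z := 2 * a) (by simpa using h0) (by simpa using h1)
  have n1 := dsine_ne_zero p (a - Complex.I * u + p)
  have n2 := dsine_ne_zero p (a + Complex.I * u + p)
  have n3 := dsine_ne_zero p (2 * a + p)
  have e4 : Complex.sin (Real.pi * p * (2 * a)) =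
      Complex.sin (Real.pi * p * (a - Complex.I * u)) *
        Complex.cos (Real.pi * p * (a + Complex.I * u)) +
      Complex.cos (Real.pi * p * (a - Complex.I * u)) *
        Complex.sin (Real.pi * p * (a + Complex.I * u)) := by
    rw [← Complex.sin_add]; congr 1; ring
  simp only [reflKernel, dsinePair, mul_neg, sub_neg_eq_add, ← sub_eq_add_neg]
  rw [show a + p - Complex.I * u = a - Complex.I * u + p by ring,
    show a + p + Complex.I * u = a + Complex.I * u + p by ring]
  rw [e1, e2, e3] at *
  have m1 := left_ne_zero_of_mul n1
  have m2 := left_ne_zero_of_mul n2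
  have m3 := left_ne_zero_of_mul n3
  have k1 := right_ne_zero_of_mul m1
  have k2 := right_ne_zero_of_mul m2
  have k3 := right_ne_zero_of_mul m3
  have l3 := right_ne_zero_of_mul n3
  generalize Complex.sin (Real.pi * p * (2 * a)) = T at *
  generalize Complex.sin (Real.pi * p * (a - Complex.I * u)) = s1 at *
  generalize Complex.sin (Real.pi * p * (a + Complex.I * u)) = s2 at *
  generalize Complex.cos (Real.pi * p * (a - Complex.I * u)) = c1 at *
  generalize Complex.cos (Real.pi * p * (a + Complex.I * u)) = c2 at *
  field_simp
  rw [e4]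
  ring

/-- The margin available in contour shifts of `reflKernel`. It is positive if `p < Q/2`, that is, if
`p < 1`. -/
def reflMargin (p : ℝ) : ℝ := min p (Q p - 2 * p) / 8

section

variable {p : ℝ}

theorem reflMargin_pos (hp : 0 < p) (hpQ : 2 * p < Q p) : 0 < reflMargin p := by
  have : 0 < Q p - 2 * p := by linarith
  unfold reflMargin
  positivity

theorem reflMargin_le (p : ℝ) : 8 * reflMargin p ≤ p ∧ 8 * reflMargin p ≤ Q p - 2 * p := by
  unfold reflMargin
  constructor
  · linarith [min_le_left p (Q p - 2 * p)]
  · linarith [min_le_right p (Q p - 2 * p)]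

theorem mul_reflMargin_le (hp : 0 < p) : p * (2 * reflMargin p) ≤ 1 / 4 := by
  have h := (reflMargin_le p).2
  have h1 : p * Q p = p ^ 2 + 1 := by
    rw [Q]; field_simp
  nlinarith

theorem reflKernel_mem_strip (hp : 0 < p) (hpQ : 2 * p < Q p) {a u : ℂ} (h0 : 0 ≤ a.re)
    (h1 : a.re ≤ reflMargin p) (hu : |u.im| ≤ reflMargin p) :
    ∀ z ∈ ({a + p - Complex.I * u, a + p + Complex.I * u, 2 * a + p, Q p - (2 * a + p)} : Set ℂ),
      reflMargin p ≤ z.re ∧ z.re ≤ Q p - reflMargin p := by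
  have hr := reflMargin_pos hp hpQ
  obtain ⟨h2, h3⟩ := reflMargin_le p
  rw [abs_le] at hu
  intro z hz
  simp only [Set.mem_insert_iff, Set.mem_singleton_iff] at hz
  rcases hz with rfl | rfl | rfl | rfl <;> simp <;> constructor <;> linarith

theorem sin_mul_pos (hp : 0 < p) {t₀ : ℝ} (ht₀ : 0 < t₀) {t : ℝ} (h1 : t₀ ≤ t)
    (h2 : t ≤ 2 * reflMargin p) :
    0 < Real.sin (Real.pi * p * t₀) ∧ Real.sin (Real.pi * p * t₀) ≤ Real.sin (Real.pi * p * t) := by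
  have hpi := Real.pi_pos
  have h3 := mul_reflMargin_le hp
  have h4 : Real.pi * p * t ≤ Real.pi / 4 := by
    have : p * t ≤ 1 / 4 := le_trans (by gcongr) h3
    nlinarith
  have h5 : Real.pi * p * t₀ ≤ Real.pi * p * t := by gcongr
  have h6 : 0 < Real.pi * p * t₀ := by positivity
  exact ⟨Real.sin_pos_of_pos_of_lt_pi h6 (by linarith),
    Real.sin_le_sin_of_le_of_le_pi_div_two (by linarith) (by linarith) h5⟩

/-- A bound for `reflKernel` that is uniform down to `Re a = 0`, at height `t₀` above its pole. -/
theorem exists_norm_reflKernel_le (hp : 0 < p) (hpQ : 2 * p < Q p) {t₀ : ℝ} (ht₀ : 0 < t₀)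
    (s : ℝ) : ∃ C > 0, ∀ a u : ℂ, a.im = s → 0 ≤ a.re → a.re ≤ reflMargin p →
      |u.im| ≤ reflMargin p → t₀ ≤ a.re + u.im →
      ‖reflKernel p a u‖ ≤ C * Real.exp (-(decayRate * (6 * reflMargin p)) * |u.re|) := by
  have hr := reflMargin_pos hp hpQ
  have hk := decayRate_pos
  obtain ⟨C₁, hC₁, h₁⟩ := exists_norm_dsinePair_le hp hr |s|
  obtain ⟨C₂, hC₂, h₂⟩ := exists_norm_dsine_le_of_im_near hp hr (2 * |s|)
  by_cases ht : t₀ ≤ 2 * reflMargin p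
  swap
  · refine ⟨1, one_pos, fun a u _ _ h1 h2 h3 => absurd h3 ?_⟩
    have := (abs_le.1 h2).2
    linarith
  have hsin₀ := (sin_mul_pos hp ht₀ le_rfl ht).1
  refine ⟨C₁ * C₂ * (Real.sin (Real.pi * p * t₀))⁻¹, by positivity, fun a u hs h0 h1 hu hau => ?_⟩
  have hmar := reflKernel_mem_strip hp hpQ h0 h1 hu
  have hu' := abs_le.1 hu
  have e1 := h₁ (a + p) (a + p) u (hmar _ (by simp)).1 (hmar _ (by simp)).2 (hmar _ (by simp)).1
    (hmar _ (by simp)).2 (by simp [hs]) (by simp [hs])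
  have e2 := h₂ (Q p - (2 * a + p)) 0 (hmar _ (by simp)).1 (hmar _ (by simp)).2
    (by simp [hs, abs_mul])
  rw [abs_zero, mul_zero, Real.exp_zero, mul_one, dsine_reflect] at e2
  have hre : (Real.pi * p * (a - Complex.I * u)).re = Real.pi * p * (a.re + u.im) := by
    simp
  obtain ⟨hs1, hs2⟩ := sin_mul_pos hp ht₀ hau (by linarith)
  have e3 := norm_cos_div_sin_le (z := Real.pi * p * (a - Complex.I * u))
    (by rw [hre]; exact (hs1.trans_le hs2).ne')
  rw [hre, abs_of_pos (hs1.trans_le hs2)] at e3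
  have e4 : ‖(2 * dsine p (2 * a + p))⁻¹‖ ≤ C₂ := by
    rw [mul_inv, norm_mul, norm_inv, Complex.norm_two]
    have := norm_nonneg (dsine p (2 * a + p))⁻¹
    linarith
  have e5 : Real.exp (decayRate * ((a + p).re + (a + p).re - Q p) * |u.re|) ≤
      Real.exp (-(decayRate * (6 * reflMargin p)) * |u.re|) := by
    refine Real.exp_le_exp.2 (mul_le_mul_of_nonneg_right ?_ (abs_nonneg _))
    rw [← mul_neg]
    refine mul_le_mul_of_nonneg_left ?_ hk.le
    have := (reflMargin_le p).2
    simp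
    linarith
  rw [reflKernel, norm_mul, div_eq_mul_inv, norm_mul]
  calc _ ≤ C₁ * Real.exp (-(decayRate * (6 * reflMargin p)) * |u.re|) * C₂ *
        (Real.sin (Real.pi * p * t₀))⁻¹ := by
        gcongr
        · exact e1.trans (by gcongr)
        · exact e3.trans (by gcongr)
    _ = _ := by ring

theorem reflKernel_sin_ne_zero (hp : 0 < p) {a u : ℂ} (h1 : a.re ≤ reflMargin p)
    (hu : |u.im| ≤ reflMargin p) (hau : 0 < a.re + u.im) :
    Complex.sin (Real.pi * p * (a - Complex.I * u)) ≠ 0 := by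
  have hpos := (sin_mul_pos hp hau le_rfl (by linarith [(abs_le.1 hu).2])).1
  intro h
  obtain ⟨k, hk⟩ := Complex.sin_eq_zero_iff.1 h
  have hre := congrArg Complex.re hk
  have h2 : (Real.pi * p * (a - Complex.I * u)).re = Real.pi * p * (a.re + u.im) := by simp
  rw [h2] at hre
  rw [hre] at hpos
  simp at hpos

theorem continuousAt_reflKernel {X : Type*} [TopologicalSpace X] (hp : 0 < p) (hpQ : 2 * p < Q p)
    {a u : X → ℂ} {t : X} (ha : ContinuousAt a t) (hu : ContinuousAt u t) (h0 : 0 ≤ (a t).re)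
    (h1 : (a t).re ≤ reflMargin p) (hum : |(u t).im| ≤ reflMargin p)
    (hau : 0 < (a t).re + (u t).im) :
    ContinuousAt (fun t => reflKernel p (a t) (u t)) t := by
  have hr := reflMargin_pos hp hpQ
  have hs : ∀ z, _ → z ∈ strip p := fun z hz => by
    have := reflKernel_mem_strip hp hpQ h0 h1 hum z hz
    exact ⟨by linarith, by linarith⟩
  have hd : ∀ f : X → ℂ, ContinuousAt f t → f t ∈ strip p →
      ContinuousAt (fun t => dsine p (f t)) t := fun f hf hft =>
    ContinuousAt.comp (g := dsine p) (differentiableAt_dsine hp hft).continuousAt hf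
  unfold reflKernel dsinePair
  refine ContinuousAt.mul (ContinuousAt.div (ContinuousAt.mul ?_ ?_) (ContinuousAt.mul (by fun_prop)
    ?_) (mul_ne_zero two_ne_zero (dsine_ne_zero _ _))) (ContinuousAt.div ?_ ?_ ?_)
  · exact hd _ (by fun_prop) (hs _ (by simp))
  · exact hd _ (by fun_prop) (hs _ (by simp))
  · exact hd _ (by fun_prop) (hs _ (by simp))
  · exact ContinuousAt.comp (g := Complex.cos) Complex.continuous_cos.continuousAt (by fun_prop)
  · exact ContinuousAt.comp (g := Complex.sin) Complex.continuous_sin.continuousAt (by fun_prop)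
  · exact reflKernel_sin_ne_zero hp h1 hum hau

theorem differentiableAt_reflKernel (hp : 0 < p) (hpQ : 2 * p < Q p) {a u : ℂ} (h0 : 0 ≤ a.re)
    (h1 : a.re ≤ reflMargin p) (hum : |u.im| ≤ reflMargin p) (hau : 0 < a.re + u.im) :
    DifferentiableAt ℂ (reflKernel p a) u := by
  have hr := reflMargin_pos hp hpQ
  have hs : ∀ z, _ → z ∈ strip p := fun z hz => by
    have := reflKernel_mem_strip hp hpQ h0 h1 hum z hz
    exact ⟨by linarith, by linarith⟩
  have hd : ∀ f : ℂ → ℂ, DifferentiableAt ℂ f u → f u ∈ strip p →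
      DifferentiableAt ℂ (fun t => dsine p (f t)) u := fun f hf hft =>
    DifferentiableAt.fun_comp' u (g := dsine p) (differentiableAt_dsine hp hft) hf
  unfold reflKernel dsinePair
  refine DifferentiableAt.mul (DifferentiableAt.div_const (DifferentiableAt.mul ?_ ?_) _)
    (DifferentiableAt.fun_div ?_ ?_ ?_)
  · exact hd _ (by fun_prop) (hs _ (by simp))
  · exact hd _ (by fun_prop) (hs _ (by simp))
  · fun_prop
  · fun_prop
  · exact reflKernel_sin_ne_zero hp h1 hum hau

end

/-! ### Existence of the reflection operators -/

/-- Since `b ≠ 1`, one of the two periods `b`, `b⁻¹` is smaller than `Q/2`. -/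
theorem exists_period_lt {b : ℝ} (hb : 0 < b) (hsin : Real.sin (Real.pi * b ^ 2) ≠ 0) :
    ∃ p : ℝ, 0 < p ∧ 2 * p < Q p ∧ Q p = Q b ∧ ∀ z, dsine p z = dsine b z := by
  have hb1 : b ≠ 1 := by
    rintro rfl
    simp at hsin
  rcases lt_or_gt_of_ne hb1 with h | h
  · refine ⟨b, hb, ?_, rfl, fun z => rfl⟩
    have := (one_lt_inv₀ hb).2 h
    rw [Q]; linarith
  · refine ⟨b⁻¹, inv_pos.2 hb, ?_, Q_inv b, dsine_inv_param b⟩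
    have := inv_lt_one_of_one_lt₀ h
    rw [Q, inv_inv]; linarith

/-- The kernel of the regularized reflection operator and its prefactor, in terms of
`a = Q/2 - α + ε`. -/
theorem reflection_kernel_eq {b : ℝ} {α : ℂ} (hα : α.re = Q b / 2) {e : ℝ}
    (he : 0 < e) (heQ : 2 * e < Q b) :
    Sb b (2 * (α - e)) = (dsine b (2 * (Q b / 2 - α + e)))⁻¹ ∧
    ∀ x : ℝ, D b (-Complex.I * (α - e)) x =
      dsinePair b (Q b / 2 - α + e) (Q b / 2 - α + e) x := by
  have h2 : ((Q b : ℂ) / 2).re = Q b / 2 := by simp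
  constructor
  · rw [← dsine_reflect, ← Sb_eq_dsine]
    · congr 1; ring
    · constructor <;> simp [hα] <;> linarith
  · intro x
    have h3 : (Q b : ℂ) / 2 - (α - e) = Q b / 2 - α + e := by ring
    rw [D_neg_I_mul_eq, h3, dsinePair]
    · constructor <;> simp [hα] <;> linarith
    · constructor <;> simp [hα] <;> linarith

section

variable {b p c B : ℝ} {α : ℂ} {h : ℂ → ℂ} {f : ℝ → ℂ}

theorem StripBounded.nonneg (hh : StripBounded c B h) (hc : 0 < c) : 0 ≤ B :=
  (norm_nonneg _).trans (hh.2 0 ⟨by simpa using hc, by simpa using hc⟩)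

theorem StripBounded.continuous (hh : StripBounded c B h) {X : Type*} [TopologicalSpace X]
    {u : X → ℂ} (hu : Continuous u) (hm : ∀ x, u x ∈ hStrip (-c) c) :
    Continuous fun x => h (u x) :=
  hh.1.continuousOn.comp_continuous hu hm

/-- The regularized reflection operator after the contour shift that removes the singularity at
`ε = 0`. -/
theorem reflReg_eq_integral (hp : 0 < p) (hpQ : 2 * p < Q p) (hQ : Q p = Q b)
    (hpb : ∀ z, dsine p z = dsine b z) (hα : α.re = Q b / 2) (hh : StripBounded c B h)
    (hf : f =ᵐ[volume] fun x => h x) {e d : ℝ} (he : 0 < e) (her : e ≤ reflMargin p)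
    (hd : 0 < d) (hdr : d < reflMargin p) (hdc : d < c) (x : ℝ) :
    Integrable (fun x' : ℝ => D b (-Complex.I * (α - e)) (x - x') * f x') ∧
    reflReg b α f x e = ∫ u : ℝ, reflKernel p (Q b / 2 - α + e) (u + Complex.I * d) *
      (h (x - (u + Complex.I * d)) + h (x + (u + Complex.I * d))) := by
  have hr := reflMargin_pos hp hpQ
  obtain ⟨hr1, hr2⟩ := reflMargin_le p
  have hk := decayRate_pos
  have hc : 0 < c := hd.trans hdc
  have hB := hh.nonneg hc
  set a : ℂ := Q b / 2 - α + e with ha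
  have hare : a.re = e := by simp [ha, hα]
  set κ := decayRate * (6 * reflMargin p) with hκ
  have hκ0 : 0 < κ := by positivity
  obtain ⟨C, hC, hbd⟩ := exists_norm_reflKernel_le hp hpQ (half_pos he) a.im
  obtain ⟨hS, hD⟩ := reflection_kernel_eq hα he (by linarith)
  rw [← ha] at hS hD
  have hreal : ∀ u : ℝ, (u : ℂ) ∈ hStrip (-c) c := fun u =>
    ⟨by simpa using hc, by simpa using hc⟩
  have hcont : Continuous fun u : ℝ => reflKernel p a u :=
    continuous_iff_continuousAt.2 fun u => continuousAt_reflKernel hp hpQ (a := fun _ : ℝ => a)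
      (u := fun u : ℝ => (u : ℂ)) (by fun_prop) (by fun_prop) (by rw [hare]; exact he.le)
      (by rwa [hare]) (by simpa using hr.le) (by rw [hare]; simpa using he)
  -- the integrands on the real line
  have hint : ∀ g : ℝ → ℂ, Continuous g → (∀ u, ‖g u‖ ≤ B) →
      Integrable fun u : ℝ => reflKernel p a u * g u := by
    intro g hg hgB
    refine ((integrable_exp_neg_mul_abs hκ0).const_mul (C * B)).mono'
      (hcont.mul hg).aestronglyMeasurable (ae_of_all _ fun u => ?_)
    have h1 := hbd a u rfl (by rw [hare]; exact he.le) (by rwa [hare]) (by simpa using hr.le)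
      (by rw [hare]; simpa using he.le)
    rw [norm_mul]
    refine (mul_le_mul h1 (hgB u) (norm_nonneg _) (by positivity)).trans (le_of_eq ?_)
    simp
    ring
  have hg1 : Continuous fun u : ℝ => h (x - u) := by
    have := hh.continuous (u := fun u : ℝ => ((x - u : ℝ) : ℂ)) (by fun_prop) fun u => hreal _
    simpa using this
  have hg2 : Continuous fun u : ℝ => h (x + u) := by
    have := hh.continuous (u := fun u : ℝ => ((x + u : ℝ) : ℂ)) (by fun_prop) fun u => hreal _
    simpa using this
  have hgB1 : ∀ u : ℝ, ‖h (x - u)‖ ≤ B := fun u => by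
    simpa using hh.2 _ (hreal (x - u))
  have hgB2 : ∀ u : ℝ, ‖h (x + u)‖ ≤ B := fun u => by
    simpa using hh.2 _ (hreal (x + u))
  have i1 := hint _ hg1 hgB1
  have i2 := hint _ hg2 hgB2
  have i3 : Integrable fun u : ℝ => reflKernel p a (-(u : ℂ)) * h (x - u) := by
    have := i2.comp_neg
    refine this.congr (ae_of_all _ fun u => ?_)
    simp [sub_eq_add_neg]
  -- the partial fraction decomposition of the kernel
  have hsum : ∀ u : ℝ, D b (-Complex.I * (α - e)) u =
      dsine b (2 * a) * (reflKernel p a u + reflKernel p a (-u)) := by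
    intro u
    have h1 : 2 * e < p⁻¹ := by
      have := mul_reflMargin_le hp
      have h2 : p * (2 * e) ≤ 1 / 4 := le_trans (by gcongr) this
      rw [lt_inv_comm₀ (by positivity) hp, lt_inv_comm₀ hp (by positivity)]
      by_contra hcon
      rw [not_lt] at hcon
      have h3 : p * p⁻¹ ≤ p * (2 * e) := by gcongr
      rw [mul_inv_cancel₀ hp.ne'] at h3
      linarith
    have := dsinePair_div_eq hp (a := a) (by rw [hare]; exact he) (by rwa [hare]) u
    rw [hD, ← this]
    have hpair : dsinePair p a a u = dsinePair b a a u := by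
      simp only [dsinePair, hpb]
    rw [hpair, hpb, mul_div_cancel₀ _ (dsine_ne_zero _ _)]
  have hae : (fun x' : ℝ => D b (-Complex.I * (α - e)) (x - x') * f x') =ᵐ[volume]
      fun x' : ℝ => D b (-Complex.I * (α - e)) (x - x') * h x' := by
    filter_upwards [hf] with x' hx'
    rw [hx']
  have hshift : ∀ x' : ℝ, D b (-Complex.I * (α - e)) (x - x') * h x' =
      (fun u : ℝ => dsine b (2 * a) * (reflKernel p a u * h (x - u) +
        reflKernel p a (-(u : ℂ)) * h (x - u))) (x - x') := by
    intro x'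
    simp only
    rw [← Complex.ofReal_sub, hsum]
    push_cast
    rw [sub_sub_cancel]
    ring
  constructor
  · refine Integrable.congr ?_ hae.symm
    simp only [hshift]
    exact ((i1.add i3).const_mul _).comp_sub_left x
  · -- the substitution `u ↦ -u` in the second partial fraction moves its poles to the lower half plane
    have hI : ∫ x' : ℝ, D b (-Complex.I * (α - e)) (x - x') * f x' =
        dsine b (2 * a) * ∫ u : ℝ, reflKernel p a u * (h (x - u) + h (x + u)) := by
      rw [integral_congr_ae hae]
      simp only [hshift]
      rw [integral_sub_left_eq_self (fun u : ℝ => dsine b (2 * a) * (reflKernel p a u * h (x - u) +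
        reflKernel p a (-(u : ℂ)) * h (x - u))) volume x, integral_const_mul,
        integral_add i1 i3]
      congr 1
      have h3 := integral_neg_eq_self (fun u : ℝ => reflKernel p a u * h (x + u)) volume
      have h4 : ∫ u : ℝ, reflKernel p a (-(u : ℂ)) * h (x - u) =
          ∫ u : ℝ, reflKernel p a u * h (x + u) := by
        rw [← h3]
        congr 1 with u
        push_cast
        rw [sub_eq_add_neg]
      rw [h4, ← integral_add i1 i2]
      simp only [mul_add]
    rw [reflReg, hS, hI, inv_mul_cancel_left₀ (dsine_ne_zero _ _)]
    -- the contour is shifted from the real line, above the pole at `Im u = -e`, to `Im u = d`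
    set m := min (reflMargin p) c with hm
    have hmr : m ≤ reflMargin p := min_le_left _ _
    have hmc : m ≤ c := min_le_right _ _
    have hdm : d < m := lt_min hdr hdc
    set lo := min (e / 2) c with hlo
    have hlo1 : lo ≤ e / 2 := min_le_left _ _
    have hlo2 : lo ≤ c := min_le_right _ _
    have hlo0 : 0 < lo := lt_min (half_pos he) hc
    have hmem : ∀ u ∈ hStrip (-lo) m, |u.im| ≤ reflMargin p ∧ e / 2 ≤ a.re + u.im ∧
        (x : ℂ) - u ∈ hStrip (-c) c ∧ (x : ℂ) + u ∈ hStrip (-c) c := by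
      intro u hu
      have hu1 := hu.1
      have hu2 := hu.2
      refine ⟨abs_le.2 ⟨by linarith, by linarith⟩, by rw [hare]; linarith, ⟨?_, ?_⟩, ?_, ?_⟩ <;>
      simp <;> linarith
    have hsh := integral_add_eq_integral_add (a := -lo) (c := m) (C := C * (B + B)) hκ0
      (F := fun u => reflKernel p a u * (h (x - u) + h (x + u))) (fun u hu => ?_) (fun u hu => ?_)
      (w₁ := 0) (w₂ := Complex.I * d) ⟨by simpa using hlo0, by simpa using hd.trans hdm⟩
      ⟨by simp; linarith, by simpa using hdm⟩
    · simpa using hsh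
    · obtain ⟨h1, h2, h3, h4⟩ := hmem u hu
      refine DifferentiableAt.differentiableWithinAt (DifferentiableAt.mul
        (differentiableAt_reflKernel hp hpQ (by rw [hare]; exact he.le) (by rwa [hare]) h1
          (by linarith)) (DifferentiableAt.add ?_ ?_))
      · exact DifferentiableAt.fun_comp' u (g := h) (hh.1.differentiableAt
          ((isOpen_hStrip _ _).mem_nhds h3)) (by fun_prop)
      · exact DifferentiableAt.fun_comp' u (g := h) (hh.1.differentiableAt
          ((isOpen_hStrip _ _).mem_nhds h4)) (by fun_prop)
    · obtain ⟨h1, h2, h3, h4⟩ := hmem u hu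
      have h5 := hbd a u rfl (by rw [hare]; exact he.le) (by rwa [hare]) h1 h2
      rw [norm_mul]
      refine (mul_le_mul h5 ((norm_add_le _ _).trans (add_le_add (hh.2 _ h3) (hh.2 _ h4)))
        (norm_nonneg _) (by positivity)).trans (le_of_eq ?_)
      ring

end

/-- The boundary value that defines the reflection operator exists for bounded holomorphic functions
on a strip, with a bound that is uniform in the position; `Rop` is the limit operator. The second
part allows the function to vary with the regularization. -/
theorem exists_reflReg_limit {b : ℝ} (hb : 0 < b) (hsin : Real.sin (Real.pi * b ^ 2) ≠ 0) {α : ℂ}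
    (hα : α.re = Q b / 2) {c : ℝ} (hc : 0 < c) :
    ∃ e₀ > 0, ∃ C : ℝ, ∃ Rop : (ℂ → ℂ) → ℝ → ℂ,
      (∀ (h : ℂ → ℂ) (B : ℝ) (f : ℝ → ℂ), StripBounded c B h → f =ᵐ[volume] (fun x : ℝ => h x) →
        ∀ e : ℝ, 0 < e → e < e₀ → ∀ x : ℝ,
          Integrable (fun x' : ℝ => D b (-Complex.I * (α - e)) (x - x') * f x') ∧
          ‖reflReg b α f x e‖ ≤ C * B) ∧
      ∀ (h : ℝ → ℂ → ℂ) (h₀ : ℂ → ℂ) (B : ℝ) (f : ℝ → ℝ → ℂ),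
        (∀ᶠ e in 𝓝[>] (0 : ℝ), StripBounded c B (h e) ∧ f e =ᵐ[volume] fun x : ℝ => h e x) →
        (∀ z ∈ hStrip (-c) c, Tendsto (fun e => h e z) (𝓝[>] 0) (𝓝 (h₀ z))) →
        ∀ x : ℝ, Tendsto (fun e => reflReg b α (f e) x e) (𝓝[>] 0) (𝓝 (Rop h₀ x)) := by
  obtain ⟨p, hp, hpQ, hQ, hpb⟩ := exists_period_lt hb hsin
  have hr := reflMargin_pos hp hpQ
  have hk := decayRate_pos
  set d := min (reflMargin p) c / 2 with hd
  have hm0 : 0 < min (reflMargin p) c := lt_min hr hc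
  have hd0 : 0 < d := half_pos hm0
  have hdr : d < reflMargin p := (half_lt_self hm0).trans_le (min_le_left _ _)
  have hdc : d < c := (half_lt_self hm0).trans_le (min_le_right _ _)
  set κ := decayRate * (6 * reflMargin p) with hκ
  have hκ0 : 0 < κ := by positivity
  obtain ⟨C, hC, hbd⟩ := exists_norm_reflKernel_le hp hpQ hd0 (-α.im)
  have hare : ∀ e : ℝ, (Q b / 2 - α + e : ℂ).re = e := fun e => by simp [hα]
  have haim : ∀ e : ℝ, (Q b / 2 - α + e : ℂ).im = -α.im := fun e => by simp
  have hK : ∀ e : ℝ, 0 ≤ e → e ≤ reflMargin p → ∀ u : ℝ,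
      ‖reflKernel p (Q b / 2 - α + e) (u + Complex.I * d)‖ ≤ C * Real.exp (-κ * |u|) := by
    intro e he her u
    have := hbd (Q b / 2 - α + e) (u + Complex.I * d) (haim e) (by rw [hare]; exact he)
      (by rw [hare]; exact her) (by simpa [abs_of_pos hd0] using hdr.le)
      (by rw [hare]; simpa using he)
    simpa using this
  have hKc : ∀ e : ℝ, 0 ≤ e → e ≤ reflMargin p → ∀ u : ℝ, ContinuousAt (fun q : ℝ × ℝ =>
      reflKernel p (Q b / 2 - α + q.1) (q.2 + Complex.I * d)) (e, u) := by
    intro e he her u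
    refine continuousAt_reflKernel hp hpQ (a := fun q : ℝ × ℝ => (Q b / 2 - α + q.1 : ℂ))
      (u := fun q : ℝ × ℝ => (q.2 + Complex.I * d : ℂ)) (by fun_prop) (by fun_prop) ?_ ?_ ?_ ?_
    · rw [hare]; exact he
    · rw [hare]; exact her
    · simpa [abs_of_pos hd0] using hdr.le
    · rw [hare]; simp; linarith
  have hmem : ∀ x u : ℝ, (x : ℂ) - (u + Complex.I * d) ∈ hStrip (-c) c ∧
      (x : ℂ) + (u + Complex.I * d) ∈ hStrip (-c) c := by
    intro x u
    refine ⟨⟨?_, ?_⟩, ?_, ?_⟩ <;> simp <;> linarith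
  have hbound : ∀ (h : ℂ → ℂ) (B : ℝ), StripBounded c B h → ∀ e : ℝ, 0 ≤ e → e ≤ reflMargin p →
      ∀ x u : ℝ, ‖reflKernel p (Q b / 2 - α + e) (u + Complex.I * d) *
        (h (x - (u + Complex.I * d)) + h (x + (u + Complex.I * d)))‖ ≤
        C * (B + B) * Real.exp (-κ * |u|) := by
    intro h B hh e he her x u
    have hB := hh.nonneg hc
    rw [norm_mul]
    refine (mul_le_mul (hK e he her u) ((norm_add_le _ _).trans (add_le_add (hh.2 _ (hmem x u).1)
      (hh.2 _ (hmem x u).2))) (norm_nonneg _) (by positivity)).trans (le_of_eq ?_)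
    ring
  have hint := integrable_exp_neg_mul_abs hκ0
  refine ⟨reflMargin p, hr, 2 * C * ∫ u : ℝ, Real.exp (-κ * |u|), fun h x => ∫ u : ℝ,
    reflKernel p (Q b / 2 - α + (0 : ℝ)) (u + Complex.I * d) *
      (h (x - (u + Complex.I * d)) + h (x + (u + Complex.I * d))), ?_, ?_⟩
  · intro h B f hh hf e he her x
    obtain ⟨h1, h2⟩ := reflReg_eq_integral hp hpQ hQ hpb hα hh hf he her.le hd0 hdr hdc x
    refine ⟨h1, ?_⟩
    rw [h2]
    refine (norm_integral_le_of_norm_le (hint.const_mul (C * (B + B)))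
      (ae_of_all _ fun u => hbound h B hh e he.le her.le x u)).trans (le_of_eq ?_)
    rw [integral_const_mul]
    ring
  · intro h h₀ B f hh hlim x
    have hev : ∀ᶠ e : ℝ in 𝓝[>] 0, 0 < e ∧ e < reflMargin p :=
      Ioo_mem_nhdsGT hr
    have hmain : Tendsto (fun e : ℝ => ∫ u : ℝ,
        reflKernel p (Q b / 2 - α + e) (u + Complex.I * d) *
        (h e (x - (u + Complex.I * d)) + h e (x + (u + Complex.I * d)))) (𝓝[>] 0)
        (𝓝 (∫ u : ℝ, reflKernel p (Q b / 2 - α + (0 : ℝ)) (u + Complex.I * d) *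
          (h₀ (x - (u + Complex.I * d)) + h₀ (x + (u + Complex.I * d))))) := by
      refine tendsto_integral_filter_of_dominated_convergence
        (fun u => C * (B + B) * Real.exp (-κ * |u|)) ?_ ?_ (hint.const_mul _)
        (ae_of_all _ fun u => ?_)
      · filter_upwards [hev, hh] with e he hhe
        refine Continuous.aestronglyMeasurable (Continuous.mul ?_ (Continuous.add ?_ ?_))
        · refine continuous_iff_continuousAt.2 fun u => ?_
          exact ContinuousAt.comp (g := fun q : ℝ × ℝ =>
            reflKernel p (Q b / 2 - α + q.1) (q.2 + Complex.I * d)) (f := fun u : ℝ => (e, u))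
            (hKc e he.1.le he.2.le u) (by fun_prop)
        · exact hhe.1.continuous (by fun_prop) fun u => (hmem x u).1
        · exact hhe.1.continuous (by fun_prop) fun u => (hmem x u).2
      · filter_upwards [hev, hh] with e he hhe
        exact ae_of_all _ fun u => hbound (h e) B hhe.1 e he.1.le he.2.le x u
      · refine Tendsto.mul ?_ ((hlim _ (hmem x u).1).add (hlim _ (hmem x u).2))
        have h1 := (hKc 0 le_rfl hr.le u).tendsto
        have h2 : Tendsto (fun e : ℝ => (e, u)) (𝓝[>] 0) (𝓝 (0, u)) :=
          ((by fun_prop : Continuous fun e : ℝ => (e, u)).tendsto 0).mono_left nhdsWithin_le_nhds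
        have h3 := Tendsto.comp (f := fun e : ℝ => (e, u)) h1 h2
        exact h3
    refine hmain.congr' ?_
    filter_upwards [hev, hh] with e he hhe
    exact ((reflReg_eq_integral hp hpQ hQ hpb hα hhe.1 hhe.2 he.1 he.2.le hd0 hdr hdc x).2).symm

/-! ### Normalization and symmetries -/

theorem sqrtSb_ne_zero (b : ℝ) (z : ℂ) : sqrtSb b z ≠ 0 := Complex.exp_ne_zero _

theorem sqrtSb_mul_self (b : ℝ) (z : ℂ) : sqrtSb b z * sqrtSb b z = dsine b z := by
  rw [sqrtSb, ← Complex.exp_add, add_halves, dsine]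

theorem sqrtSb_reflect (b : ℝ) (z : ℂ) : sqrtSb b (Q b - z) = (sqrtSb b z)⁻¹ := by
  rw [sqrtSb, sqrtSb, logSb_reflect, ← Complex.exp_neg]
  congr 1; ring

theorem M_reflect_one (b : ℝ) (α₃ α₂ α₁ : ℂ) : M b α₃ α₂ (Q b - α₁) =
    M b α₃ α₂ α₁ * (dsine b (α₂ + α₃ - α₁) * dsine b (2 * Q b - α₁ - α₂ - α₃)) := by
  rw [M, M, show 2 * (Q b : ℂ) - (Q b - α₁) - α₂ - α₃ = Q b - (α₂ + α₃ - α₁) by ring,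
    show (Q b : ℂ) - (Q b - α₁) - α₂ + α₃ = α₁ + α₃ - α₂ by ring,
    show (Q b : ℂ) - α₁ + α₃ - α₂ = Q b - α₁ - α₂ + α₃ by ring,
    show α₂ + α₃ - (Q b - α₁) = Q b - (2 * Q b - α₁ - α₂ - α₃) by ring, sqrtSb_reflect,
    sqrtSb_reflect, ← sqrtSb_mul_self, ← sqrtSb_mul_self]
  have h1 := sqrtSb_ne_zero b (α₂ + α₃ - α₁)
  have h2 := sqrtSb_ne_zero b (2 * Q b - α₁ - α₂ - α₃)
  have h3 := sqrtSb_ne_zero b (α₁ + α₃ - α₂)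
  have h4 := sqrtSb_ne_zero b (Q b - α₁ - α₂ + α₃)
  field_simp

theorem M_reflect_three (b : ℝ) (α₃ α₂ α₁ : ℂ) : M b (Q b - α₃) α₂ α₁ =
    M b α₃ α₂ α₁ * (dsine b (α₁ + α₃ - α₂) * dsine b (α₂ + α₃ - α₁)) := by
  rw [M, M, show 2 * (Q b : ℂ) - α₁ - α₂ - (Q b - α₃) = Q b - α₁ - α₂ + α₃ by ring,
    show (Q b : ℂ) - α₁ - α₂ + (Q b - α₃) = 2 * Q b - α₁ - α₂ - α₃ by ring,
    show α₁ + (Q b - α₃) - α₂ = Q b - (α₂ + α₃ - α₁) by ring,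
    show α₂ + (Q b - α₃) - α₁ = Q b - (α₁ + α₃ - α₂) by ring, sqrtSb_reflect,
    sqrtSb_reflect, ← sqrtSb_mul_self, ← sqrtSb_mul_self]
  have h1 := sqrtSb_ne_zero b (α₂ + α₃ - α₁)
  have h2 := sqrtSb_ne_zero b (2 * Q b - α₁ - α₂ - α₃)
  have h3 := sqrtSb_ne_zero b (α₁ + α₃ - α₂)
  have h4 := sqrtSb_ne_zero b (Q b - α₁ - α₂ + α₃)
  field_simp

theorem cgAn_translate (b : ℝ) (α₃ α₂ α₁ x₃ x₂ x₁ w : ℂ) :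
    cgAn b α₃ α₂ α₁ (x₃ + w) (x₂ + w) x₁ = cgAn b α₃ α₂ α₁ x₃ x₂ (x₁ - w) := by
  rw [cgAn_eq, cgAn_eq, show x₂ + w - x₁ = x₂ - (x₁ - w) by ring,
    show x₂ + w - (x₃ + w) = x₂ - x₃ by ring, show x₃ + w - x₁ = x₃ - (x₁ - w) by ring]

/-- Reflecting the line exchanges the two tensor factors. -/
theorem cg_neg (b : ℝ) (α₃ α₂ α₁ x₃ x₂ x₁ : ℂ) :
    cg b α₃ α₁ α₂ (-x₃) (-x₁) (-x₂) = cg b α₃ α₂ α₁ x₃ x₂ x₁ := by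
  rw [cg, cg, cgAn_eq, cgAn_eq, show -x₁ - -x₂ = x₂ - x₁ by ring,
    show -x₁ - -x₃ = x₃ - x₁ by ring, show -x₃ - -x₂ = x₂ - x₃ by ring, add_comm α₂ α₁,
    sub_right_comm (confDim b α₃), M, M, add_comm α₂ α₃, add_comm α₁ α₃, sub_right_comm _ α₂ α₁,
    sub_right_comm _ α₂ α₁]
  ring

theorem dsinePair_neg (b : ℝ) (p u : ℂ) : dsinePair b p p (-u) = dsinePair b p p u := by
  rw [dsinePair, dsinePair, mul_neg, sub_neg_eq_add, ← sub_eq_add_neg, mul_comm]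

/-! ### Boundary values with a given limit -/

/-- The Clebsch-Gordan map applied to `ψ` at `x₃` exists and equals `l`. -/
def HasCG (b : ℝ) (α₃ α₂ α₁ : ℂ) (ψ : ℝ → ℝ → ℂ) (x₃ : ℝ) (l : ℂ) : Prop :=
  (∀ᶠ ε : ℝ in 𝓝[>] 0, Integrable fun x : ℝ × ℝ =>
      cg b α₃ α₂ α₁ x₃ (x.1 + Complex.I * ε) (x.2 - Complex.I * ε) * ψ x.1 x.2) ∧
    Tendsto (cgReg b α₃ α₂ α₁ ψ x₃) (𝓝[>] 0) (𝓝 l)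

/-- The reflection operator applied to `f` at `x` exists and equals `l`. -/
def HasRefl (b : ℝ) (α : ℂ) (f : ℝ → ℂ) (x : ℝ) (l : ℂ) : Prop :=
  (∀ᶠ ε : ℝ in 𝓝[>] 0,
      Integrable fun x' : ℝ => D b (-Complex.I * (α - ε)) (x - x') * f x') ∧
    Tendsto (reflReg b α f x) (𝓝[>] 0) (𝓝 l)

section

variable {b : ℝ} {α α₃ α₂ α₁ l l' : ℂ} {ψ ψ' : ℝ → ℝ → ℂ} {f f' : ℝ → ℂ} {x x₃ : ℝ}

theorem HasCG.converges (h : HasCG b α₃ α₂ α₁ ψ x₃ l) : CGConverges b α₃ α₂ α₁ ψ x₃ :=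
  ⟨h.1, l, h.2⟩

theorem HasCG.cgMap_eq (h : HasCG b α₃ α₂ α₁ ψ x₃ l) : cgMap b α₃ α₂ α₁ ψ x₃ = l :=
  h.2.limUnder_eq

theorem HasRefl.converges (h : HasRefl b α f x l) : ReflConverges b α f x := ⟨h.1, l, h.2⟩

theorem HasRefl.reflOp_eq (h : HasRefl b α f x l) : reflOp b α f x = l := h.2.limUnder_eq

theorem HasCG.add (h : HasCG b α₃ α₂ α₁ ψ x₃ l) (h' : HasCG b α₃ α₂ α₁ ψ' x₃ l') :
    HasCG b α₃ α₂ α₁ (ψ + ψ') x₃ (l + l') := by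
  refine ⟨?_, (h.2.add h'.2).congr' ?_⟩
  · filter_upwards [h.1, h'.1] with ε h1 h2
    refine (h1.add h2).congr (ae_of_all _ fun x => ?_)
    simp only [Pi.add_apply]; ring
  · filter_upwards [h.1, h'.1] with ε h1 h2
    rw [cgReg, cgReg, cgReg, ← integral_add h1 h2]
    simp only [Pi.add_apply, mul_add]

theorem HasCG.smul (h : HasCG b α₃ α₂ α₁ ψ x₃ l) (a : ℂ) :
    HasCG b α₃ α₂ α₁ (a • ψ) x₃ (a * l) := by
  refine ⟨?_, (h.2.const_mul a).congr fun ε => ?_⟩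
  · filter_upwards [h.1] with ε h1
    refine (h1.const_mul a).congr (ae_of_all _ fun x => ?_)
    simp only [Pi.smul_apply, smul_eq_mul]; ring
  · rw [cgReg, cgReg, ← integral_const_mul]
    simp only [Pi.smul_apply, smul_eq_mul, mul_left_comm]

theorem HasCG.zero : HasCG b α₃ α₂ α₁ 0 x₃ 0 := by
  refine ⟨Eventually.of_forall fun ε => by simp, tendsto_const_nhds.congr fun ε => ?_⟩
  simp [cgReg]

theorem HasRefl.add (h : HasRefl b α f x l) (h' : HasRefl b α f' x l') :
    HasRefl b α (f + f') x (l + l') := by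
  refine ⟨?_, (h.2.add h'.2).congr' ?_⟩
  · filter_upwards [h.1, h'.1] with ε h1 h2
    refine (h1.add h2).congr (ae_of_all _ fun x => ?_)
    simp only [Pi.add_apply]; ring
  · filter_upwards [h.1, h'.1] with ε h1 h2
    rw [reflReg, reflReg, reflReg, ← mul_add, ← integral_add h1 h2]
    simp only [Pi.add_apply, mul_add]

theorem HasRefl.smul (h : HasRefl b α f x l) (a : ℂ) : HasRefl b α (a • f) x (a * l) := by
  refine ⟨?_, (h.2.const_mul a).congr fun ε => ?_⟩
  · filter_upwards [h.1] with ε h1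
    refine (h1.const_mul a).congr (ae_of_all _ fun x => ?_)
    simp only [Pi.smul_apply, smul_eq_mul]; ring
  · rw [reflReg, reflReg, mul_left_comm, ← integral_const_mul a]
    simp only [Pi.smul_apply, smul_eq_mul, mul_left_comm]

theorem HasRefl.zero : HasRefl b α 0 x 0 := by
  refine ⟨Eventually.of_forall fun ε => by simp, tendsto_const_nhds.congr fun ε => ?_⟩
  simp [reflReg]

theorem HasCG.neg (h : HasCG b α₃ α₂ α₁ ψ x₃ l) :
    HasCG b α₃ α₁ α₂ (fun x₂ x₁ => ψ (-x₁) (-x₂)) (-x₃) l := by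
  -- `(x₂, x₁) ↦ (-x₁, -x₂)` preserves the measure
  have hmp : MeasurePreserving (fun x : ℝ × ℝ => (-x.2, -x.1)) volume volume := by
    have h1 : MeasurePreserving (Prod.swap : ℝ × ℝ → ℝ × ℝ) volume volume :=
      Measure.measurePreserving_swap
    exact (Measure.measurePreserving_neg (volume : Measure (ℝ × ℝ))).comp h1
  have hemb : MeasurableEmbedding (fun x : ℝ × ℝ => (-x.2, -x.1)) :=
    (MeasurableEquiv.prodComm.trans (MeasurableEquiv.neg (ℝ × ℝ))).measurableEmbedding
  have hker : ∀ (ε : ℝ) (x : ℝ × ℝ),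
      cg b α₃ α₁ α₂ ((-x₃ : ℝ) : ℂ) (x.1 + Complex.I * ε) (x.2 - Complex.I * ε) * ψ (-x.2) (-x.1) =
      (fun x : ℝ × ℝ => cg b α₃ α₂ α₁ x₃ (x.1 + Complex.I * ε) (x.2 - Complex.I * ε) *
        ψ x.1 x.2) (-x.2, -x.1) := by
    intro ε x
    simp only
    rw [← cg_neg]
    push_cast
    congr 2 <;> ring
  refine ⟨?_, h.2.congr fun ε => ?_⟩
  · filter_upwards [h.1] with ε h1
    simp only [hker]
    exact (hmp.integrable_comp_emb hemb).2 h1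
  · rw [cgReg, cgReg]
    simp only [hker]
    exact (hmp.integral_comp hemb _).symm

theorem HasRefl.neg (hb : 0 < b) (hα : α.re = Q b / 2) (h : HasRefl b α f x l) :
    HasRefl b α (fun y => f (-y)) (-x) l := by
  have hQ := Q_pos hb
  have hev : ∀ᶠ ε : ℝ in 𝓝[>] 0, ∀ y : ℝ,
      D b (-Complex.I * (α - ε)) ((-x : ℝ) - y) * f (-y) =
        (fun y : ℝ => D b (-Complex.I * (α - ε)) (x - y) * f y) (-y) := by
    filter_upwards [Ioo_mem_nhdsGT (show 0 < Q b / 2 by positivity)] with ε hε y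
    have hD := (reflection_kernel_eq hα hε.1 (by linarith [hε.2])).2
    have e1 := hD (-x - y)
    have e2 := hD (x - -y)
    push_cast at e1 e2 ⊢
    rw [e1, e2, ← dsinePair_neg]
    congr 2
    ring
  refine ⟨?_, h.2.congr' ?_⟩
  · filter_upwards [hev, h.1] with ε h1 h2
    simp only [h1]
    exact h2.comp_neg
  · filter_upwards [hev] with ε h1
    rw [reflReg, reflReg]
    simp only [h1]
    rw [integral_neg_eq_self (fun y : ℝ => D b (-Complex.I * (α - ε)) (x - y) * f y) volume]

end

/-! ### The kernel identities integrated against functions -/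

/-- A criterion for absolute convergence of a double integral. -/
theorem integrable_prod_of_norm_le {X : Type*} [MeasurableSpace X] {ν : Measure X} [SFinite ν]
    {F : ℝ × X → ℂ} (hF : AEStronglyMeasurable F (volume.prod ν)) {A : ℝ → ℝ} (hA : Integrable A)
    (hA0 : ∀ y, 0 ≤ A y) {W : ℝ → X → ℝ} (hW : ∀ y, Integrable (W y) ν) {c : ℝ}
    (hWc : ∀ y, ∫ q, W y q ∂ν ≤ c) (h : ∀ y, ∀ᵐ q ∂ν, ‖F (y, q)‖ ≤ A y * W y q) :
    Integrable F (volume.prod ν) := by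
  refine (integrable_prod_iff hF).2 ⟨?_, ?_⟩
  · filter_upwards [hF.prodMk_left] with y hy
    exact ((hW y).const_mul (A y)).mono' hy (h y)
  · refine (hA.mul_const c).mono' hF.norm.integral_prod_right' (ae_of_all _ fun y => ?_)
    rw [Real.norm_of_nonneg (integral_nonneg fun q => norm_nonneg _)]
    calc _ ≤ ∫ q, A y * W y q ∂ν :=
          integral_mono_of_nonneg (ae_of_all _ fun q => norm_nonneg _) ((hW y).const_mul _) (h y)
      _ ≤ _ := by
          rw [integral_const_mul]
          exact mul_le_mul_of_nonneg_left (hWc y) (hA0 y)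

section

variable {b : ℝ} {α α₃ α₂ α₁ : ℂ}

/-- The kernel of the regularized reflection operator is smooth and decays exponentially. -/
theorem exists_norm_reflection_kernel_le (hb : 0 < b) (hα : α.re = Q b / 2) {e : ℝ} (he : 0 < e)
    (heQ : 2 * e < Q b) :
    (Continuous fun x : ℝ => D b (-Complex.I * (α - e)) x) ∧
    ∃ C > 0, ∃ κ > 0, ∀ x : ℝ, ‖D b (-Complex.I * (α - e)) x‖ ≤ C * Real.exp (-κ * |x|) := by
  have hD := (reflection_kernel_eq hα he heQ).2
  have hk := decayRate_pos
  set a : ℂ := Q b / 2 - α + e with ha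
  have hare : a.re = e := by simp [ha, hα]
  simp only [hD]
  constructor
  · unfold dsinePair
    refine (continuous_dsine_comp hb (by fun_prop) fun x => ?_).mul
      (continuous_dsine_comp hb (by fun_prop) fun x => ?_) <;>
    constructor <;> simp [hare] <;> linarith
  · set x₀ := min e (Q b - e) with hx₀
    have h1 : x₀ ≤ e := min_le_left _ _
    have h2 : x₀ ≤ Q b - e := min_le_right _ _
    obtain ⟨C, hC, h⟩ := exists_norm_dsinePair_le hb (x₀ := x₀) (lt_min he (by linarith)) |a.im|
    refine ⟨C, hC, decayRate * (Q b - 2 * e), mul_pos hk (by linarith), fun x => ?_⟩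
    refine (h a a x (by simp [hare]; linarith) (by simp [hare]; linarith) (by simp [hare]; linarith)
      (by simp [hare]; linarith) le_rfl le_rfl).trans (le_of_eq ?_)
    rw [hare, Complex.ofReal_re]
    congr 2
    ring

theorem aestronglyMeasurable_reflReg (hb : 0 < b) (hα : α.re = Q b / 2) {e : ℝ} (he : 0 < e)
    (heQ : 2 * e < Q b) {g : ℝ → ℂ} (hg : AEStronglyMeasurable g volume) :
    AEStronglyMeasurable (fun x => reflReg b α g x e) volume := by
  obtain ⟨hcont, -⟩ := exists_norm_reflection_kernel_le hb hα he heQ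
  have h1 : Continuous fun q : ℝ × ℝ => D b (-Complex.I * (α - e)) (q.1 - q.2) := by
    have := hcont.comp (continuous_fst.sub continuous_snd : Continuous fun q : ℝ × ℝ => q.1 - q.2)
    refine this.congr fun q => ?_
    simp
  have h2 : AEStronglyMeasurable (fun q : ℝ × ℝ => D b (-Complex.I * (α - e)) (q.1 - q.2) * g q.2)
      (volume.prod volume) := h1.aestronglyMeasurable.mul hg.comp_snd
  exact h2.integral_prod_right'.const_mul _

/-- The kernel identity integrated against a bounded function: applying the regularized
`R_{Q-α₁}` inside the Clebsch-Gordan integral at the shifted parameter `α₁ + e` amounts to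
reflecting that parameter. -/
theorem integral_cgKernel_mul_reflReg (hb : 0 < b) (h₁ : α₁.re = Q b / 2) (h₂ : α₂.re = Q b / 2)
    (h₃ : α₃.re = Q b / 2) {ε e : ℝ} (he : 0 < e) (heε : 3 * e ≤ ε) (hε : ε ≤ Q b / 8)
    {g : ℝ → ℂ} {B : ℝ} (hg : AEStronglyMeasurable g volume) (hgB : ∀ᵐ y, ‖g y‖ ≤ B) (x₃ s : ℝ) :
    ∫ t : ℝ, cgKernel b α₃ α₂ (α₁ + e) x₃ (s + Complex.I * ε) (t - Complex.I * ε) *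
        reflReg b (Q b - α₁) g t e =
      dsine b (α₂ + α₃ - α₁ - e) * dsine b (2 * Q b - α₁ - α₂ - α₃ - e) *
        ∫ y : ℝ, cgKernel b α₃ α₂ (Q b - α₁ - e) x₃ (s + Complex.I * ε) (y - Complex.I * ε) *
          g y := by
  have hε0 : 0 < ε := by linarith
  have hQ := Q_pos hb
  have hα : (Q b - α₁ : ℂ).re = Q b / 2 := by simp [h₁]; ring
  have heQ : 2 * e < Q b := by linarith
  obtain ⟨hDc, C', hC', κ', hκ', hD⟩ := exists_norm_reflection_kernel_le hb hα he heQ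
  have hB0 : 0 ≤ B := by
    obtain ⟨y, hy⟩ := hgB.exists
    exact (norm_nonneg _).trans hy
  have hreg : ∀ s t : ℝ, CGRegion b ε α₃ α₂ (α₁ + e) x₃ (s + Complex.I * ε) (t - Complex.I * ε) :=
    cgRegion_of_re_eq (by simp [h₁, abs_of_pos he]; linarith) (by simp [h₂]; linarith)
      (by simp [h₃]; linarith) (by simp) (by simpa using hε)
  have hreg' : ∀ s t : ℝ,
      CGRegion b ε α₃ α₂ (Q b - α₁ - e) x₃ (s + Complex.I * ε) (t - Complex.I * ε) :=
    cgRegion_of_re_eq (by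
        have : (Q b - α₁ - e : ℂ).re - Q b / 2 = -e := by simp [h₁]; ring
        rw [this, abs_neg, abs_of_pos he]; linarith) (by simp [h₂]; linarith)
      (by simp [h₃]; linarith) (by simp) (by simpa using hε)
  obtain ⟨C, hC, hcg⟩ := exists_norm_cgKernel_le hb hε0 (|α₁.im| + |α₂.im| + |α₃.im|)
  have n1 := abs_nonneg α₁.im
  have n2 := abs_nonneg α₂.im
  have n3 := abs_nonneg α₃.im
  have hκ := cgRate_pos hb
  set k : ℝ → ℂ := fun t =>
    cgKernel b α₃ α₂ (α₁ + e) x₃ (s + Complex.I * ε) (t - Complex.I * ε) with hk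
  have hkc : Continuous k := continuous_iff_continuousAt.2 fun t =>
    (hreg s t).continuousAt (X := ℝ) (a₃ := fun _ => α₃) (a₂ := fun _ => α₂)
      (a₁ := fun _ => α₁ + e) (y₃ := fun _ => (x₃ : ℂ)) (y₂ := fun _ => (s : ℂ) + Complex.I * ε)
      (y₁ := fun t => (t : ℂ) - Complex.I * ε) hb hε0 (by fun_prop) (by fun_prop) (by fun_prop)
      (by fun_prop) (by fun_prop) (by fun_prop)
  have hkb : ∀ t, ‖k t‖ ≤ C * Real.exp (-cgRate b * |x₃ - t|) := by
    intro t
    have h4 := hcg _ _ _ _ _ _ (hreg s t) (by simp; linarith) (by linarith) (by linarith)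
    refine h4.trans (mul_le_mul_of_nonneg_left ?_ hC.le)
    have h5 : Real.exp (-cgRate b * |((s : ℂ) + Complex.I * ε).re - (x₃ : ℂ).re|) ≤ 1 :=
      Real.exp_le_one_iff.2 (mul_nonpos_of_nonpos_of_nonneg (neg_nonpos.2 hκ.le) (abs_nonneg _))
    refine (mul_le_of_le_one_left (Real.exp_pos _).le h5).trans (le_of_eq ?_)
    simp
  set F : ℝ × ℝ → ℂ := fun q => k q.1 * (D b (-Complex.I * (Q b - α₁ - e)) (q.1 - q.2) * g q.2)
    with hF
  have hD2 : Continuous fun q : ℝ × ℝ => D b (-Complex.I * (Q b - α₁ - e)) (q.1 - q.2) := by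
    have := hDc.comp (continuous_fst.sub continuous_snd : Continuous fun q : ℝ × ℝ => q.1 - q.2)
    refine this.congr fun q => ?_
    simp
  have hint := integrable_exp_neg_mul_abs hκ'
  have hFi : Integrable F (volume.prod volume) := by
    refine integrable_prod_of_norm_le
      ((hkc.comp continuous_fst).aestronglyMeasurable.mul
        (hD2.aestronglyMeasurable.mul hg.comp_snd))
      (A := fun t => C * Real.exp (-cgRate b * |x₃ - t|))
      (W := fun t y => C' * B * Real.exp (-κ' * |t - y|))
      (c := C' * B * ∫ y : ℝ, Real.exp (-κ' * |y|))
      (((integrable_exp_neg_mul_abs hκ).comp_sub_left x₃).const_mul C) (fun t => by positivity)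
      (fun t => (hint.comp_sub_left t).const_mul _) (fun t => ?_) fun t => ?_
    · rw [integral_const_mul, integral_sub_left_eq_self (fun y : ℝ => Real.exp (-κ' * |y|)) volume t]
    · filter_upwards [hgB] with y hy
      simp only [hF]
      rw [norm_mul, norm_mul]
      refine mul_le_mul (hkb t) ?_ (by positivity) (by positivity)
      have h5 := hD (t - y)
      push_cast at h5
      refine (mul_le_mul h5 hy (norm_nonneg _) (by positivity)).trans (le_of_eq ?_)
      ring
  -- the kernel identity, translated by `iε`
  have hid : ∀ y : ℝ, Sb b (2 * (Q b - α₁ - e)) *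
      ∫ t : ℝ, k t * D b (-Complex.I * (Q b - α₁ - e)) (t - y) =
      dsine b (α₂ + α₃ - α₁ - e) * dsine b (2 * Q b - α₁ - α₂ - α₃ - e) *
        cgKernel b α₃ α₂ (Q b - α₁ - e) x₃ (s + Complex.I * ε) (y - Complex.I * ε) := by
    intro y
    have hdiv : ∀ z : ℂ, (z / 2).re = z.re / 2 := fun z => by simp
    have := (kernel_identity hb (α₁ := α₁ + e) (α₂ := α₂) (α₃ := α₃) (x₁ := y)
      (x₂ := s + Complex.I * ε + Complex.I * ε) (x₃ := x₃ + Complex.I * ε)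
      (by simp [hdiv, h₁, h₂, h₃]; linarith) (by simp [hdiv, h₁, h₂]; linarith)
      (by simp [hdiv, h₁, h₃]; linarith) (by simp [hdiv, h₁, h₂, h₃]; linarith)
      (by simp [h₁]; linarith) (by simp [h₁]; linarith)).2
    simp only [cgAn_translate] at this
    rw [show (Q b : ℂ) - (α₁ + e) = Q b - α₁ - e by ring, (hreg' s y).cgAn_eq hε0,
      Sb_eq_dsine (z := α₂ + α₃ - (α₁ + e)), Sb_eq_dsine (z := 2 * Q b - (α₁ + e) - α₂ - α₃),
      show α₂ + α₃ - (α₁ + e) = α₂ + α₃ - α₁ - e by ring,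
      show 2 * (Q b : ℂ) - (α₁ + e) - α₂ - α₃ = 2 * Q b - α₁ - α₂ - α₃ - e by ring] at this
    · rw [← this]
      congr 2 with t
      rw [(hreg s t).cgAn_eq hε0]
    · constructor <;> simp [h₁, h₂, h₃] <;> linarith
    · constructor <;> simp [h₁, h₂, h₃] <;> linarith
  calc ∫ t : ℝ, k t * reflReg b (Q b - α₁) g t e
      = Sb b (2 * (Q b - α₁ - e)) * ∫ t : ℝ, ∫ y : ℝ, F (t, y) := by
        rw [← integral_const_mul]
        congr 1 with t
        simp only [hF, reflReg]
        rw [integral_const_mul]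
        ring
    _ = Sb b (2 * (Q b - α₁ - e)) * ∫ y : ℝ, ∫ t : ℝ, F (t, y) := by
        rw [integral_integral_swap hFi]
    _ = _ := by
        rw [← integral_const_mul, ← integral_const_mul]
        congr 1 with y
        have h6 : ∫ t : ℝ, F (t, y) =
            (∫ t : ℝ, k t * D b (-Complex.I * (Q b - α₁ - e)) (t - y)) * g y := by
          rw [← integral_mul_const]
          simp only [hF, mul_assoc]
        rw [h6, ← mul_assoc, hid]
        ring

/-- The kernel identity for `R_{α₃}`, integrated against a bounded function. -/
theorem reflReg_cgKernel_integral (hb : 0 < b) (h₁ : α₁.re = Q b / 2) (h₂ : α₂.re = Q b / 2)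
    (h₃ : α₃.re = Q b / 2) {d e : ℝ} (he : 0 < e) (hed : 3 * e ≤ d) (hd : d ≤ Q b / 8)
    {ψ : ℝ × ℝ → ℂ} {B : ℝ} (hψ : AEStronglyMeasurable ψ volume) (hB : ∀ᵐ q, ‖ψ q‖ ≤ B) (x : ℝ) :
    reflReg b α₃ (fun y => ∫ q : ℝ × ℝ,
        cgKernel b (α₃ - e) α₂ α₁ y (q.1 + Complex.I * d) (q.2 - Complex.I * d) * ψ q) x e =
      dsine b (α₁ + α₃ - α₂ - e) * dsine b (α₂ + α₃ - α₁ - e) * ∫ q : ℝ × ℝ,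
        cgKernel b (Q b - α₃ + e) α₂ α₁ x (q.1 + Complex.I * d) (q.2 - Complex.I * d) * ψ q := by
  have hd0 : 0 < d := by linarith
  have hQ := Q_pos hb
  have heQ : 2 * e < Q b := by linarith
  obtain ⟨hDc, C', hC', κ', hκ', hD⟩ := exists_norm_reflection_kernel_le hb h₃ he heQ
  have hB0 : 0 ≤ B := by
    obtain ⟨y, hy⟩ := hB.exists
    exact (norm_nonneg _).trans hy
  have hreg : ∀ y s t : ℝ,
      CGRegion b d (α₃ - e) α₂ α₁ y (s + Complex.I * d) (t - Complex.I * d) := fun y =>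
    cgRegion_of_re_eq (by simp [h₁]; linarith) (by simp [h₂]; linarith)
      (by simp [h₃, abs_of_pos he]; linarith) (by simp) (by simpa using hd)
  have hreg' : ∀ s t : ℝ,
      CGRegion b d (Q b - α₃ + e) α₂ α₁ x (s + Complex.I * d) (t - Complex.I * d) :=
    cgRegion_of_re_eq (by simp [h₁]; linarith) (by simp [h₂]; linarith) (by
        have : (Q b - α₃ + e : ℂ).re - Q b / 2 = e := by simp [h₃]; ring
        rw [this, abs_of_pos he]; linarith) (by simp) (by simpa using hd)
  obtain ⟨C, hC, hcg⟩ := exists_norm_cgKernel_le hb hd0 (|α₁.im| + |α₂.im| + |α₃.im|)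
  have n1 := abs_nonneg α₁.im
  have n2 := abs_nonneg α₂.im
  have n3 := abs_nonneg α₃.im
  have hκ := cgRate_pos hb
  set k : ℝ → ℝ × ℝ → ℂ := fun y q =>
    cgKernel b (α₃ - e) α₂ α₁ y (q.1 + Complex.I * d) (q.2 - Complex.I * d) with hk
  have hkc : Continuous fun p : ℝ × ℝ × ℝ => k p.1 p.2 := continuous_iff_continuousAt.2 fun p =>
    (hreg p.1 p.2.1 p.2.2).continuousAt (X := ℝ × ℝ × ℝ) (a₃ := fun _ => α₃ - e) (a₂ := fun _ => α₂)
      (a₁ := fun _ => α₁) (y₃ := fun p => (p.1 : ℂ)) (y₂ := fun p => (p.2.1 : ℂ) + Complex.I * d)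
      (y₁ := fun p => (p.2.2 : ℂ) - Complex.I * d) hb hd0 (by fun_prop) (by fun_prop) (by fun_prop)
      (by fun_prop) (by fun_prop) (by fun_prop)
  have hkb : ∀ y q, ‖k y q‖ ≤
      C * (Real.exp (-cgRate b * |q.1 - y|) * Real.exp (-cgRate b * |y - q.2|)) := by
    intro y q
    have h4 := hcg _ _ _ _ _ _ (hreg y q.1 q.2) (by linarith) (by linarith) (by simp; linarith)
    refine h4.trans (le_of_eq ?_)
    simp
  set F : ℝ × ℝ × ℝ → ℂ := fun p => D b (-Complex.I * (α₃ - e)) (x - p.1) * (k p.1 p.2 * ψ p.2)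
    with hF
  have hD2 : Continuous fun y : ℝ => D b (-Complex.I * (α₃ - e)) (x - y) := by
    have := hDc.comp (continuous_const.sub continuous_id : Continuous fun y : ℝ => x - y)
    refine this.congr fun q => ?_
    simp
  have hFi : Integrable F (volume.prod volume) := by
    refine integrable_prod_of_norm_le
      ((hD2.comp continuous_fst).aestronglyMeasurable.mul (hkc.aestronglyMeasurable.mul hψ.comp_snd))
      (A := fun y => C' * Real.exp (-κ' * |x - y|))
      (W := fun y q => C * B * (Real.exp (-cgRate b * |q.1 - y|) * Real.exp (-cgRate b * |y - q.2|)))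
      (c := C * B * (∫ y : ℝ, Real.exp (-cgRate b * |y|)) ^ 2)
      (((integrable_exp_neg_mul_abs hκ').comp_sub_left x).const_mul C') (fun t => by positivity)
      (fun y => (integrable_cgWeight hκ y).const_mul _) (fun y => ?_) fun y => ?_
    · rw [integral_const_mul, integral_cgWeight]
    · filter_upwards [hB] with q hq
      simp only [hF]
      rw [norm_mul, norm_mul]
      have h5 := hD (x - y)
      push_cast at h5
      refine mul_le_mul h5 ?_ (by positivity) (by positivity)
      refine (mul_le_mul (hkb y q) hq (norm_nonneg _) (by positivity)).trans (le_of_eq ?_)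
      ring
  have hid : ∀ q : ℝ × ℝ, Sb b (2 * (α₃ - e)) *
      ∫ y : ℝ, D b (-Complex.I * (α₃ - e)) (x - y) * k y q =
      dsine b (α₁ + α₃ - α₂ - e) * dsine b (α₂ + α₃ - α₁ - e) *
        cgKernel b (Q b - α₃ + e) α₂ α₁ x (q.1 + Complex.I * d) (q.2 - Complex.I * d) := by
    intro q
    have hdiv : ∀ z : ℂ, (z / 2).re = z.re / 2 := fun z => by simp
    have := (kernel_identity_three hb (α₁ := α₁) (α₂ := α₂) (α₃ := α₃ - e)
      (x₁ := q.2 - Complex.I * d) (x₂ := q.1 + Complex.I * d) (x₃ := x)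
      (by simp [hdiv, h₂, h₃]; linarith) (by simp [hdiv, h₁, h₂, h₃]; linarith)
      (by simp [hdiv, h₁, h₂, h₃]; linarith) (by simp [hdiv, h₁, h₃]; linarith)
      (by simp [h₃]; linarith) (by simp [h₃]; linarith)).2
    rw [show (Q b : ℂ) - (α₃ - e) = Q b - α₃ + e by ring, (hreg' q.1 q.2).cgAn_eq hd0,
      Sb_eq_dsine (z := α₁ + (α₃ - e) - α₂), Sb_eq_dsine (z := α₂ + (α₃ - e) - α₁),
      show α₁ + (α₃ - e) - α₂ = α₁ + α₃ - α₂ - e by ring,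
      show α₂ + (α₃ - e) - α₁ = α₂ + α₃ - α₁ - e by ring] at this
    · rw [← this]
      congr 2 with y
      rw [(hreg y q.1 q.2).cgAn_eq hd0]
    · constructor <;> simp [h₁, h₂, h₃] <;> linarith
    · constructor <;> simp [h₁, h₂, h₃] <;> linarith
  calc reflReg b α₃ (fun y => ∫ q : ℝ × ℝ, k y q * ψ q) x e
      = Sb b (2 * (α₃ - e)) * ∫ y : ℝ, ∫ q : ℝ × ℝ, F (y, q) := by
        rw [reflReg]
        congr 2 with y
        simp only [hF]
        rw [integral_const_mul]
    _ = Sb b (2 * (α₃ - e)) * ∫ q : ℝ × ℝ, ∫ y : ℝ, F (y, q) := by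
        rw [integral_integral_swap hFi]
    _ = _ := by
        rw [← integral_const_mul, ← integral_const_mul]
        congr 1 with q
        have h6 : ∫ y : ℝ, F (y, q) =
            (∫ y : ℝ, D b (-Complex.I * (α₃ - e)) (x - y) * k y q) * ψ q := by
          rw [← integral_mul_const]
          simp only [hF, mul_assoc]
        rw [h6, ← mul_assoc, hid]
        ring

end

/-! ### The Clebsch-Gordan maps on products of functions -/

section

variable {b : ℝ} {α₃ α₂ α₁ : ℂ}

/-- On the critical lines the regularized coefficient is the product of the normalization and the
kernel. -/
theorem cg_eq_cgKernel (h₁ : α₁.re = Q b / 2) (h₂ : α₂.re = Q b / 2)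
    (h₃ : α₃.re = Q b / 2) {ε : ℝ} (hε : 0 < ε) (hεQ : ε ≤ Q b / 8) (x₃ : ℝ) (x : ℝ × ℝ) :
    cg b α₃ α₂ α₁ x₃ (x.1 + Complex.I * ε) (x.2 - Complex.I * ε) = M b α₃ α₂ α₁ *
      cgKernel b α₃ α₂ α₁ x₃ (x.1 + Complex.I * ε) (x.2 - Complex.I * ε) := by
  have habs : ∀ {a : ℂ}, a.re = Q b / 2 → |a.re - Q b / 2| ≤ ε / 3 := fun ha => by
    rw [ha, sub_self, abs_zero]; positivity
  rw [cg, (cgRegion_of_re_eq (habs h₁) (habs h₂) (habs h₃) (by simp) (by simpa using hεQ)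
    x.1 x.2).cgAn_eq hε]

theorem cgReg_eq (h₁ : α₁.re = Q b / 2) (h₂ : α₂.re = Q b / 2)
    (h₃ : α₃.re = Q b / 2) {ε : ℝ} (hε : 0 < ε) (hεQ : ε ≤ Q b / 8) (ψ : ℝ → ℝ → ℂ) (x₃ : ℝ) :
    cgReg b α₃ α₂ α₁ ψ x₃ ε = M b α₃ α₂ α₁ * ∫ x : ℝ × ℝ,
      cgKernel b α₃ α₂ α₁ x₃ (x.1 + Complex.I * ε) (x.2 - Complex.I * ε) * ψ x.1 x.2 := by
  rw [cgReg, ← integral_const_mul]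
  congr 1 with x
  rw [cg_eq_cgKernel h₁ h₂ h₃ hε hεQ, mul_assoc]

/-- The regularized Clebsch-Gordan integral of a bounded function converges absolutely. -/
theorem integrable_cg_mul (hb : 0 < b) (h₁ : α₁.re = Q b / 2) (h₂ : α₂.re = Q b / 2)
    (h₃ : α₃.re = Q b / 2) {ε : ℝ} (hε : 0 < ε) (hεQ : ε ≤ Q b / 8) {ψ : ℝ × ℝ → ℂ} {B : ℝ}
    (hψ : AEStronglyMeasurable ψ volume) (hB : ∀ᵐ x, ‖ψ x‖ ≤ B) (x₃ : ℝ) :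
    Integrable fun x : ℝ × ℝ =>
      cg b α₃ α₂ α₁ x₃ (x.1 + Complex.I * ε) (x.2 - Complex.I * ε) * ψ x := by
  have habs : ∀ {a : ℂ}, a.re = Q b / 2 → |a.re - Q b / 2| ≤ ε / 3 := fun ha => by
    rw [ha, sub_self, abs_zero]; positivity
  obtain ⟨C, -, h⟩ := exists_cgKernel_integral_bound hb hε (|α₁.im| + |α₂.im| + |α₃.im|)
  have n1 := abs_nonneg α₁.im
  have n2 := abs_nonneg α₂.im
  have n3 := abs_nonneg α₃.im
  refine ((h α₃ α₂ α₁ x₃ ε (cgRegion_of_re_eq (habs h₁) (habs h₂) (habs h₃) (by simp)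
    (by simpa using hεQ)) (by linarith) (by linarith) (by linarith) ψ B hψ hB).1.const_mul
    (M b α₃ α₂ α₁)).congr (ae_of_all _ fun x => ?_)
  simp only
  rw [cg_eq_cgKernel h₁ h₂ h₃ hε hεQ, mul_assoc]

theorem ae_prod_of_ae {p q : ℝ → Prop} (hp : ∀ᵐ x, p x) (hq : ∀ᵐ x, q x) :
    ∀ᵐ x : ℝ × ℝ, p x.1 ∧ q x.2 :=
  (Measure.quasiMeasurePreserving_fst.ae hp).and (Measure.quasiMeasurePreserving_snd.ae hq)

/-- A product of boundary values of bounded holomorphic functions is measurable and bounded. -/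
theorem StripBounded.tensor {c B : ℝ} {F G : ℂ → ℂ} (hc : 0 < c) (hF : StripBounded c B F)
    (hG : StripBounded c B G) {d : ℝ} (hd : |d| < c) :
    AEStronglyMeasurable (fun x : ℝ × ℝ => F (x.1 + Complex.I * d) * G (x.2 - Complex.I * d))
      volume ∧
    ∀ x : ℝ × ℝ, ‖F (x.1 + Complex.I * d) * G (x.2 - Complex.I * d)‖ ≤ B * B := by
  have hB := hF.nonneg hc
  rw [abs_lt] at hd
  have h1 : ∀ x : ℝ, (x : ℂ) + Complex.I * d ∈ hStrip (-c) c := fun x => by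
    constructor <;> simp <;> linarith
  have h2 : ∀ x : ℝ, (x : ℂ) - Complex.I * d ∈ hStrip (-c) c := fun x => by
    constructor <;> simp <;> linarith
  refine ⟨Continuous.aestronglyMeasurable ((hF.continuous (by fun_prop) fun x => h1 _).mul
    (hG.continuous (by fun_prop) fun x => h2 _)), fun x => ?_⟩
  rw [norm_mul]
  exact mul_le_mul (hF.2 _ (h1 _)) (hG.2 _ (h2 _)) (norm_nonneg _) hB

/-- The Clebsch-Gordan map exists on products of boundary values of bounded holomorphic functions;
its value is an integral over shifted contours. -/
theorem hasCG_tensor (hb : 0 < b) (h₁ : α₁.re = Q b / 2) (h₂ : α₂.re = Q b / 2)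
    (h₃ : α₃.re = Q b / 2) {c B : ℝ} {F G : ℂ → ℂ} (hF : StripBounded c B F)
    (hG : StripBounded c B G) {f g : ℝ → ℂ} (hf : f =ᵐ[volume] fun x => F x)
    (hg : g =ᵐ[volume] fun x => G x) {d : ℝ} (hd : 0 < d) (hdc : d < c) (hdQ : d < Q b / 8)
    (x₃ : ℝ) :
    HasCG b α₃ α₂ α₁ (fun x₂ x₁ => f x₂ * g x₁) x₃ (M b α₃ α₂ α₁ * ∫ x : ℝ × ℝ,
      cgKernel b α₃ α₂ α₁ x₃ (x.1 + Complex.I * d) (x.2 - Complex.I * d) *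
        (F (x.1 + Complex.I * d) * G (x.2 - Complex.I * d))) := by
  have hc : 0 < c := hd.trans hdc
  have hae : ∀ᵐ x : ℝ × ℝ, f x.1 * g x.2 = F x.1 * G x.2 := by
    filter_upwards [ae_prod_of_ae hf hg] with x hx
    rw [hx.1, hx.2]
  have hev : ∀ᶠ ε : ℝ in 𝓝[>] 0, 0 < ε ∧ ε < d := Ioo_mem_nhdsGT hd
  have h0 := hF.tensor hc hG (d := 0) (by simpa using hc)
  simp only [Complex.ofReal_zero, mul_zero, add_zero, sub_zero] at h0
  refine ⟨?_, ?_⟩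
  · filter_upwards [hev] with ε hε
    refine (integrable_cg_mul hb h₁ h₂ h₃ hε.1 (hε.2.trans hdQ).le h0.1 (ae_of_all _ h0.2) x₃).congr
      ?_
    filter_upwards [hae] with x hx
    rw [hx]
  have hreg : ∀ s t : ℝ, CGRegion b d α₃ α₂ α₁ x₃ (s + Complex.I * d) (t - Complex.I * d) :=
    cgRegion_of_re_eq (by rw [h₁, sub_self, abs_zero]; positivity)
      (by rw [h₂, sub_self, abs_zero]; positivity) (by rw [h₃, sub_self, abs_zero]; positivity)
      (by simp) (by simpa using hdQ.le)
  have hmain := tendsto_cgKernel_integral hb hd (l := 𝓝[>] (0 : ℝ)) (tendsto_const_nhds (x := α₃))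
    (tendsto_const_nhds (x := α₂)) (tendsto_const_nhds (x := α₁)) (z := x₃) (d := d)
    (Eventually.of_forall fun _ => hreg) hreg
    (ψ := fun ε x => F (x.1 + Complex.I * ((d - ε : ℝ) : ℂ)) *
      G (x.2 - Complex.I * ((d - ε : ℝ) : ℂ)))
    (ψ₀ := fun x => F (x.1 + Complex.I * d) * G (x.2 - Complex.I * d)) (B := B * B) ?_ ?_
    (ae_of_all _ fun x => ?_)
  · refine (hmain.const_mul (M b α₃ α₂ α₁)).congr' ?_
    filter_upwards [hev] with ε hε
    rw [cgReg_eq h₁ h₂ h₃ hε.1 (hε.2.trans hdQ).le,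
      ← cgKernel_integral_shift hb h₁ h₂ h₃ hF hG hε.1 hε.2.le hdc hdQ x₃]
    congr 1
    refine integral_congr_ae ?_
    filter_upwards [hae] with x hx
    rw [hx]
  · filter_upwards [hev] with ε hε
    exact (hF.tensor hc hG (by rw [abs_of_pos (by linarith [hε.2])]; linarith [hε.1])).1
  · filter_upwards [hev] with ε hε
    exact ae_of_all _
      (hF.tensor hc hG (by rw [abs_of_pos (by linarith [hε.2])]; linarith [hε.1])).2
  · have hlim : Tendsto (fun ε : ℝ => ((d - ε : ℝ) : ℂ)) (𝓝[>] 0) (𝓝 (d : ℂ)) :=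
      ((by fun_prop : Continuous fun ε : ℝ => ((d - ε : ℝ) : ℂ)).tendsto' 0 _ (by simp)).mono_left
        nhdsWithin_le_nhds
    have hFd : ContinuousAt F (x.1 + Complex.I * d) := (hF.1.differentiableAt
      ((isOpen_hStrip _ _).mem_nhds (by constructor <;> simp <;> linarith))).continuousAt
    have hGd : ContinuousAt G (x.2 - Complex.I * d) := (hG.1.differentiableAt
      ((isOpen_hStrip _ _).mem_nhds (by constructor <;> simp <;> linarith))).continuousAt
    exact (hFd.tendsto.comp ((hlim.const_mul _).const_add _)).mul
      (hGd.tendsto.comp ((hlim.const_mul _).const_sub _))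

/-! ### The three relations on products of functions -/

/-- Weyl invariance in `α₁`, on a product: the kernel identity at `α₁ + e`, `e → 0`. -/
theorem weyl_one (hb : 0 < b) (hsin : Real.sin (Real.pi * b ^ 2) ≠ 0) (h₁ : α₁.re = Q b / 2)
    (h₂ : α₂.re = Q b / 2) (h₃ : α₃.re = Q b / 2) {c B : ℝ} (hc : 0 < c) {F G : ℂ → ℂ}
    (hF : StripBounded c B F) (hG : StripBounded c B G) {f g : ℝ → ℂ}
    (hf : f =ᵐ[volume] fun x => F x) (hg : g =ᵐ[volume] fun x => G x) :
    ∃ r : ℝ → ℂ, (∀ x, HasRefl b (Q b - α₁) g x (r x)) ∧ ∀ x₃ : ℝ, ∃ l,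
      HasCG b α₃ α₂ (Q b - α₁) (fun x₂ x₁ => f x₂ * g x₁) x₃ l ∧
      HasCG b α₃ α₂ α₁ (fun x₂ x₁ => f x₂ * r x₁) x₃ l := by
  have hQ := Q_pos hb
  have hα : (Q b - α₁ : ℂ).re = Q b / 2 := by simp [h₁]; ring
  have hB := hF.nonneg hc
  obtain ⟨e₀, he₀, C, Rop, hbound, hlim⟩ := exists_reflReg_limit hb hsin hα hc
  have hr : ∀ x, Tendsto (fun e => reflReg b (Q b - α₁) g x e) (𝓝[>] 0) (𝓝 (Rop G x)) :=
    hlim (fun _ => G) G B (fun _ => g) (Eventually.of_forall fun _ => ⟨hG, hg⟩)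
      fun z _ => tendsto_const_nhds
  have hfm : AEStronglyMeasurable f volume :=
    (hF.continuous (u := fun x : ℝ => (x : ℂ)) (by fun_prop) fun x =>
      ⟨by simpa using hc, by simpa using hc⟩).aestronglyMeasurable.congr hf.symm
  have hgm : AEStronglyMeasurable g volume :=
    (hG.continuous (u := fun x : ℝ => (x : ℂ)) (by fun_prop) fun x =>
      ⟨by simpa using hc, by simpa using hc⟩).aestronglyMeasurable.congr hg.symm
  have hfB : ∀ᵐ x, ‖f x‖ ≤ B := by
    filter_upwards [hf] with x hx
    rw [hx]
    exact hF.2 _ ⟨by simpa using hc, by simpa using hc⟩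
  have hgB : ∀ᵐ x, ‖g x‖ ≤ B := by
    filter_upwards [hg] with x hx
    rw [hx]
    exact hG.2 _ ⟨by simpa using hc, by simpa using hc⟩
  have hevR : ∀ᶠ e : ℝ in 𝓝[>] 0, 0 < e ∧ e < e₀ ∧ 2 * e < Q b := by
    filter_upwards [Ioo_mem_nhdsGT he₀, Ioo_mem_nhdsGT (half_pos hQ)] with e h1 h2
    exact ⟨h1.1, h1.2, by linarith [h2.2]⟩
  have hRm : ∀ᶠ e : ℝ in 𝓝[>] 0, AEStronglyMeasurable (fun x => reflReg b (Q b - α₁) g x e)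
      volume := by
    filter_upwards [hevR] with e he
    exact aestronglyMeasurable_reflReg hb hα he.1 he.2.2 hgm
  have hRB : ∀ᶠ e : ℝ in 𝓝[>] 0, ∀ x, ‖reflReg b (Q b - α₁) g x e‖ ≤ C * B := by
    filter_upwards [hevR] with e he x
    exact (hbound G B g hG hg e he.1 he.2.1 x).2
  have hrB : ∀ x, ‖Rop G x‖ ≤ C * B := fun x =>
    le_of_tendsto (hr x).norm (hRB.mono fun e he => he x)
  have hrm : AEStronglyMeasurable (Rop G) volume := by
    obtain ⟨u, hu0, hu⟩ : ∃ u : ℕ → ℝ, Tendsto u atTop (𝓝[>] 0) ∧ ∀ n,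
        AEStronglyMeasurable (fun x => reflReg b (Q b - α₁) g x (u n)) volume := by
      obtain ⟨v, hv⟩ := exists_seq_tendsto (𝓝[>] (0 : ℝ))
      obtain ⟨N, hN⟩ := eventually_atTop.1 (hv.eventually hRm)
      exact ⟨fun n => v (n + N), hv.comp (tendsto_add_atTop_nat N), fun n => hN _ (by omega)⟩
    exact aestronglyMeasurable_of_tendsto_ae atTop hu (ae_of_all _ fun x => (hr x).comp hu0)
  refine ⟨Rop G, fun x => ⟨?_, hr x⟩, fun x₃ => ?_⟩
  · filter_upwards [hevR] with e he
    exact (hbound G B g hG hg e he.1 he.2.1 x).1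
  set d := min c (Q b / 8) / 2 with hd
  have hm0 : 0 < min c (Q b / 8) := lt_min hc (by positivity)
  have hd0 : 0 < d := half_pos hm0
  have hdc : d < c := (half_lt_self hm0).trans_le (min_le_left _ _)
  have hdQ : d < Q b / 8 := (half_lt_self hm0).trans_le (min_le_right _ _)
  have hCG := hasCG_tensor hb hα h₂ h₃ hF hG hf hg hd0 hdc hdQ x₃
  refine ⟨_, hCG, ?_, hCG.2.congr' ?_⟩
  · filter_upwards [Ioo_mem_nhdsGT (show 0 < Q b / 8 by positivity)] with ε hε
    refine integrable_cg_mul hb h₁ h₂ h₃ hε.1 hε.2.le (ψ := fun x => f x.1 * Rop G x.2)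
      (B := B * (C * B)) (hfm.comp_fst.mul hrm.comp_snd) ?_ x₃
    filter_upwards [ae_prod_of_ae hfB (ae_of_all _ hrB)] with x hx
    rw [norm_mul]
    exact mul_le_mul hx.1 hx.2 (norm_nonneg _) hB
  -- for each fixed `ε` the two regularized integrals agree: both are limits, as `e → 0`, of the two
  -- sides of the kernel identity at `α₁ + e`
  filter_upwards [Ioo_mem_nhdsGT (show 0 < Q b / 8 by positivity)] with ε hε
  have hε0 : 0 < ε := hε.1
  have hevε : ∀ᶠ e : ℝ in 𝓝[>] 0, 0 < e ∧ e < ε / 3 := Ioo_mem_nhdsGT (by linarith)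
  have hto : Tendsto (fun e : ℝ => (e : ℂ)) (𝓝[>] 0) (𝓝 0) :=
    (Complex.continuous_ofReal.tendsto' 0 0 (by simp)).mono_left nhdsWithin_le_nhds
  have hzero : ∀ {a : ℂ}, a.re = Q b / 2 → |a.re - Q b / 2| ≤ ε / 3 := fun ha => by
    rw [ha, sub_self, abs_zero]; positivity
  have t1 : Tendsto (fun e : ℝ => ∫ x : ℝ × ℝ, cgKernel b α₃ α₂ (α₁ + e) x₃
      (x.1 + Complex.I * ε) (x.2 - Complex.I * ε) * (f x.1 * reflReg b (Q b - α₁) g x.2 e)) (𝓝[>] 0)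
      (𝓝 (∫ x : ℝ × ℝ, cgKernel b α₃ α₂ α₁ x₃ (x.1 + Complex.I * ε) (x.2 - Complex.I * ε) *
        (f x.1 * Rop G x.2))) := by
    refine tendsto_cgKernel_integral hb hε0 tendsto_const_nhds tendsto_const_nhds
      (by simpa using hto.const_add α₁) ?_
      (cgRegion_of_re_eq (hzero h₁) (hzero h₂) (hzero h₃) (by simp) (by simpa using hε.2.le))
      (B := B * (C * B)) ?_ ?_ (ae_of_all _ fun x => (hr x.2).const_mul _)
    · filter_upwards [hevε] with e he
      exact cgRegion_of_re_eq (by simp [h₁, abs_of_pos he.1]; linarith [he.2]) (hzero h₂) (hzero h₃)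
        (by simp) (by simpa using hε.2.le)
    · filter_upwards [hRm] with e he
      exact hfm.comp_fst.mul he.comp_snd
    · filter_upwards [hRB] with e he
      filter_upwards [ae_prod_of_ae hfB (ae_of_all _ he)] with x hx
      rw [norm_mul]
      exact mul_le_mul hx.1 hx.2 (norm_nonneg _) hB
  have hre' : ∀ e : ℝ, (Q b - α₁ - e : ℂ).re - Q b / 2 = -e := fun e => by simp [h₁]; ring
  have hregε : ∀ e : ℝ, 0 < e → e < ε / 3 → ∀ s t : ℝ, CGRegion b ε α₃ α₂ (Q b - α₁ - e) x₃
      (s + Complex.I * ε) (t - Complex.I * ε) := fun e h0 h1 =>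
    cgRegion_of_re_eq (by rw [hre', abs_neg, abs_of_pos h0]; exact h1.le) (hzero h₂) (hzero h₃)
      (by simp) (by simpa using hε.2.le)
  have hψm : AEStronglyMeasurable (fun x : ℝ × ℝ => f x.1 * g x.2) volume :=
    hfm.comp_fst.mul hgm.comp_snd
  have hψB : ∀ᵐ x : ℝ × ℝ, ‖f x.1 * g x.2‖ ≤ B * B := by
    filter_upwards [ae_prod_of_ae hfB hgB] with x hx
    rw [norm_mul]
    exact mul_le_mul hx.1 hx.2 (norm_nonneg _) hB
  have t2 : Tendsto (fun e : ℝ => ∫ x : ℝ × ℝ, cgKernel b α₃ α₂ (Q b - α₁ - e) x₃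
      (x.1 + Complex.I * ε) (x.2 - Complex.I * ε) * (f x.1 * g x.2)) (𝓝[>] 0)
      (𝓝 (∫ x : ℝ × ℝ, cgKernel b α₃ α₂ (Q b - α₁) x₃ (x.1 + Complex.I * ε)
        (x.2 - Complex.I * ε) * (f x.1 * g x.2))) := by
    refine tendsto_cgKernel_integral hb hε0 tendsto_const_nhds tendsto_const_nhds
      (by simpa using hto.const_sub (Q b - α₁)) ?_
      (cgRegion_of_re_eq (hzero hα) (hzero h₂) (hzero h₃) (by simp) (by simpa using hε.2.le))
      (Eventually.of_forall fun _ => hψm) (Eventually.of_forall fun _ => hψB)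
      (ae_of_all _ fun x => tendsto_const_nhds)
    filter_upwards [hevε] with e he using hregε e he.1 he.2
  have hS : ∀ z : ℂ, z.re = Q b / 2 →
      Tendsto (fun e : ℝ => dsine b (z - e)) (𝓝[>] 0) (𝓝 (dsine b z)) := fun z hz =>
    tendsto_dsine hb ⟨by linarith, by linarith⟩ (by simpa using hto.const_sub z)
  have t3 := ((hS (α₂ + α₃ - α₁) (by simp [h₁, h₂, h₃]; ring)).mul
    (hS (2 * Q b - α₁ - α₂ - α₃) (by simp [h₁, h₂, h₃]; linarith))).mul t2
  have heq : (fun e : ℝ => ∫ x : ℝ × ℝ, cgKernel b α₃ α₂ (α₁ + e) x₃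
      (x.1 + Complex.I * ε) (x.2 - Complex.I * ε) * (f x.1 * reflReg b (Q b - α₁) g x.2 e))
      =ᶠ[𝓝[>] 0] fun e : ℝ => dsine b (α₂ + α₃ - α₁ - e) * dsine b (2 * Q b - α₁ - α₂ - α₃ - e) *
        ∫ x : ℝ × ℝ, cgKernel b α₃ α₂ (Q b - α₁ - e) x₃ (x.1 + Complex.I * ε)
          (x.2 - Complex.I * ε) * (f x.1 * g x.2) := by
    filter_upwards [hevε, hRm, hRB, hevR] with e he hem heB heR
    have n1 := abs_nonneg α₁.im
    have n2 := abs_nonneg α₂.im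
    have n3 := abs_nonneg α₃.im
    obtain ⟨C', -, hint⟩ := exists_cgKernel_integral_bound hb hε0 (|α₁.im| + |α₂.im| + |α₃.im|)
    have i1 := (hint α₃ α₂ (α₁ + e) x₃ ε (cgRegion_of_re_eq
      (by simp [h₁, abs_of_pos he.1]; linarith [he.2]) (hzero h₂) (hzero h₃) (by simp)
      (by simpa using hε.2.le)) (by simp; linarith) (by linarith) (by linarith)
      (fun x => f x.1 * reflReg b (Q b - α₁) g x.2 e) (B * (C * B)) (hfm.comp_fst.mul hem.comp_snd)
      (by
        filter_upwards [ae_prod_of_ae hfB (ae_of_all _ heB)] with x hx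
        rw [norm_mul]
        exact mul_le_mul hx.1 hx.2 (norm_nonneg _) hB)).1
    have i2 := (hint α₃ α₂ (Q b - α₁ - e) x₃ ε (hregε e he.1 he.2) (by simp; linarith) (by linarith)
      (by linarith) _ _ hψm hψB).1
    rw [Measure.volume_eq_prod] at i1 i2 ⊢
    rw [integral_prod _ i1, integral_prod _ i2, ← integral_const_mul]
    congr 1 with s
    have h5 := integral_cgKernel_mul_reflReg hb h₁ h₂ h₃ he.1 (by linarith [he.2]) hε.2.le hgm hgB x₃ s
    simp only [mul_left_comm _ (f s), integral_const_mul]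
    rw [h5]
  have hlimeq := tendsto_nhds_unique (t1.congr' heq) t3
  rw [cgReg_eq hα h₂ h₃ hε0 hε.2.le, cgReg_eq h₁ h₂ h₃ hε0 hε.2.le, hlimeq, M_reflect_one]
  ring

/-- Weyl invariance in `α₂`, the mirror image of `weyl_one`. -/
theorem weyl_two (hb : 0 < b) (hsin : Real.sin (Real.pi * b ^ 2) ≠ 0) (h₁ : α₁.re = Q b / 2)
    (h₂ : α₂.re = Q b / 2) (h₃ : α₃.re = Q b / 2) {c B : ℝ} (hc : 0 < c) {F G : ℂ → ℂ}
    (hF : StripBounded c B F) (hG : StripBounded c B G) {f g : ℝ → ℂ}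
    (hf : f =ᵐ[volume] fun x => F x) (hg : g =ᵐ[volume] fun x => G x) :
    ∃ r : ℝ → ℂ, (∀ x, HasRefl b (Q b - α₂) f x (r x)) ∧ ∀ x₃ : ℝ, ∃ l,
      HasCG b α₃ (Q b - α₂) α₁ (fun x₂ x₁ => f x₂ * g x₁) x₃ l ∧
      HasCG b α₃ α₂ α₁ (fun x₂ x₁ => r x₂ * g x₁) x₃ l := by
  have hα : (Q b - α₂ : ℂ).re = Q b / 2 := by simp [h₂]; ring
  have hneg : ∀ {H : ℂ → ℂ}, StripBounded c B H → StripBounded c B fun z => H (-z) := by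
    intro H hH
    have hm : ∀ z ∈ hStrip (-c) c, -z ∈ hStrip (-c) c := fun z hz => by
      have h1 := hz.1
      have h2 := hz.2
      constructor <;> simp <;> linarith
    exact ⟨hH.1.comp (by fun_prop) hm, fun z hz => hH.2 _ (hm z hz)⟩
  have hnegae : ∀ {u : ℝ → ℂ} {H : ℂ → ℂ}, u =ᵐ[volume] (fun x : ℝ => H x) →
      (fun x => u (-x)) =ᵐ[volume] fun x : ℝ => (fun z => H (-z)) (x : ℂ) := by
    intro u H hu
    have := (Measure.measurePreserving_neg (volume : Measure ℝ)).quasiMeasurePreserving.ae hu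
    filter_upwards [this] with x hx
    rw [hx]
    push_cast
    rfl
  obtain ⟨r, hr, hcg⟩ := weyl_one hb hsin h₂ h₁ h₃ hc (hneg hG) (hneg hF) (hnegae hg) (hnegae hf)
  refine ⟨fun x => r (-x), fun x => ?_, fun x₃ => ?_⟩
  · have := (hr (-x)).neg hb hα
    simpa using this
  · obtain ⟨l, hl1, hl2⟩ := hcg (-x₃)
    refine ⟨l, ?_, ?_⟩
    · have := hl1.neg
      simp only [neg_neg] at this
      simpa only [mul_comm] using this
    · have := hl2.neg
      simp only [neg_neg] at this
      simpa only [mul_comm] using this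

/-- Weyl invariance in `α₃`, on a product. The image of the Clebsch-Gordan map extends
holomorphically to a strip, and so do the images `h e` at the parameters `α₃ - e`, which converge to
it; to these the kernel identity applies. -/
theorem weyl_three (hb : 0 < b) (hsin : Real.sin (Real.pi * b ^ 2) ≠ 0) (h₁ : α₁.re = Q b / 2)
    (h₂ : α₂.re = Q b / 2) (h₃ : α₃.re = Q b / 2) {c B : ℝ} (hc : 0 < c) {F G : ℂ → ℂ}
    (hF : StripBounded c B F) (hG : StripBounded c B G) {f g : ℝ → ℂ}
    (hf : f =ᵐ[volume] fun x => F x) (hg : g =ᵐ[volume] fun x => G x) :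
    ∃ h r : ℝ → ℂ, (∀ x₃, HasCG b α₃ α₂ α₁ (fun x₂ x₁ => f x₂ * g x₁) x₃ (h x₃)) ∧ ∀ x₃,
      HasRefl b α₃ h x₃ (r x₃) ∧
      HasCG b (Q b - α₃) α₂ α₁ (fun x₂ x₁ => f x₂ * g x₁) x₃ (r x₃) := by
  have hQ := Q_pos hb
  have hα : (Q b - α₃ : ℂ).re = Q b / 2 := by simp [h₃]; ring
  set d := min c (Q b / 12) / 2 with hd
  have hm0 : 0 < min c (Q b / 12) := lt_min hc (by positivity)
  have hd0 : 0 < d := half_pos hm0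
  have hdc : d < c := (half_lt_self hm0).trans_le (min_le_left _ _)
  have hdQ : d < Q b / 12 := (half_lt_self hm0).trans_le (min_le_right _ _)
  have hd2 : 0 < d / 2 := half_pos hd0
  set ψ : ℝ × ℝ → ℂ := fun x => F (x.1 + Complex.I * d) * G (x.2 - Complex.I * d) with hψ
  obtain ⟨hψm, hψB⟩ := hF.tensor hc hG (d := d) (by rwa [abs_of_pos hd0])
  set h : ℝ → ℂ → ℂ := fun e z => M b α₃ α₂ α₁ * ∫ x : ℝ × ℝ,
    cgKernel b (α₃ - e) α₂ α₁ z (x.1 + Complex.I * d) (x.2 - Complex.I * d) * ψ x with hh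
  have hzero : ∀ {a : ℂ} {m : ℝ}, 0 ≤ m → a.re = Q b / 2 → |a.re - Q b / 2| ≤ m := fun hm ha => by
    rwa [ha, sub_self, abs_zero]
  have hre₃ : ∀ e : ℝ, (α₃ - e : ℂ).re - Q b / 2 = -e := fun e => by simp [h₃]
  have hreg : ∀ e : ℝ, 0 ≤ e → e < d / 6 → ∀ z ∈ hStrip (-(d / 2)) (d / 2), ∀ s t : ℝ,
      CGRegion b (d / 2) (α₃ - e) α₂ α₁ z (s + Complex.I * d) (t - Complex.I * d) := by
    intro e he0 he z hz
    have habs : |z.im| ≤ d / 2 := abs_le.2 ⟨hz.1.le, hz.2.le⟩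
    exact cgRegion_of_re_eq (hzero (by positivity) h₁) (hzero (by positivity) h₂)
      (by rw [hre₃, abs_neg, abs_of_nonneg he0]; linarith) (by linarith) (by linarith)
  have n1 := abs_nonneg α₁.im
  have n2 := abs_nonneg α₂.im
  have n3 := abs_nonneg α₃.im
  obtain ⟨C, hC, hbd⟩ := exists_cgKernel_integral_bound hb hd2 (|α₁.im| + |α₂.im| + |α₃.im|)
  have hstrip : ∀ e : ℝ, 0 ≤ e → e < d / 6 →
      StripBounded (d / 2) (‖M b α₃ α₂ α₁‖ * (C * (B * B))) (h e) := by
    intro e he0 he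
    refine ⟨(differentiableOn_cgKernel_integral hb hd0 (by linarith) (hzero (by positivity) h₁)
      (hzero (by positivity) h₂) (by rw [hre₃, abs_neg, abs_of_nonneg he0]; linarith) hψm
      (ae_of_all _ hψB)).const_mul _, fun z hz => ?_⟩
    simp only [hh]
    rw [norm_mul]
    exact mul_le_mul_of_nonneg_left (hbd _ _ _ z d (hreg e he0 he z hz) (by linarith) (by linarith)
      (by simp; linarith) ψ _ hψm (ae_of_all _ hψB)).2 (norm_nonneg _)
  have hev : ∀ᶠ e : ℝ in 𝓝[>] 0, 0 < e ∧ e < d / 6 := Ioo_mem_nhdsGT (by positivity)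
  have hto : Tendsto (fun e : ℝ => (e : ℂ)) (𝓝[>] 0) (𝓝 0) :=
    (Complex.continuous_ofReal.tendsto' 0 0 (by simp)).mono_left nhdsWithin_le_nhds
  have hlim : ∀ z ∈ hStrip (-(d / 2)) (d / 2), Tendsto (fun e => h e z) (𝓝[>] 0) (𝓝 (h 0 z)) := by
    intro z hz
    refine Tendsto.const_mul _ (tendsto_cgKernel_integral hb hd2 ?_ tendsto_const_nhds
      tendsto_const_nhds ?_ (hreg 0 le_rfl (by positivity) z hz) (Eventually.of_forall fun _ => hψm)
      (Eventually.of_forall fun _ => ae_of_all _ hψB) (ae_of_all _ fun x => tendsto_const_nhds))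
    · simpa using hto.const_sub α₃
    · filter_upwards [hev] with e he using hreg e he.1.le he.2 z hz
  -- the regularized operator may be applied to `h e` instead of `h 0` without changing the limit
  obtain ⟨e₀, he₀, C', Rop, hR1, hR2⟩ := exists_reflReg_limit hb hsin h₃ hd2
  have hCG : ∀ x₃ : ℝ, HasCG b α₃ α₂ α₁ (fun x₂ x₁ => f x₂ * g x₁) x₃ (h 0 x₃) := by
    intro x₃
    have := hasCG_tensor hb h₁ h₂ h₃ hF hG hf hg hd0 hdc (by linarith) x₃
    simpa only [hh, Complex.ofReal_zero, sub_zero] using this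
  refine ⟨fun x => h 0 x, fun x => Rop (h 0) x, hCG, fun x => ⟨⟨?_, ?_⟩, ?_⟩⟩
  · filter_upwards [Ioo_mem_nhdsGT he₀] with e he
    exact (hR1 (h 0) _ _ (hstrip 0 le_rfl (by positivity)) (ae_eq_refl _) e he.1 he.2 x).1
  · exact hR2 (fun _ => h 0) (h 0) _ (fun _ x => h 0 x)
      (Eventually.of_forall fun _ => ⟨hstrip 0 le_rfl (by positivity), ae_eq_refl _⟩)
      (fun z _ => tendsto_const_nhds) x
  have hval : Rop (h 0) x = M b (Q b - α₃) α₂ α₁ * ∫ q : ℝ × ℝ,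
      cgKernel b (Q b - α₃) α₂ α₁ x (q.1 + Complex.I * d) (q.2 - Complex.I * d) * ψ q := by
    have t1 := hR2 h (h 0) _ (fun e x => h e x)
      (by filter_upwards [hev] with e he using ⟨hstrip e he.1.le he.2, ae_eq_refl _⟩) hlim x
    have hS : ∀ z : ℂ, z.re = Q b / 2 →
        Tendsto (fun e : ℝ => dsine b (z - e)) (𝓝[>] 0) (𝓝 (dsine b z)) := fun z hz =>
      tendsto_dsine hb ⟨by linarith, by linarith⟩ (by simpa using hto.const_sub z)
    have t2 : Tendsto (fun e : ℝ => ∫ q : ℝ × ℝ, cgKernel b (Q b - α₃ + e) α₂ α₁ x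
        (q.1 + Complex.I * d) (q.2 - Complex.I * d) * ψ q) (𝓝[>] 0)
        (𝓝 (∫ q : ℝ × ℝ, cgKernel b (Q b - α₃) α₂ α₁ x
          (q.1 + Complex.I * d) (q.2 - Complex.I * d) * ψ q)) := by
      refine tendsto_cgKernel_integral hb hd0 (by simpa using hto.const_add (Q b - α₃))
        tendsto_const_nhds tendsto_const_nhds ?_ (cgRegion_of_re_eq (hzero (by positivity) h₁)
          (hzero (by positivity) h₂) (hzero (by positivity) hα) (by simp) (by simp; linarith))
        (Eventually.of_forall fun _ => hψm) (Eventually.of_forall fun _ => ae_of_all _ hψB)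
        (ae_of_all _ fun x => tendsto_const_nhds)
      filter_upwards [hev] with e he
      refine cgRegion_of_re_eq (hzero (by positivity) h₁) (hzero (by positivity) h₂) ?_ (by simp)
        (by simp; linarith)
      have : (Q b - α₃ + e : ℂ).re - Q b / 2 = e := by simp [h₃]; ring
      rw [this, abs_of_pos he.1]
      linarith [he.2]
    have t3 := (((hS (α₁ + α₃ - α₂) (by simp [h₁, h₂, h₃]; ring)).mul
      (hS (α₂ + α₃ - α₁) (by simp [h₁, h₂, h₃]; ring))).mul t2).const_mul (M b α₃ α₂ α₁)
    rw [tendsto_nhds_unique t1 (t3.congr' ?_), M_reflect_three]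
    · ring
    filter_upwards [hev] with e he
    have h6 := reflReg_cgKernel_integral (d := d) (ψ := ψ) hb h₁ h₂ h₃ he.1 (by linarith [he.2])
      (by linarith) hψm
      (ae_of_all _ hψB) x
    rw [← h6, reflReg, reflReg]
    simp only [hh, mul_left_comm _ (M b α₃ α₂ α₁), integral_const_mul]
  beta_reduce
  rw [hval]
  exact hasCG_tensor hb h₁ h₂ hα hF hG hf hg hd0 hdc (by linarith) x

end

/-! ### From products to the algebraic tensor product -/

section

variable {b : ℝ} {α₁ α₂ α₃ : ℂ}

theorem StripBounded.mono {c B B' : ℝ} {h : ℂ → ℂ} (hh : StripBounded c B h) (hB : B ≤ B') :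
    StripBounded c B' h :=
  ⟨hh.1, fun z hz => (hh.2 z hz).trans hB⟩

/-- Two elements of the spaces `P_α` extend to one strip with a common bound. -/
theorem exists_stripBounded_pair (hb : 0 < b) {α β : ℂ} {f g : L2} (hf : f ∈ P b α)
    (hg : g ∈ P b β) : ∃ (B : ℝ) (F G : ℂ → ℂ), StripBounded (b / 4) B F ∧
      StripBounded (b / 4) B G ∧ (f =ᵐ[volume] fun x : ℝ => F x) ∧
        g =ᵐ[volume] fun x : ℝ => G x := by
  obtain ⟨B, F, hF, hfF⟩ := exists_stripBounded_of_mem_P hb hf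
  obtain ⟨B', G, hG, hgG⟩ := exists_stripBounded_of_mem_P hb hg
  exact ⟨max B B', F, G, hF.mono (le_max_left _ _), hG.mono (le_max_right _ _), hfF, hgG⟩

theorem weyl_one_of_mem (hb : 0 < b) (hsin : Real.sin (Real.pi * b ^ 2) ≠ 0)
    (h₁ : α₁.re = Q b / 2) (h₂ : α₂.re = Q b / 2) (h₃ : α₃.re = Q b / 2) {ψ : ℝ → ℝ → ℂ}
    (hψ : ψ ∈ PTensor b α₂ (Q b - α₁)) :
    ∃ ρ : ℝ → ℝ → ℂ, (∀ x₂ x₁, HasRefl b (Q b - α₁) (fun x => ψ x₂ x) x₁ (ρ x₂ x₁)) ∧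
      ∀ x₃ : ℝ, ∃ l, HasCG b α₃ α₂ (Q b - α₁) ψ x₃ l ∧ HasCG b α₃ α₂ α₁ ρ x₃ l := by
  induction hψ using Submodule.span_induction with
  | mem ψ h =>
    obtain ⟨f, hf, g, hg, rfl⟩ := h
    obtain ⟨B, F, G, hF, hG, hfF, hgG⟩ := exists_stripBounded_pair hb hf hg
    obtain ⟨r, hr, hcg⟩ := weyl_one hb hsin h₁ h₂ h₃ (by positivity) hF hG hfF hgG
    exact ⟨fun x₂ x₁ => f x₂ * r x₁, fun x₂ x₁ => (hr x₁).smul (f x₂), hcg⟩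
  | zero => exact ⟨0, fun _ _ => HasRefl.zero, fun _ => ⟨0, HasCG.zero, HasCG.zero⟩⟩
  | add ψ ψ' _ _ h h' =>
    obtain ⟨ρ, hr, hc⟩ := h
    obtain ⟨ρ', hr', hc'⟩ := h'
    refine ⟨ρ + ρ', fun x₂ x₁ => (hr x₂ x₁).add (hr' x₂ x₁), fun x₃ => ?_⟩
    obtain ⟨l, h1, h2⟩ := hc x₃
    obtain ⟨l', h1', h2'⟩ := hc' x₃
    exact ⟨l + l', h1.add h1', h2.add h2'⟩
  | smul a ψ _ h =>
    obtain ⟨ρ, hr, hc⟩ := h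
    refine ⟨a • ρ, fun x₂ x₁ => (hr x₂ x₁).smul a, fun x₃ => ?_⟩
    obtain ⟨l, h1, h2⟩ := hc x₃
    exact ⟨a * l, h1.smul a, h2.smul a⟩

theorem weyl_two_of_mem (hb : 0 < b) (hsin : Real.sin (Real.pi * b ^ 2) ≠ 0)
    (h₁ : α₁.re = Q b / 2) (h₂ : α₂.re = Q b / 2) (h₃ : α₃.re = Q b / 2) {ψ : ℝ → ℝ → ℂ}
    (hψ : ψ ∈ PTensor b (Q b - α₂) α₁) :
    ∃ ρ : ℝ → ℝ → ℂ, (∀ x₂ x₁, HasRefl b (Q b - α₂) (fun x => ψ x x₁) x₂ (ρ x₂ x₁)) ∧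
      ∀ x₃ : ℝ, ∃ l, HasCG b α₃ (Q b - α₂) α₁ ψ x₃ l ∧ HasCG b α₃ α₂ α₁ ρ x₃ l := by
  induction hψ using Submodule.span_induction with
  | mem ψ h =>
    obtain ⟨f, hf, g, hg, rfl⟩ := h
    obtain ⟨B, F, G, hF, hG, hfF, hgG⟩ := exists_stripBounded_pair hb hf hg
    obtain ⟨r, hr, hcg⟩ := weyl_two hb hsin h₁ h₂ h₃ (by positivity) hF hG hfF hgG
    refine ⟨fun x₂ x₁ => r x₂ * g x₁, fun x₂ x₁ => ?_, hcg⟩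
    have := (hr x₂).smul (g x₁)
    rw [mul_comm] at this
    convert this using 1
    funext x
    exact mul_comm _ _
  | zero => exact ⟨0, fun _ _ => HasRefl.zero, fun _ => ⟨0, HasCG.zero, HasCG.zero⟩⟩
  | add ψ ψ' _ _ h h' =>
    obtain ⟨ρ, hr, hc⟩ := h
    obtain ⟨ρ', hr', hc'⟩ := h'
    refine ⟨ρ + ρ', fun x₂ x₁ => (hr x₂ x₁).add (hr' x₂ x₁), fun x₃ => ?_⟩
    obtain ⟨l, h1, h2⟩ := hc x₃
    obtain ⟨l', h1', h2'⟩ := hc' x₃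
    exact ⟨l + l', h1.add h1', h2.add h2'⟩
  | smul a ψ _ h =>
    obtain ⟨ρ, hr, hc⟩ := h
    refine ⟨a • ρ, fun x₂ x₁ => (hr x₂ x₁).smul a, fun x₃ => ?_⟩
    obtain ⟨l, h1, h2⟩ := hc x₃
    exact ⟨a * l, h1.smul a, h2.smul a⟩

theorem weyl_three_of_mem (hb : 0 < b) (hsin : Real.sin (Real.pi * b ^ 2) ≠ 0)
    (h₁ : α₁.re = Q b / 2) (h₂ : α₂.re = Q b / 2) (h₃ : α₃.re = Q b / 2) {ψ : ℝ → ℝ → ℂ}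
    (hψ : ψ ∈ PTensor b α₂ α₁) :
    ∃ h r : ℝ → ℂ, (∀ x₃, HasCG b α₃ α₂ α₁ ψ x₃ (h x₃)) ∧
      ∀ x₃, HasRefl b α₃ h x₃ (r x₃) ∧ HasCG b (Q b - α₃) α₂ α₁ ψ x₃ (r x₃) := by
  induction hψ using Submodule.span_induction with
  | mem ψ h =>
    obtain ⟨f, hf, g, hg, rfl⟩ := h
    obtain ⟨B, F, G, hF, hG, hfF, hgG⟩ := exists_stripBounded_pair hb hf hg
    exact weyl_three hb hsin h₁ h₂ h₃ (by positivity) hF hG hfF hgG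
  | zero =>
    exact ⟨0, 0, fun _ => HasCG.zero, fun _ => ⟨HasRefl.zero, HasCG.zero⟩⟩
  | add ψ ψ' _ _ h h' =>
    obtain ⟨u, r, hu, hr⟩ := h
    obtain ⟨u', r', hu', hr'⟩ := h'
    exact ⟨u + u', r + r', fun x => (hu x).add (hu' x),
      fun x => ⟨(hr x).1.add (hr' x).1, (hr x).2.add (hr' x).2⟩⟩
  | smul a ψ _ h =>
    obtain ⟨u, r, hu, hr⟩ := h
    exact ⟨a • u, a • r, fun x => (hu x).smul a, fun x => ⟨(hr x).1.smul a, (hr x).2.smul a⟩⟩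

end

end ModularDouble

end

theorem mainTheorem3 (b : ℝ) (hb : 0 < b) (hsin : Real.sin (Real.pi * b ^ 2) ≠ 0) :
    -- the three Weyl-invariance relations, on the algebraic tensor products of the `P_α`
    (∀ α₁ α₂ α₃ : ℂ, α₁.re = Q b / 2 → α₂.re = Q b / 2 → α₃.re = Q b / 2 →
      (∀ ψ ∈ PTensor b α₂ (Q b - α₁),
        (∀ x₂ x₁ : ℝ, ReflConverges b (Q b - α₁) (fun x => ψ x₂ x) x₁) ∧
        ∀ x₃ : ℝ,
          CGConverges b α₃ α₂ α₁ (refl₁ b (Q b - α₁) ψ) x₃ ∧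
          CGConverges b α₃ α₂ (Q b - α₁) ψ x₃ ∧
          cgMap b α₃ α₂ α₁ (refl₁ b (Q b - α₁) ψ) x₃ = cgMap b α₃ α₂ (Q b - α₁) ψ x₃) ∧
      (∀ ψ ∈ PTensor b (Q b - α₂) α₁,
        (∀ x₂ x₁ : ℝ, ReflConverges b (Q b - α₂) (fun x => ψ x x₁) x₂) ∧
        ∀ x₃ : ℝ,
          CGConverges b α₃ α₂ α₁ (refl₂ b (Q b - α₂) ψ) x₃ ∧
          CGConverges b α₃ (Q b - α₂) α₁ ψ x₃ ∧
          cgMap b α₃ α₂ α₁ (refl₂ b (Q b - α₂) ψ) x₃ = cgMap b α₃ (Q b - α₂) α₁ ψ x₃) ∧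
      (∀ ψ ∈ PTensor b α₂ α₁,
        (∀ x₃ : ℝ, CGConverges b α₃ α₂ α₁ ψ x₃) ∧
        ∀ x₃ : ℝ,
          ReflConverges b α₃ (cgMap b α₃ α₂ α₁ ψ) x₃ ∧
          CGConverges b (Q b - α₃) α₂ α₁ ψ x₃ ∧
          reflOp b α₃ (cgMap b α₃ α₂ α₁ ψ) x₃ = cgMap b (Q b - α₃) α₂ α₁ ψ x₃)) ∧
    -- the kernel identity, wherever the real line separates the two families of poles
    (∀ α₁ α₂ α₃ x₁ x₂ x₃ : ℂ,
      0 < (Q b - (α₁ + α₂) / 2 - α₃ - Complex.I * x₂).re →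
      0 < (Q b - (α₁ + α₂) / 2 + Complex.I * x₂).re →
      0 < ((α₃ - α₁) / 2 - Complex.I * x₃).re →
      0 < (α₂ + (α₃ - α₁) / 2 + Complex.I * x₃).re →
      0 < (α₁ - Q b / 2 - Complex.I * x₁).re →
      0 < (α₁ - Q b / 2 + Complex.I * x₁).re →
      MeasureTheory.Integrable (fun y : ℝ =>
        cgAn b α₃ α₂ α₁ x₃ x₂ y * D b (-Complex.I * (Q b - α₁)) (y - x₁)) ∧
      Sb b (2 * (Q b - α₁))
          * ∫ y : ℝ, cgAn b α₃ α₂ α₁ x₃ x₂ y * D b (-Complex.I * (Q b - α₁)) (y - x₁)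
        = Sb b (α₂ + α₃ - α₁) * Sb b (2 * Q b - α₁ - α₂ - α₃)
          * cgAn b α₃ α₂ (Q b - α₁) x₃ x₂ x₁) := by
  refine ⟨fun α₁ α₂ α₃ h₁ h₂ h₃ => ⟨fun ψ hψ => ?_, fun ψ hψ => ?_, fun ψ hψ => ?_⟩,
    fun α₁ α₂ α₃ x₁ x₂ x₃ => kernel_identity hb⟩
  · obtain ⟨ρ, hr, hc⟩ := weyl_one_of_mem hb hsin h₁ h₂ h₃ hψ
    have hρ : refl₁ b (Q b - α₁) ψ = ρ := by
      funext x₂ x₁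
      exact (hr x₂ x₁).reflOp_eq
    refine ⟨fun x₂ x₁ => (hr x₂ x₁).converges, fun x₃ => ?_⟩
    obtain ⟨l, hl, hl'⟩ := hc x₃
    rw [hρ]
    exact ⟨hl'.converges, hl.converges, hl'.cgMap_eq.trans hl.cgMap_eq.symm⟩
  · obtain ⟨ρ, hr, hc⟩ := weyl_two_of_mem hb hsin h₁ h₂ h₃ hψ
    have hρ : refl₂ b (Q b - α₂) ψ = ρ := by
      funext x₂ x₁
      exact (hr x₂ x₁).reflOp_eq
    refine ⟨fun x₂ x₁ => (hr x₂ x₁).converges, fun x₃ => ?_⟩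
    obtain ⟨l, hl, hl'⟩ := hc x₃
    rw [hρ]
    exact ⟨hl'.converges, hl.converges, hl'.cgMap_eq.trans hl.cgMap_eq.symm⟩
  · obtain ⟨h, r, hh, hr⟩ := weyl_three_of_mem hb hsin h₁ h₂ h₃ hψ
    have hch : cgMap b α₃ α₂ α₁ ψ = h := funext fun x => (hh x).cgMap_eq
    refine ⟨fun x₃ => (hh x₃).converges, fun x₃ => ?_⟩
    rw [hch]
    exact ⟨(hr x₃).1.converges, (hr x₃).2.converges,
      (hr x₃).1.reflOp_eq.trans (hr x₃).2.cgMap_eq.symm⟩
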